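/- Let $M$ be a compact smooth oriented surface with (possibly empty) boundary $\partial M$, smoothly immersed in $\mathbb{R}^3$ (for instance an embedded surface $M\subset\mathbb{R}^3$), with continuous unit normal field $n$, and let $\partial M$ carry the induced orientation: if $T$ is its positive tangent, then $n\times T$ points into $M$. Let $p\in\mathbb{R}^3$ be a point not on $M$, let $S^2_p$ be the unit sphere centred at $p$, and let $\pi(y)=p+\frac{y-p}{|y-p|}$ be the radial projection onto it. For $q\in S^2_p$ let $\chi(q)=\sum_j \mathrm{Sign}\big((q-p)\cdot n(r_j)\big)$ be the number of signed intersections, where $r_j$ runs over the points of $M$ on the ray from $p$ through $q$ (for an immersed surface, counted in the parameter surface); this sum is finite for almost every $q$. The regions are the connected components of $S^2_p\setminus\pi(\partial M)$. Let $A\neq B$ be two regions that share a common edge $E$: a nonempty relatively open subset $E$ of $\pi(\partial M)$ that is contained in the closure of $A$ and in the closure of $B$, and over which the projected boundary is traversed exactly once (each point of $E$ is the projection of exactly one point of $\partial M$). Then there are integers $\chi_A,\chi_B$ such that $\chi=\chi_A$ almost everywhere on $A$ and $\chi=\chi_B$ almost everywhere on $B$, and $$|\chi_A-\chi_B|=1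 .$$ Moreover, the sign is fixed by the orientation of the projected boundary curve: at every point $q\in E$ at which the projected boundary has a nonzero positively oriented tangent vector $\tau$, the in-plane normal $m=(q-p)\times\tau$ (the cross product of the outward normal of the sphere and $\tau$) points from the region with the smaller constant into the region with the larger one, that is, for all sufficiently small $\varepsilon>0$ the point $\pi(q+\varepsilon m)$ lies in the region with the larger constant and $\pi(q-\varepsilon m)$ in the region with the smaller one. -/

import Mathlib

open Set Filter Topology MeasureTheory
open scoped Manifold ContDiff

noncomputable section

/-- Euclidean three-space. -/
abbrev E3 : Type := EuclideanSpace ℝ (Fin 3)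

/-- The cross product of `ℝ³`. -/
def cross (u v : E3) : E3 := WithLp.toLp 2 (crossProduct u.ofLp v.ofLp)

/-- `f : N → ℝ³` is a smooth immersion of the smooth surface with boundary `N`, and `ν` is a
continuous field of unit normals along it (the orientation). An embedded surface `M ⊂ ℝ³` is the
case in which `f` is the inclusion. -/
structure IsOrientedSurface {N : Type*} [TopologicalSpace N]
    [ChartedSpace (EuclideanHalfSpace 2) N] (f ν : N → E3) : Prop where
  smooth : ContMDiff (𝓡∂ 2) 𝓘(ℝ, E3) ∞ f
  immersion : ∀ x : N, Function.Injective (mfderiv (𝓡∂ 2) 𝓘(ℝ, E3) f x)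
  normal_continuous : Continuous ν
  normal_unit : ∀ x : N, ‖ν x‖ = 1
  normal_orthogonal : ∀ (x : N) (v : TangentSpace (𝓡∂ 2) x),
    inner ℝ (ν x) (mfderiv (𝓡∂ 2) 𝓘(ℝ, E3) f x v : E3) = 0

/-- Radial projection of `ℝ³ ∖ {p}` onto the unit sphere `Metric.sphere p 1`. -/
def sphereProj (p y : E3) : E3 := p + ‖y - p‖⁻¹ • (y - p)

/-- Surface area on the unit sphere centred at `p`, as a measure on `ℝ³`. -/
def sphereArea (p : E3) : Measure E3 :=
  Measure.map (fun u : Metric.sphere (0 : E3) 1 => p + (u : E3)) (volume : Measure E3).toSphere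

/-- The parameters of the intersection points of the surface with the ray from `p` through `q`. -/
def rayHits {N : Type*} (f : N → E3) (p q : E3) : Set N :=
  {x | ∃ t : ℝ, 0 ≤ t ∧ f x = p + t • (q - p)}

/-- The number of signed intersections of the ray from `p` through `q` with the surface:
`+1` for each hit from the back, `-1` for each hit from the front, `0` for a tangency. -/
def signedCount {N : Type*} (f ν : N → E3) (p q : E3) : ℤ :=
  ∑ᶠ x ∈ rayHits f p q, (SignType.sign (inner ℝ (q - p) (ν x) : ℝ) : ℤ)

/-- The projection of the boundary of the surface onto the unit sphere centred at `p`. -/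
def projBoundary {N : Type*} [TopologicalSpace N] [ChartedSpace (EuclideanHalfSpace 2) N]
    (f : N → E3) (p : E3) : Set E3 :=
  (fun x => sphereProj p (f x)) '' (𝓡∂ 2).boundary N

/-- `A` is one of the regions (connected components) into which the projected boundary splits
the unit sphere centred at `p`. -/
def IsRegion {N : Type*} [TopologicalSpace N] [ChartedSpace (EuclideanHalfSpace 2) N]
    (f : N → E3) (p : E3) (A : Set E3) : Prop :=
  ∃ q ∈ Metric.sphere p 1 \ projBoundary f p,
    A = connectedComponentIn (Metric.sphere p 1 \ projBoundary f p) q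

/-- The signed count equals the integer `k` almost everywhere on `A`. -/
def IsCountOn {N : Type*} (f ν : N → E3) (p : E3) (A : Set E3) (k : ℤ) : Prop :=
  ∀ᵐ q ∂(sphereArea p), q ∈ A → signedCount f ν p q = k

/-- `E` is a common edge of `A` and `B`: a nonempty relatively open piece of the projected
boundary which lies on the frontiers of both `A` and `B` and which the projected boundary
traverses only once (it is not an overlap of several boundary arcs). -/
structure IsCommonEdge {N : Type*} [TopologicalSpace N] [ChartedSpace (EuclideanHalfSpace 2) N]
    (f : N → E3) (p : E3) (A B E : Set E3) : Prop where
  nonempty : E.Nonempty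
  relOpen : ∃ U : Set E3, IsOpen U ∧ E = projBoundary f p ∩ U
  once : ∀ x ∈ (𝓡∂ 2).boundary N, ∀ y ∈ (𝓡∂ 2).boundary N,
    sphereProj p (f x) ∈ E → sphereProj p (f x) = sphereProj p (f y) → x = y
  subset_left : E ⊆ closure A
  subset_right : E ⊆ closure B

/-- At a boundary point `x`, `v` is a nonzero tangent vector of the boundary in its positive
direction: `ν × T`, with `T` the image of `v` in `ℝ³`, points into the surface (the surface lies
to the left of its boundary). In the half-plane chart at `x`, the boundary directions are those
with first coordinate `0` and the inward ones are those with positive first coordinate. -/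
def IsPosBoundaryTangent {N : Type*} [TopologicalSpace N] [ChartedSpace (EuclideanHalfSpace 2) N]
    (f ν : N → E3) (x : N) (v : EuclideanSpace ℝ (Fin 2)) : Prop :=
  v 0 = 0 ∧ ∃ w : EuclideanSpace ℝ (Fin 2), 0 < w 0 ∧
    cross (ν x) (mfderiv (𝓡∂ 2) 𝓘(ℝ, E3) f x v) = mfderiv (𝓡∂ 2) 𝓘(ℝ, E3) f x w

/-- The tangent of the projected boundary curve: the image of the tangent vector `v` under the
differential of the surface followed by the radial projection. -/
def projTangent {N : Type*} [TopologicalSpace N] [ChartedSpace (EuclideanHalfSpace 2) N]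
    (f : N → E3) (p : E3) (x : N) (v : EuclideanSpace ℝ (Fin 2)) : E3 :=
  fderiv ℝ (sphereProj p) (f x) (mfderiv (𝓡∂ 2) 𝓘(ℝ, E3) f x v)

/-- At the point `q` of the unit sphere centred at `p`, the tangent direction `m` points from the
region `B` into the region `A`. -/
def PointsFromInto (p q m : E3) (B A : Set E3) : Prop :=
  ∀ᶠ ε : ℝ in 𝓝[>] 0, sphereProj p (q + ε • m) ∈ A ∧ sphereProj p (q - ε • m) ∈ B

end

/-! An orthonormal frame a gives gnomonic coordinates y₁, y₂ on the open half-space where ⟨a₀, ·⟩ >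
0; they turn the rays from p in it into points of a plane. For test functions α, β on the line, the
form α(y₁)β(y₂) dy₁∧dy₂ pulls back to the surface as the density `flux`, which a functional J
integrates against area. The theorem follows from evaluating J(flux α β) in two ways.

Locally: around a direction y that is off the projected boundary and not tangent to the surface, the
fibre is finite, each of its points has a sheet on which (y₁, y₂) are coordinates, and the change of
variables gives J(flux α β) = χ(y) ∫α ∫β when α, β are concentrated near y
(`IsAreaIntegral.exists_concentration`).

Globally: α'(y₁)β(y₂) dy₁∧dy₂ = d(αβ)∧dy₂ is exact, so Stokes makes its integral vanish whenever αβ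
vanishes on the boundary of the surface (`IsAreaIntegral.bracket_eq_zero`). A test function on an
interval is a derivative plus its integral times a fixed bump; hence on a box free of projected
boundary J(flux α β) = κ ∫α ∫β for one constant κ (`IsAreaIntegral.exists_degree`). So χ = κ at
every transversal direction of the box. Tangent directions form a null set, by a Sard argument for
the cone over the surface (`IsOrientedSurface.volume_badCone`); transversal directions are therefore
dense, the local constants agree on overlaps, and connectedness makes χ constant almost everywhere
on a region (`IsOrientedSurface.exists_region_count`).

For the jump, let the frame have a₂ along the projected tangent τ and centre a box at the edge
point. Because the edge is traversed once, compactness makes the projected boundary in a small box a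
single arc, monotone in y₂ and close to y₁ = 0 (`IsOrientedSurface.exists_isBoundaryBox`). Take A' =
L − R, with unit bumps L to the left of the arc and R to its right, so that A = 1 along the arc. The
local evaluation gives J(flux A' β) = (χ_left − χ_right) ∫β, whereas Stokes leaves the boundary term
∫β (`IsBoundaryBox.flux_deriv`). Hence χ_left − χ_right = 1 (`IsBoundaryBox.count_eq_add_one`). The
left is the side of −a₁, which is the direction of (q − p) × τ. A point of the edge with nonzero
tangent exists, for otherwise the projected boundary would be locally constant and not traversed
once (`IsOrientedSurface.exists_projTangent_ne_zero`). -/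

noncomputable section

/-! ### Linear algebra: wedge and triple products -/

/-- The Euclidean plane. -/
abbrev E2 : Type := EuclideanSpace ℝ (Fin 2)

/-- First standard basis vector of the plane. -/
abbrev bv0 : E2 := EuclideanSpace.single 0 1

/-- Second standard basis vector of the plane. -/
abbrev bv1 : E2 := EuclideanSpace.single 1 1

theorem E2.eq_sum (z : E2) : z = z 0 • bv0 + z 1 • bv1 := by
  ext i; fin_cases i <;> simp

theorem det_plane (A : E2 →L[ℝ] E2) :
    A.det = A bv0 0 * A bv1 1 - A bv0 1 * A bv1 0 := by
  have h := LinearMap.det_toMatrix (EuclideanSpace.basisFun (Fin 2) ℝ).toBasis (A : E2 →ₗ[ℝ] E2)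
  rw [ContinuousLinearMap.det, ← h, Matrix.det_fin_two]
  simp [LinearMap.toMatrix_apply]
  ring

/-- The wedge product of two linear forms, evaluated on the standard basis. -/
def wedge (a b : E2 →L[ℝ] ℝ) : ℝ := a bv0 * b bv1 - a bv1 * b bv0

theorem wedge_comp (a b : E2 →L[ℝ] ℝ) (A : E2 →L[ℝ] E2) :
    wedge (a ∘L A) (b ∘L A) = A.det * wedge a b := by
  have h0 := E2.eq_sum (A bv0)
  have h1 := E2.eq_sum (A bv1)
  rw [det_plane]
  simp only [wedge, ContinuousLinearMap.comp_apply]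
  rw [show a (A bv0) = A bv0 0 * a bv0 + A bv0 1 * a bv1 by conv_lhs => rw [h0]; simp,
    show a (A bv1) = A bv1 0 * a bv0 + A bv1 1 * a bv1 by conv_lhs => rw [h1]; simp,
    show b (A bv0) = A bv0 0 * b bv0 + A bv0 1 * b bv1 by conv_lhs => rw [h0]; simp,
    show b (A bv1) = A bv1 0 * b bv0 + A bv1 1 * b bv1 by conv_lhs => rw [h1]; simp]
  ring

theorem inner_E3 (u v : E3) : inner ℝ u v = u 0 * v 0 + u 1 * v 1 + u 2 * v 2 := by
  simp [PiLp.inner_apply, Fin.sum_univ_three]; ring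

theorem cross_zero (u v : E3) : cross u v 0 = u 1 * v 2 - u 2 * v 1 := by
  simp [cross, crossProduct]

theorem cross_one (u v : E3) : cross u v 1 = u 2 * v 0 - u 0 * v 2 := by
  simp [cross, crossProduct]

theorem cross_two (u v : E3) : cross u v 2 = u 0 * v 1 - u 1 * v 0 := by
  simp [cross, crossProduct]

/-- The triple product of `n` with the images of the standard basis under `D`. -/
def vol (n : E3) (D : E2 →L[ℝ] E3) : ℝ := inner ℝ n (cross (D bv0) (D bv1))

theorem vol_comp (n : E3) (D : E2 →L[ℝ] E3) (A : E2 →L[ℝ] E2) :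
    vol n (D ∘L A) = A.det * vol n D := by
  have h0 := E2.eq_sum (A bv0)
  have h1 := E2.eq_sum (A bv1)
  rw [det_plane]
  simp only [vol, ContinuousLinearMap.comp_apply]
  rw [show D (A bv0) = A bv0 0 • D bv0 + A bv0 1 • D bv1 by conv_lhs => rw [h0]; simp,
    show D (A bv1) = A bv1 0 • D bv0 + A bv1 1 • D bv1 by conv_lhs => rw [h1]; simp]
  simp only [inner_E3, cross_zero, cross_one, cross_two, PiLp.add_apply, PiLp.smul_apply,
    smul_eq_mul]
  ring

/-- Both u and v are orthogonal to the unit vector n, so u × v is a multiple of n, with coefficient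
the triple product. This is how the unit normal enters the Jacobian of the radial projection. -/
theorem inner_cross_of_orthogonal {n u v : E3} (hn : ‖n‖ = 1) (hu : inner ℝ n u = 0)
    (hv : inner ℝ n v = 0) (w : E3) :
    inner ℝ w (cross u v) = inner ℝ w n * inner ℝ n (cross u v) := by
  have hn' : inner ℝ n n = (1 : ℝ) := by rw [real_inner_self_eq_norm_sq, hn]; norm_num
  simp only [inner_E3, cross_zero, cross_one, cross_two] at *
  have e0 : (u 1 * v 2 - u 2 * v 1) = n 0 * (n 0 * (u 1 * v 2 - u 2 * v 1)
      + n 1 * (u 2 * v 0 - u 0 * v 2) + n 2 * (u 0 * v 1 - u 1 * v 0)) := by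
    linear_combination (-(u 1 * v 2 - u 2 * v 1)) * hn' + (n 1 * v 2 - n 2 * v 1) * hu
      - (n 1 * u 2 - n 2 * u 1) * hv
  have e1 : (u 2 * v 0 - u 0 * v 2) = n 1 * (n 0 * (u 1 * v 2 - u 2 * v 1)
      + n 1 * (u 2 * v 0 - u 0 * v 2) + n 2 * (u 0 * v 1 - u 1 * v 0)) := by
    linear_combination (-(u 2 * v 0 - u 0 * v 2)) * hn' + (n 2 * v 0 - n 0 * v 2) * hu
      - (n 2 * u 0 - n 0 * u 2) * hv
  have e2 : (u 0 * v 1 - u 1 * v 0) = n 2 * (n 0 * (u 1 * v 2 - u 2 * v 1)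
      + n 1 * (u 2 * v 0 - u 0 * v 2) + n 2 * (u 0 * v 1 - u 1 * v 0)) := by
    linear_combination (-(u 0 * v 1 - u 1 * v 0)) * hn' + (n 0 * v 1 - n 1 * v 0) * hu
      - (n 0 * u 1 - n 1 * u 0) * hv
  linear_combination (w 0) * e0 + (w 1) * e1 + (w 2) * e2

/-- A zero triple product forces u × v = 0. By Lagrange's identity the vector |v|²u − ⟨u,v⟩v has
squared norm |v|²|u × v|² = 0, so injectivity of D gives |v|² = 0, which is again impossible. -/
theorem vol_ne_zero {n : E3} {D : E2 →L[ℝ] E3} (hD : Function.Injective D) (hn : ‖n‖ = 1)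
    (hnD : ∀ v, inner ℝ n (D v) = 0) : vol n D ≠ 0 := by
  intro h
  set u := D bv0 with hu
  set v := D bv1 with hv
  have hc : inner ℝ (cross u v) (cross u v) = (0 : ℝ) := by
    rw [inner_cross_of_orthogonal hn (hnD bv0) (hnD bv1)]
    rw [vol] at h
    rw [h, mul_zero]
  have hw : D ((inner ℝ v v : ℝ) • bv0 - (inner ℝ u v : ℝ) • bv1) = 0 := by
    rw [map_sub, map_smul, map_smul, ← hu, ← hv, ← inner_self_eq_zero (𝕜 := ℝ)]
    have : inner ℝ ((inner ℝ v v : ℝ) • u - (inner ℝ u v : ℝ) • v)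
        ((inner ℝ v v : ℝ) • u - (inner ℝ u v : ℝ) • v)
        = (inner ℝ v v : ℝ) * inner ℝ (cross u v) (cross u v) := by
      simp only [inner_E3, cross_zero, cross_one, cross_two, PiLp.sub_apply, PiLp.smul_apply,
        smul_eq_mul]
      ring
    rw [this, hc, mul_zero]
  have h0 := hD (hw.trans (map_zero D).symm)
  have h1 : inner ℝ v v = (0 : ℝ) := by simpa using congrArg (fun z : E2 => z 0) h0
  have h2 : v = 0 := inner_self_eq_zero.1 h1
  have h3 := hD ((hv.symm.trans h2).trans (map_zero D).symm)
  simpa using congrArg (fun z : E2 => z 1) h3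

/-! ### Frames and gnomonic coordinates -/

/-- A positively oriented orthonormal frame of three-space. -/
structure IsFrame (a : Fin 3 → E3) : Prop where
  orthonormal : Orthonormal ℝ a
  pos : inner ℝ (a 0) (cross (a 1) (a 2)) = (1 : ℝ)

/-- Gnomonic coordinates attached to a frame. -/
def gno (a : Fin 3 → E3) (i : Fin 3) (w : E3) : ℝ := inner ℝ (a i) w / inner ℝ (a 0) w

theorem IsFrame.inner_eq {a : Fin 3 → E3} (ha : IsFrame a) (i j : Fin 3) :
    inner ℝ (a i) (a j) = if i = j then (1 : ℝ) else 0 :=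
  orthonormal_iff_ite.1 ha.orthonormal i j

theorem IsFrame.eq_sum {a : Fin 3 → E3} (ha : IsFrame a) (w : E3) :
    w = (inner ℝ (a 0) w : ℝ) • a 0 + (inner ℝ (a 1) w : ℝ) • a 1
      + (inner ℝ (a 2) w : ℝ) • a 2 := by
  let b := basisOfOrthonormalOfCardEqFinrank ha.orthonormal (by simp)
  have hb : ⇑b = a := coe_basisOfOrthonormalOfCardEqFinrank _ _
  let o : OrthonormalBasis (Fin 3) ℝ E3 := b.toOrthonormalBasis (by rw [hb]; exact ha.orthonormal)
  have ho : ⇑o = a := by simp [o, hb]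
  have := o.sum_repr' w
  rw [Fin.sum_univ_three, ho] at this
  exact this.symm

/-- Multiplicativity of determinants: det(w, u, v) · det(a₀, a₁, a₂) is the determinant of the
matrix of inner products, and the second factor is 1. -/
theorem IsFrame.triple {a : Fin 3 → E3} (ha : IsFrame a) (w u v : E3) :
    inner ℝ w (cross u v) =
      inner ℝ (a 0) w * (inner ℝ (a 1) u * inner ℝ (a 2) v - inner ℝ (a 2) u * inner ℝ (a 1) v)
      - inner ℝ (a 1) w * (inner ℝ (a 0) u * inner ℝ (a 2) v - inner ℝ (a 2) u * inner ℝ (a 0) v)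
      + inner ℝ (a 2) w *
        (inner ℝ (a 0) u * inner ℝ (a 1) v - inner ℝ (a 1) u * inner ℝ (a 0) v) := by
  have h := ha.pos
  rw [← mul_one (inner ℝ w (cross u v)), ← h]
  simp only [inner_E3, cross_zero, cross_one, cross_two]
  ring

/-- A unit vector and a nonzero vector orthogonal to it determine a frame. -/
theorem isFrame_of {e t : E3} (he : ‖e‖ = 1) (ht : ‖t‖ = 1) (het : inner ℝ e t = (0 : ℝ)) :
    IsFrame ![e, cross t e, t] := by
  have he' : inner ℝ e e = (1 : ℝ) := by rw [real_inner_self_eq_norm_sq, he]; norm_num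
  have ht' : inner ℝ t t = (1 : ℝ) := by rw [real_inner_self_eq_norm_sq, ht]; norm_num
  have hc : inner ℝ (cross t e) (cross t e) = (1 : ℝ) := by
    have : inner ℝ (cross t e) (cross t e)
        = inner ℝ t t * inner ℝ e e - (inner ℝ e t : ℝ) ^ 2 := by
      simp only [inner_E3, cross_zero, cross_one, cross_two]; ring
    rw [this, he', ht', het]; norm_num
  have h1 : inner ℝ e (cross t e) = (0 : ℝ) := by
    simp only [inner_E3, cross_zero, cross_one, cross_two]; ring
  have h2 : inner ℝ t (cross t e) = (0 : ℝ) := by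
    simp only [inner_E3, cross_zero, cross_one, cross_two]; ring
  have hcn : ‖cross t e‖ = 1 :=
    (pow_eq_one_iff_of_nonneg (norm_nonneg _) two_ne_zero).1
      ((real_inner_self_eq_norm_sq _).symm.trans hc)
  refine ⟨orthonormal_iff_ite.2 ?_, ?_⟩
  · intro i j
    fin_cases i <;> fin_cases j <;>
      simp [he, ht, het, h1, h2, hcn, real_inner_comm]
  · have : inner ℝ e (cross (cross t e) t) = inner ℝ e e * inner ℝ t t - (inner ℝ e t : ℝ) ^ 2 := by
      simp only [inner_E3, cross_zero, cross_one, cross_two]; ring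
    simpa [he, ht, het] using this

theorem exists_isFrame {e : E3} (he : ‖e‖ = 1) : ∃ a, IsFrame a ∧ a 0 = e := by
  obtain ⟨t, ht, het⟩ : ∃ t : E3, ‖t‖ = 1 ∧ inner ℝ e t = (0 : ℝ) := by
    have hr : 0 < Module.finrank ℝ (ℝ ∙ e)ᗮ := by
      have h1 := Submodule.finrank_add_finrank_orthogonal (ℝ ∙ e)
      have h2 : Module.finrank ℝ (ℝ ∙ e) = 1 :=
        finrank_span_singleton (norm_ne_zero_iff.1 (he.trans_ne one_ne_zero))
      have h3 : Module.finrank ℝ E3 = 3 := by simp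
      omega
    have : Nontrivial (ℝ ∙ e)ᗮ := Module.finrank_pos_iff.1 hr
    obtain ⟨t, ht⟩ := exists_norm_eq (ℝ ∙ e)ᗮ (zero_le_one (α := ℝ))
    exact ⟨t, ht, Submodule.mem_orthogonal_singleton_iff_inner_right.1 t.2⟩
  exact ⟨_, isFrame_of he ht het, rfl⟩

theorem gno_smul (a : Fin 3 → E3) (i : Fin 3) {r : ℝ} (hr : r ≠ 0) (w : E3) :
    gno a i (r • w) = gno a i w := by
  simp only [gno, inner_smul_right]
  exact mul_div_mul_left _ _ hr

theorem IsFrame.eq_smul {a : Fin 3 → E3} (ha : IsFrame a) {w : E3} (hw : inner ℝ (a 0) w ≠ (0 : ℝ)) :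
    w = (inner ℝ (a 0) w : ℝ) • (a 0 + gno a 1 w • a 1 + gno a 2 w • a 2) := by
  conv_lhs => rw [ha.eq_sum w]
  simp only [gno, smul_add, smul_smul]
  rw [mul_div_cancel₀ _ hw, mul_div_cancel₀ _ hw]

theorem sphereProj_sub_norm {p y : E3} (h : y ≠ p) : ‖sphereProj p y - p‖ = 1 := by
  have : ‖y - p‖ ≠ 0 := by simpa [sub_eq_zero] using h
  simp [sphereProj, norm_smul, this]

theorem sphereProj_eq_iff {p y q : E3} (h : y ≠ p) (hq : ‖q - p‖ = 1) :
    sphereProj p y = q ↔ ∃ t : ℝ, 0 < t ∧ y - p = t • (q - p) := by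
  have hn : 0 < ‖y - p‖ := by simpa [sub_eq_zero] using h
  constructor
  · rintro rfl
    refine ⟨_, hn, ?_⟩
    simp [sphereProj, smul_smul, hn.ne']
  · rintro ⟨t, ht, hy⟩
    rw [sphereProj, hy, norm_smul, hq, Real.norm_of_nonneg ht.le, smul_smul]
    simp [ht.ne']

/-- In gnomonic coordinates, points on a common ray are points with equal coordinates. -/
theorem IsFrame.sphereProj_eq_iff {a : Fin 3 → E3} (ha : IsFrame a) {p y q : E3} (h : y ≠ p)
    (hq : ‖q - p‖ = 1) (hq0 : 0 < (inner ℝ (a 0) (q - p) : ℝ)) :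
    sphereProj p y = q ↔ 0 < (inner ℝ (a 0) (y - p) : ℝ) ∧ gno a 1 (y - p) = gno a 1 (q - p) ∧
      gno a 2 (y - p) = gno a 2 (q - p) := by
  rw [_root_.sphereProj_eq_iff h hq]
  constructor
  · rintro ⟨t, ht, hy⟩
    rw [hy]
    exact ⟨by rw [inner_smul_right]; positivity, gno_smul a 1 ht.ne' _, gno_smul a 2 ht.ne' _⟩
  · rintro ⟨h0, h1, h2⟩
    refine ⟨inner ℝ (a 0) (y - p) * (inner ℝ (a 0) (q - p))⁻¹, by positivity, ?_⟩
    have e1 := ha.eq_smul h0.ne'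
    rw [h1, h2] at e1
    have e2 : (inner ℝ (a 0) (q - p) : ℝ)⁻¹ • (q - p)
        = a 0 + gno a 1 (q - p) • a 1 + gno a 2 (q - p) • a 2 := by
      rw [inv_smul_eq_iff₀ hq0.ne']
      exact ha.eq_smul hq0.ne'
    rw [e1, mul_smul, e2]
    simp only [smul_add, inner_add_right, inner_smul_right, ha.inner_eq]
    simp

/-! ### Surface calculus in charts of the half-plane -/

section Charts

variable {N : Type*} [TopologicalSpace N] [ChartedSpace (EuclideanHalfSpace 2) N]
variable {V : Type*} [NormedAddCommGroup V] [NormedSpace ℝ V]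

/-- The derivative of a vector-valued map on a surface. -/
def md (g : N → V) (x : N) : E2 →L[ℝ] V := mfderiv (𝓡∂ 2) 𝓘(ℝ, V) g x

/-- The derivative of the inverse of the chart at `k`. -/
def chartD (k : N) (z : E2) : E2 →L[ℝ] E2 :=
  mfderivWithin 𝓘(ℝ, E2) (𝓡∂ 2) (extChartAt (𝓡∂ 2) k).symm (range (𝓡∂ 2)) z

theorem hasFDerivWithinAt_comp_chart [IsManifold (𝓡∂ 2) ∞ N] {g : N → V} {k : N} {z : E2}
    (hz : z ∈ (extChartAt (𝓡∂ 2) k).target)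
    (hg : MDifferentiableAt (𝓡∂ 2) 𝓘(ℝ, V) g ((extChartAt (𝓡∂ 2) k).symm z)) :
    HasFDerivWithinAt (g ∘ (extChartAt (𝓡∂ 2) k).symm)
      (md g ((extChartAt (𝓡∂ 2) k).symm z) ∘L chartD k z) (range (𝓡∂ 2)) z := by
  have : IsManifold (𝓡∂ 2) 1 N := IsManifold.of_le (n := ∞) (by simp)
  have h1 := (mdifferentiableWithinAt_extChartAt_symm (I := 𝓡∂ 2) hz).hasMFDerivWithinAt
  have h2 := hg.hasMFDerivAt.comp_hasMFDerivWithinAt z h1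
  exact h2.hasFDerivWithinAt

theorem det_chartD_ne_zero [IsManifold (𝓡∂ 2) ∞ N] {k : N} {z : E2}
    (hz : z ∈ (extChartAt (𝓡∂ 2) k).target) : (chartD k z).det ≠ 0 := by
  have : IsManifold (𝓡∂ 2) 1 N := IsManifold.of_le (n := ∞) (by simp)
  obtain ⟨e, he⟩ := isInvertible_mfderivWithin_extChartAt_symm (I := 𝓡∂ 2) hz
  let e' : E2 ≃L[ℝ] E2 := e
  have he' : chartD k z = e'.toContinuousLinearMap := he.symm
  rw [he']
  exact (LinearEquiv.isUnit_det' e'.toLinearEquiv).ne_zero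

theorem fderivWithin_comp_chart [IsManifold (𝓡∂ 2) ∞ N] {g : N → V} {k : N} {z : E2}
    (hz : z ∈ (extChartAt (𝓡∂ 2) k).target)
    (hg : MDifferentiableAt (𝓡∂ 2) 𝓘(ℝ, V) g ((extChartAt (𝓡∂ 2) k).symm z)) :
    fderivWithin ℝ (g ∘ (extChartAt (𝓡∂ 2) k).symm) (range (𝓡∂ 2)) z =
      md g ((extChartAt (𝓡∂ 2) k).symm z) ∘L chartD k z :=
  (hasFDerivWithinAt_comp_chart hz hg).fderivWithin
    ((𝓡∂ 2).uniqueDiffOn z (extChartAt_target_subset_range k hz))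

theorem contDiffOn_comp_chart [IsManifold (𝓡∂ 2) ∞ N] {g : N → V} (k : N)
    (hg : ContMDiff (𝓡∂ 2) 𝓘(ℝ, V) ∞ g) :
    ContDiffOn ℝ ∞ (g ∘ (extChartAt (𝓡∂ 2) k).symm) (extChartAt (𝓡∂ 2) k).target := by
  have := hg.comp_contMDiffOn (contMDiffOn_extChartAt_symm (I := 𝓡∂ 2) (n := ∞) k)
  exact this.contDiffOn

theorem extChartAt_target_relOpen (k : N) :
    ∃ O : Set E2, IsOpen O ∧ (extChartAt (𝓡∂ 2) k).target = O ∩ range (𝓡∂ 2) := by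
  refine ⟨(𝓡∂ 2).symm ⁻¹' (chartAt (EuclideanHalfSpace 2) k).target,
    (chartAt _ k).open_target.preimage (𝓡∂ 2).continuous_symm, ?_⟩
  rw [extChartAt_target]

theorem extChartAt_preimage_relOpen (k : N) {U : Set N} (hU : IsOpen U) :
    ∃ O : Set E2, IsOpen O ∧ (extChartAt (𝓡∂ 2) k).target ∩ (extChartAt (𝓡∂ 2) k).symm ⁻¹' U
      = O ∩ range (𝓡∂ 2) := by
  obtain ⟨O₁, hO₁, h₁⟩ := extChartAt_target_relOpen k
  obtain ⟨O₂, hO₂, h₂⟩ := (continuousOn_iff'.1 (continuousOn_extChartAt_symm (I := 𝓡∂ 2) k)) U hU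
  refine ⟨O₂ ∩ O₁, hO₂.inter hO₁, ?_⟩
  rw [inter_comm, h₂, h₁, inter_assoc]

theorem measurableSet_chart_preimage (k : N) {U : Set N} (hU : IsOpen U) :
    MeasurableSet ((extChartAt (𝓡∂ 2) k).target ∩ (extChartAt (𝓡∂ 2) k).symm ⁻¹' U) := by
  obtain ⟨O, hO, h⟩ := extChartAt_preimage_relOpen k hU
  rw [h]
  exact hO.measurableSet.inter (𝓡∂ 2).isClosed_range.measurableSet

/-- T is relatively open in the half-plane, so the derivative within the half-plane and the
derivative within T agree on T. All orders of smoothness survive up to the edge. -/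
theorem fderivWithin_range_continuousOn {T : Set E2} {O : Set E2} (hO : IsOpen O)
    (hT : T = O ∩ range (𝓡∂ 2)) {g : E2 → V} (hg : ContDiffOn ℝ ∞ g T) :
    ContDiffOn ℝ ∞ (fun z => fderivWithin ℝ g (range (𝓡∂ 2)) z) T := by
  have hu : UniqueDiffOn ℝ T := by
    rw [hT, inter_comm]; exact (𝓡∂ 2).uniqueDiffOn.inter hO
  refine (hg.fderivWithin hu (m := ∞) (by simp)).congr fun z hz => ?_
  rw [hT] at hz ⊢
  rw [inter_comm, fderivWithin_inter (hO.mem_nhds hz.1)]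

theorem md_eq_of_eventuallyEq {g h : N → V} {x : N} (hgh : g =ᶠ[𝓝 x] h) : md g x = md h x :=
  hgh.mfderiv_eq

variable (f ν : N → E3)

/-- The oriented area density of the surface. -/
def omega (x : N) : ℝ := vol (ν x) (md f x)

/-- The area density in the chart at `k`. -/
def areaDensity (k : N) (z : E2) : ℝ :=
  |omega f ν ((extChartAt (𝓡∂ 2) k).symm z)| * |(chartD k z).det|

/-- The area integral over the chart domain at `k`. -/
def chartInt (k : N) (G : N → ℝ) : ℝ :=
  ∫ z in (extChartAt (𝓡∂ 2) k).target, G ((extChartAt (𝓡∂ 2) k).symm z) * areaDensity f ν k z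

/-- The Poisson bracket of two functions with respect to the oriented area. -/
def bracket (u v : N → ℝ) (x : N) : ℝ := wedge (md u x) (md v x) / omega f ν x

variable {f ν}

theorem IsOrientedSurface.omega_ne_zero (hM : IsOrientedSurface f ν) (x : N) :
    omega f ν x ≠ 0 :=
  vol_ne_zero (hM.immersion x) (hM.normal_unit x) (hM.normal_orthogonal x)

theorem IsOrientedSurface.mdiffAt (hM : IsOrientedSurface f ν) (x : N) :
    MDifferentiableAt (𝓡∂ 2) 𝓘(ℝ, E3) f x :=
  (hM.smooth x).mdifferentiableAt (by simp)

variable [IsManifold (𝓡∂ 2) ∞ N]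

/-- The derivative `md f x` is written in the preferred chart at x, which may jump with x. So
`omega` and the determinant of `chartD` need not be continuous separately, but their product is the
oriented area density in the fixed chart k. -/
theorem IsOrientedSurface.vol_chart (hM : IsOrientedSurface f ν) {k : N} {z : E2}
    (hz : z ∈ (extChartAt (𝓡∂ 2) k).target) :
    vol (ν ((extChartAt (𝓡∂ 2) k).symm z))
      (fderivWithin ℝ (f ∘ (extChartAt (𝓡∂ 2) k).symm) (range (𝓡∂ 2)) z) =
      (chartD k z).det * omega f ν ((extChartAt (𝓡∂ 2) k).symm z) := by
  rw [fderivWithin_comp_chart hz (hM.mdiffAt _), vol_comp, omega]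

theorem continuousOn_vol {X : Type*} [TopologicalSpace X] {s : Set X} {n : X → E3}
    {D : X → E2 →L[ℝ] E3} (hn : ContinuousOn n s) (hD : ContinuousOn D s) :
    ContinuousOn (fun x => vol (n x) (D x)) s := by
  have h0 : ContinuousOn (fun x => D x bv0) s := hD.clm_apply continuousOn_const
  have h1 : ContinuousOn (fun x => D x bv1) s := hD.clm_apply continuousOn_const
  have hc : ∀ {w : X → E3} (i : Fin 3), ContinuousOn w s → ContinuousOn (fun x => w x i) s :=
    fun i hw => (EuclideanSpace.proj (𝕜 := ℝ) i).continuous.comp_continuousOn hw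
  simp only [vol, inner_E3, cross_zero, cross_one, cross_two]
  have := hc 0 h0; have := hc 1 h0; have := hc 2 h0
  have := hc 0 h1; have := hc 1 h1; have := hc 2 h1
  have := hc 0 hn; have := hc 1 hn; have := hc 2 hn
  fun_prop

theorem IsOrientedSurface.continuousOn_signedDensity (hM : IsOrientedSurface f ν) (k : N) :
    ContinuousOn (fun z => (chartD k z).det * omega f ν ((extChartAt (𝓡∂ 2) k).symm z))
      (extChartAt (𝓡∂ 2) k).target := by
  obtain ⟨O, hO, hT⟩ := extChartAt_target_relOpen k
  refine ContinuousOn.congr ?_ fun z hz => (hM.vol_chart hz).symm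
  exact continuousOn_vol
    (hM.normal_continuous.comp_continuousOn (continuousOn_extChartAt_symm k))
    (fderivWithin_range_continuousOn hO hT (contDiffOn_comp_chart k hM.smooth)).continuousOn

theorem IsOrientedSurface.continuousOn_areaDensity (hM : IsOrientedSurface f ν) (k : N) :
    ContinuousOn (areaDensity f ν k) (extChartAt (𝓡∂ 2) k).target := by
  refine (hM.continuousOn_signedDensity k).abs.congr fun z _ => ?_
  simp only [areaDensity, abs_mul, mul_comm]

/-- The bracket in a chart. -/
theorem bracket_chart (hM : IsOrientedSurface f ν) {u v : N → ℝ} {k : N} {z : E2}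
    (hz : z ∈ (extChartAt (𝓡∂ 2) k).target)
    (hu : MDifferentiableAt (𝓡∂ 2) 𝓘(ℝ, ℝ) u ((extChartAt (𝓡∂ 2) k).symm z))
    (hv : MDifferentiableAt (𝓡∂ 2) 𝓘(ℝ, ℝ) v ((extChartAt (𝓡∂ 2) k).symm z)) :
    wedge (fderivWithin ℝ (u ∘ (extChartAt (𝓡∂ 2) k).symm) (range (𝓡∂ 2)) z)
      (fderivWithin ℝ (v ∘ (extChartAt (𝓡∂ 2) k).symm) (range (𝓡∂ 2)) z) =
    bracket f ν u v ((extChartAt (𝓡∂ 2) k).symm z) *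
      ((chartD k z).det * omega f ν ((extChartAt (𝓡∂ 2) k).symm z)) := by
  rw [fderivWithin_comp_chart hz hu, fderivWithin_comp_chart hz hv, wedge_comp, bracket]
  have := hM.omega_ne_zero ((extChartAt (𝓡∂ 2) k).symm z)
  field_simp

theorem continuousOn_wedge {X : Type*} [TopologicalSpace X] {s : Set X}
    {a b : X → E2 →L[ℝ] ℝ} (ha : ContinuousOn a s) (hb : ContinuousOn b s) :
    ContinuousOn (fun x => wedge (a x) (b x)) s := by
  simp only [wedge]
  fun_prop

/-- In a fixed chart the bracket is du∧dv divided by the oriented area density. Both are continuous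
there, and the dependence on preferred charts cancels in the quotient. -/
theorem continuous_bracket (hM : IsOrientedSurface f ν) {u v : N → ℝ}
    (hu : ContMDiff (𝓡∂ 2) 𝓘(ℝ, ℝ) ∞ u) (hv : ContMDiff (𝓡∂ 2) 𝓘(ℝ, ℝ) ∞ v) :
    Continuous (bracket f ν u v) := by
  rw [continuous_iff_continuousAt]
  intro x
  set e := extChartAt (𝓡∂ 2) x with he
  obtain ⟨O, hO, hT⟩ := extChartAt_target_relOpen x
  have h1 : ContinuousOn (fun z => bracket f ν u v (e.symm z)) e.target := by
    have := (continuousOn_wedge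
      (fderivWithin_range_continuousOn hO hT (contDiffOn_comp_chart x hu)).continuousOn
      (fderivWithin_range_continuousOn hO hT (contDiffOn_comp_chart x hv)).continuousOn).div
      (hM.continuousOn_signedDensity x) fun z hz =>
        mul_ne_zero (det_chartD_ne_zero hz) (hM.omega_ne_zero _)
    refine this.congr fun z hz => ?_
    have hne := mul_ne_zero (det_chartD_ne_zero hz) (hM.omega_ne_zero (e.symm z))
    simp only [Pi.div_apply]
    rw [bracket_chart hM hz ((hu _).mdifferentiableAt (by simp))
      ((hv _).mdifferentiableAt (by simp)), mul_div_cancel_right₀ _ hne]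
  have h2 : ContinuousOn (fun y => bracket f ν u v (e.symm (e y))) e.source :=
    h1.comp (continuousOn_extChartAt x) e.mapsTo
  have h3 : ContinuousOn (bracket f ν u v) e.source :=
    h2.congr fun y hy => by simp only [e.left_inv hy]
  exact h3.continuousAt (extChartAt_source_mem_nhds x)

/-- The area integral does not depend on the chart. -/
theorem chartInt_eq (k l : N) {G : N → ℝ}
    (hk : ∀ x, G x ≠ 0 → x ∈ (extChartAt (𝓡∂ 2) k).source)
    (hl : ∀ x, G x ≠ 0 → x ∈ (extChartAt (𝓡∂ 2) l).source) :
    chartInt f ν k G = chartInt f ν l G := by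
  set ek := extChartAt (𝓡∂ 2) k with hek
  set el := extChartAt (𝓡∂ 2) l with hel
  set S := ek.target ∩ ek.symm ⁻¹' el.source with hS
  set S' := el.target ∩ el.symm ⁻¹' ek.source with hS'
  have hSm : MeasurableSet S := measurableSet_chart_preimage k (isOpen_extChartAt_source l)
  have hS'm : MeasurableSet S' := measurableSet_chart_preimage l (isOpen_extChartAt_source k)
  set ψ : E2 → E2 := el ∘ ek.symm with hψ
  set ψ' : E2 → E2 →L[ℝ] E2 := fun z => md (el : N → E2) (ek.symm z) ∘L chartD k z with hψ'
  have himg : ψ '' S = S' := by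
    ext w
    constructor
    · rintro ⟨z, ⟨hz1, hz2⟩, rfl⟩
      refine ⟨el.map_source hz2, ?_⟩
      simp only [hψ, mem_preimage, Function.comp_apply]
      rw [el.left_inv hz2]
      exact ek.map_target hz1
    · rintro ⟨hw1, hw2⟩
      refine ⟨ek (el.symm w), ⟨ek.map_source hw2, ?_⟩, ?_⟩
      · simp only [mem_preimage]
        rw [ek.left_inv hw2]
        exact el.map_target hw1
      · simp only [hψ, Function.comp_apply]
        rw [ek.left_inv hw2, el.right_inv hw1]
  have hinj : InjOn ψ S := by
    rintro z ⟨hz1, hz2⟩ w ⟨hw1, hw2⟩ h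
    exact ek.symm.injOn hz1 hw1 (el.injOn hz2 hw2 h)
  have hdiff : ∀ x ∈ el.source, MDifferentiableAt (𝓡∂ 2) 𝓘(ℝ, E2) (el : N → E2) x := by
    intro x hx
    have : IsManifold (𝓡∂ 2) 1 N := IsManifold.of_le (n := ∞) (by simp)
    exact mdifferentiableAt_extChartAt (by rwa [hel, extChartAt_source] at hx)
  have hder : ∀ z ∈ S, HasFDerivWithinAt ψ (ψ' z) S z := fun z hz =>
    (hasFDerivWithinAt_comp_chart hz.1 (hdiff _ hz.2)).mono
      (inter_subset_left.trans (extChartAt_target_subset_range k))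
  -- The Jacobian of the transition map is det(el) · det(`chartD k`), and det(el) is inverse to
  -- det(`chartD l`) because el composed with its inverse is the identity. The factor |omega| is
  -- common to both densities.
  have hdet : ∀ z ∈ S, areaDensity f ν k z = |(ψ' z).det| * areaDensity f ν l (ψ z) := by
    intro z hz
    have hw : ψ z ∈ el.target := el.map_source hz.2
    have hback : el.symm (ψ z) = ek.symm z := el.left_inv hz.2
    have h1 := hasFDerivWithinAt_comp_chart (g := (el : N → E2)) hw
      (by rw [hback]; exact hdiff _ hz.2)
    have h2 : HasFDerivWithinAt ((el : N → E2) ∘ el.symm) (ContinuousLinearMap.id ℝ E2)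
        (range (𝓡∂ 2)) (ψ z) := by
      refine (hasFDerivWithinAt_id _ _).congr_of_eventuallyEq ?_ (el.right_inv hw)
      filter_upwards [extChartAt_target_mem_nhdsWithin_of_mem hw] with y hy using el.right_inv hy
    have h3 := ((𝓡∂ 2).uniqueDiffOn _ (extChartAt_target_subset_range l hw)).eq h1 h2
    have h4 : (md (el : N → E2) (ek.symm z)).det * (chartD l (ψ z)).det = 1 := by
      have := congrArg ContinuousLinearMap.det h3
      rw [← hel, hback] at this
      simpa [ContinuousLinearMap.det, LinearMap.det_comp] using this
    have h5 : (ψ' z).det = (md (el : N → E2) (ek.symm z)).det * (chartD k z).det := by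
      simp [hψ', ContinuousLinearMap.det, LinearMap.det_comp]
    rw [areaDensity, areaDensity, ← hek, ← hel, hback, h5, abs_mul]
    have h6 : |(md (el : N → E2) (ek.symm z)).det| * |(chartD l (ψ z)).det| = 1 := by
      rw [← abs_mul, h4, abs_one]
    linear_combination (-|omega f ν (ek.symm z)| * |(chartD k z).det|) * h6
  have hL : chartInt f ν k G = ∫ z in S, G (ek.symm z) * areaDensity f ν k z := by
    rw [chartInt]
    refine setIntegral_eq_of_subset_of_forall_sdiff_eq_zero
      (by simpa using measurableSet_chart_preimage k isOpen_univ) inter_subset_left ?_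
    rintro z ⟨hz1, hz2⟩
    by_cases hG : G (ek.symm z) = 0
    · rw [hG, zero_mul]
    · exact absurd ⟨hz1, hl _ hG⟩ hz2
  have hR : chartInt f ν l G = ∫ z in S', G (el.symm z) * areaDensity f ν l z := by
    rw [chartInt]
    refine setIntegral_eq_of_subset_of_forall_sdiff_eq_zero
      (by simpa using measurableSet_chart_preimage l isOpen_univ) inter_subset_left ?_
    rintro z ⟨hz1, hz2⟩
    by_cases hG : G (el.symm z) = 0
    · rw [hG, zero_mul]
    · exact absurd ⟨hz1, hk _ hG⟩ hz2
  rw [hL, hR, ← himg, integral_image_eq_integral_abs_det_fderiv_smul volume hSm hder hinj]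
  refine setIntegral_congr_fun hSm fun z hz => ?_
  have hback : el.symm (ψ z) = ek.symm z := el.left_inv hz.2
  simp only [smul_eq_mul]
  rw [hback, hdet z hz]
  ring

end Charts

/-! ### Stokes' theorem in the half-plane -/

section FlatStokes

/-- The linear identification of `ℝ × ℝ` with the Euclidean plane. -/
def planeMk : ℝ × ℝ →L[ℝ] E2 :=
  (ContinuousLinearMap.fst ℝ ℝ ℝ).smulRight bv0 + (ContinuousLinearMap.snd ℝ ℝ ℝ).smulRight bv1

@[simp] theorem planeMk_zero (w : ℝ × ℝ) : planeMk w 0 = w.1 := by simp [planeMk]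

@[simp] theorem planeMk_one (w : ℝ × ℝ) : planeMk w 1 = w.2 := by simp [planeMk]

theorem planeMk_eta (z : E2) : planeMk (z 0, z 1) = z := by
  ext i; fin_cases i <;> simp

theorem planeMk_measurePreserving : MeasurePreserving planeMk := by
  have h := (PiLp.volume_preserving_toLp (Fin 2)).comp
    (volume_preserving_finTwoArrow ℝ).symm
  have he : (planeMk : ℝ × ℝ → E2) =
      WithLp.toLp 2 ∘ (MeasurableEquiv.finTwoArrow (α := ℝ)).symm := by
    funext w
    ext i
    fin_cases i <;> simp [MeasurableEquiv.finTwoArrow]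
  rw [he]
  exact h

theorem planeMk_measurableEmbedding : MeasurableEmbedding planeMk := by
  refine Continuous.measurableEmbedding planeMk.continuous fun w w' h => ?_
  ext
  · simpa using congrArg (fun z : E2 => z 0) h
  · simpa using congrArg (fun z : E2 => z 1) h

theorem integral_plane (F : E2 → ℝ) : ∫ z, F z = ∫ w : ℝ × ℝ, F (planeMk w) :=
  (planeMk_measurePreserving.integral_comp planeMk_measurableEmbedding F).symm

theorem mem_range_halfPlane {z : E2} : z ∈ range (𝓡∂ 2) ↔ 0 ≤ z 0 := by
  rw [range_modelWithCornersEuclideanHalfSpace]; rfl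

theorem mem_interior_range_halfPlane {z : E2} : z ∈ interior (range (𝓡∂ 2)) ↔ 0 < z 0 := by
  rw [interior_range_modelWithCornersEuclideanHalfSpace]; rfl

variable {T O K : Set E2} {u v : E2 → ℝ}

/-- Extension by zero from T creates no discontinuity at the rim of T: near points outside the
closed set K the extension vanishes identically, and points of K are relatively interior to T. -/
theorem continuousOn_indicator_halfPlane (hO : IsOpen O) (hT : T = O ∩ range (𝓡∂ 2))
    (hK : IsClosed K) (hKT : K ⊆ T) {g : E2 → ℝ} (hg : ContinuousOn g T)
    (h0 : ∀ z ∈ T \ K, g z = 0) : ContinuousOn (T.indicator g) (range (𝓡∂ 2)) := by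
  intro z hz
  by_cases hzK : z ∈ K
  · have hzT := hKT hzK
    have hmem : T ∈ 𝓝[range (𝓡∂ 2)] z := by
      rw [hT, inter_comm]
      exact inter_mem_nhdsWithin _ (hO.mem_nhds (by rw [hT] at hzT; exact hzT.1))
    have : ContinuousWithinAt g (range (𝓡∂ 2)) z := (hg z hzT).mono_of_mem_nhdsWithin hmem
    refine this.congr_of_eventuallyEq ?_ (indicator_of_mem hzT g)
    filter_upwards [hmem] with y hy using indicator_of_mem hy g
  · have h : T.indicator g =ᶠ[𝓝 z] fun _ => 0 := by
      filter_upwards [hK.isOpen_compl.mem_nhds hzK] with y hy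
      by_cases hyT : y ∈ T
      · rw [indicator_of_mem hyT, h0 y ⟨hyT, hy⟩]
      · exact indicator_of_notMem hyT g
    exact (continuousAt_const.congr h.symm).continuousWithinAt

/-- Stokes' theorem in the half-plane for the two-form `du ∧ dv`. -/
theorem integral_wedge_halfPlane (hO : IsOpen O) (hT : T = O ∩ range (𝓡∂ 2))
    (hK : IsCompact K) (hKT : K ⊆ T) (hu : ContDiffOn ℝ ∞ u T) (hv : ContDiffOn ℝ ∞ v T)
    (hu0 : ∀ z ∈ T \ K, u z = 0) :
    ∫ z in T, wedge (fderivWithin ℝ u (range (𝓡∂ 2)) z) (fderivWithin ℝ v (range (𝓡∂ 2)) z) =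
      -∫ t : ℝ, T.indicator (fun z => u z * fderivWithin ℝ v (range (𝓡∂ 2)) z bv1)
        (planeMk (0, t)) := by
  set H := range (𝓡∂ 2) with hH
  set Du := fderivWithin ℝ u H with hDu
  set Dv := fderivWithin ℝ v H with hDv
  have hDu_s : ContDiffOn ℝ ∞ Du T := fderivWithin_range_continuousOn hO hT hu
  have hDv_s : ContDiffOn ℝ ∞ Dv T := fderivWithin_range_continuousOn hO hT hv
  have hTm : MeasurableSet T := by
    rw [hT]; exact hO.measurableSet.inter (𝓡∂ 2).isClosed_range.measurableSet
  have hTnhds : ∀ z ∈ T, z ∈ interior H → T ∈ 𝓝 z := by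
    intro z hz hzi
    rw [hT]
    rw [hT] at hz
    exact inter_mem (hO.mem_nhds hz.1) (mem_interior_iff_mem_nhds.1 hzi)
  have hDu0 : ∀ z ∈ T \ K, Du z = 0 := by
    intro z hz
    have hzH : z ∈ H := by have := hz.1; rw [hT] at this; exact this.2
    have h1 : u =ᶠ[𝓝[H] z] fun _ => 0 := by
      have hmem : T ∈ 𝓝[H] z := by
        have := hz.1
        rw [hT] at this
        rw [hT, inter_comm]
        exact inter_mem_nhdsWithin _ (hO.mem_nhds this.1)
      filter_upwards [hmem, mem_nhdsWithin_of_mem_nhds (hK.isClosed.isOpen_compl.mem_nhds hz.2)]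
        with y hy1 hy2 using hu0 y ⟨hy1, hy2⟩
    rw [hDu, h1.fderivWithin_eq (hu0 z hz)]
    simp
  -- The field (P, −Q) = (u ∂₁v, −u ∂₀v), extended by zero, has divergence du∧dv, since the mixed
  -- second derivatives of v cancel. Here ∂₀ and ∂₁ are along `bv0` and `bv1`.
  set P : E2 → ℝ := T.indicator fun z => u z * Dv z bv1 with hP
  set Q : E2 → ℝ := T.indicator fun z => u z * Dv z bv0 with hQ
  set W : E2 → ℝ := T.indicator fun z => wedge (Du z) (Dv z) with hW
  have hPc : ContinuousOn P H := continuousOn_indicator_halfPlane hO hT hK.isClosed hKT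
    (hu.continuousOn.mul (hDv_s.continuousOn.clm_apply continuousOn_const))
    fun z hz => by simp [hu0 z hz]
  have hQc : ContinuousOn Q H := continuousOn_indicator_halfPlane hO hT hK.isClosed hKT
    (hu.continuousOn.mul (hDv_s.continuousOn.clm_apply continuousOn_const))
    fun z hz => by simp [hu0 z hz]
  have hWc : ContinuousOn W H := continuousOn_indicator_halfPlane hO hT hK.isClosed hKT
    (continuousOn_wedge hDu_s.continuousOn hDv_s.continuousOn)
    fun z hz => by simp [hDu0 z hz, wedge]
  have hzero : ∀ (g : E2 → ℝ), (∀ z ∈ T \ K, g z = 0) → ∀ z ∉ K, T.indicator g z = 0 := by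
    intro g hg z hz
    by_cases hzT : z ∈ T
    · rw [indicator_of_mem hzT, hg z ⟨hzT, hz⟩]
    · exact indicator_of_notMem hzT g
  have hP0 : ∀ z ∉ K, P z = 0 := hzero _ fun z hz => by simp [hu0 z hz]
  have hQ0 : ∀ z ∉ K, Q z = 0 := hzero _ fun z hz => by simp [hu0 z hz]
  have hW0 : ∀ z ∉ K, W z = 0 := hzero _ fun z hz => by simp [hDu0 z hz, wedge]
  have hder : ∀ z ∈ interior H, DifferentiableAt ℝ P z ∧ DifferentiableAt ℝ Q z ∧
      fderiv ℝ P z bv0 - fderiv ℝ Q z bv1 = W z := by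
    intro z hz
    by_cases hzK : z ∈ K
    · have hzT := hKT hzK
      have hTn := hTnhds z hzT hz
      have hud : DifferentiableAt ℝ u z := (hu.contDiffAt hTn).differentiableAt (by simp)
      have hDvd : DifferentiableAt ℝ Dv z := (hDv_s.contDiffAt hTn).differentiableAt (by simp)
      have hb : ∀ b : E2, HasFDerivAt (fun y => u y * Dv y b)
          (u z • ((ContinuousLinearMap.apply ℝ ℝ b) ∘L fderiv ℝ Dv z) + Dv z b • fderiv ℝ u z)
          z := by
        intro b
        exact hud.hasFDerivAt.mul
          (((ContinuousLinearMap.apply ℝ ℝ b).hasFDerivAt).comp z hDvd.hasFDerivAt)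
      have hPz := (hb bv1).congr_of_eventuallyEq (f₁ := P)
        (by filter_upwards [hTn] with y hy using indicator_of_mem hy _)
      have hQz := (hb bv0).congr_of_eventuallyEq (f₁ := Q)
        (by filter_upwards [hTn] with y hy using indicator_of_mem hy _)
      refine ⟨hPz.differentiableAt, hQz.differentiableAt, ?_⟩
      rw [hPz.fderiv, hQz.fderiv, hW, indicator_of_mem hzT]
      have hsym : fderiv ℝ Dv z bv0 bv1 = fderiv ℝ Dv z bv1 bv0 := by
        have h1 : Dv =ᶠ[𝓝 z] fderiv ℝ v := by
          filter_upwards [isOpen_interior.mem_nhds hz] with y hy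
          rw [hDv]
          exact fderivWithin_of_mem_nhds (mem_interior_iff_mem_nhds.1 hy)
        rw [h1.fderiv_eq]
        exact (hv.contDiffAt hTn).isSymmSndFDerivAt
          (by rw [minSmoothness_of_isRCLikeNormedField]; exact WithTop.coe_le_coe.2 le_top) bv0 bv1
      have hDuz : Du z = fderiv ℝ u z :=
        fderivWithin_of_mem_nhds (mem_interior_iff_mem_nhds.1 hz)
      simp only [wedge, hDuz, add_apply, smul_apply,
        ContinuousLinearMap.comp_apply, ContinuousLinearMap.apply_apply, smul_eq_mul]
      rw [hsym]
      ring
    · have hn : Kᶜ ∈ 𝓝 z := hK.isClosed.isOpen_compl.mem_nhds hzK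
      have hPz : HasFDerivAt P (0 : E2 →L[ℝ] ℝ) z :=
        (hasFDerivAt_const (0 : ℝ) z).congr_of_eventuallyEq
          (by filter_upwards [hn] with y hy using hP0 y hy)
      have hQz : HasFDerivAt Q (0 : E2 →L[ℝ] ℝ) z :=
        (hasFDerivAt_const (0 : ℝ) z).congr_of_eventuallyEq
          (by filter_upwards [hn] with y hy using hQ0 y hy)
      refine ⟨hPz.differentiableAt, hQz.differentiableAt, ?_⟩
      rw [hPz.fderiv, hQz.fderiv, hW0 z hzK]
      simp
  obtain ⟨R, hR0, hR⟩ : ∃ R > 0, ∀ z ∈ K, ‖z‖ < R := by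
    obtain ⟨R, hR0, hR⟩ := hK.isBounded.subset_ball_lt 0 0
    exact ⟨R, hR0, fun z hz => by simpa using hR hz⟩
  have hK' : ∀ w : ℝ × ℝ, planeMk w ∈ K → 0 ≤ w.1 ∧ w.1 < R ∧ -R < w.2 ∧ w.2 < R := by
    intro w hw
    have h0 := (EuclideanSpace.norm_eq (planeMk w)) ▸ hR _ hw
    have hn := hR _ hw
    have h1 := (PiLp.norm_apply_le (planeMk w) 0).trans_lt hn
    have h2 := (PiLp.norm_apply_le (planeMk w) 1).trans_lt hn
    simp only [planeMk_zero, planeMk_one, Real.norm_eq_abs, abs_lt] at h1 h2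
    have h3 : planeMk w ∈ H := by have := hKT hw; rw [hT] at this; exact this.2
    have h4 := mem_range_halfPlane.1 h3
    rw [planeMk_zero] at h4
    exact ⟨h4, h1.2, h2.1, h2.2⟩
  have hmaps : MapsTo planeMk (uIcc (0 : ℝ) R ×ˢ uIcc (-R) R) H := by
    rintro w ⟨hw, -⟩
    rw [uIcc_of_le hR0.le] at hw
    exact mem_range_halfPlane.2 (by simpa using hw.1)
  set D : Set (ℝ × ℝ) := {w | 0 < w.1} with hD
  classical
  -- The divergence theorem needs derivatives only in the open box. The values for w.1 ≤ 0 are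
  -- chosen so that the formal divergence is W everywhere, which is continuous on the closed box.
  set f' : ℝ × ℝ → ℝ × ℝ →L[ℝ] ℝ := fun w => if 0 < w.1 then fderiv ℝ P (planeMk w) ∘L planeMk
    else W (planeMk w) • ContinuousLinearMap.fst ℝ ℝ ℝ with hf'
  set g' : ℝ × ℝ → ℝ × ℝ →L[ℝ] ℝ := fun w => if 0 < w.1 then
    -(fderiv ℝ Q (planeMk w) ∘L planeMk) else 0 with hg'
  have hdiv : ∀ w, f' w (1, 0) + g' w (0, 1) = W (planeMk w) := by
    intro w
    by_cases hw : 0 < w.1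
    · have h := (hder (planeMk w) (mem_interior_range_halfPlane.2 (by simpa using hw))).2.2
      simp only [hf', hg', if_pos hw]
      rw [← h]
      simp [planeMk, sub_eq_add_neg]
    · simp [hf', hg', if_neg hw]
  have hstokes := integral2_divergence_prod_of_hasFDerivAt (fun w => P (planeMk w))
    (fun w => -Q (planeMk w)) f' g' 0 (-R) R R
    (hPc.comp planeMk.continuous.continuousOn hmaps)
    ((hQc.comp planeMk.continuous.continuousOn hmaps).neg)
    (by
      rintro w ⟨hw, -⟩
      have hw : 0 < w.1 := by simpa [hR0.le] using hw.1
      simp only [hf', if_pos hw]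
      exact (hder _ (mem_interior_range_halfPlane.2 (by simpa using hw))).1.hasFDerivAt.comp w
        planeMk.hasFDerivAt)
    (by
      rintro w ⟨hw, -⟩
      have hw : 0 < w.1 := by simpa [hR0.le] using hw.1
      simp only [hg', if_pos hw]
      exact ((hder _ (mem_interior_range_halfPlane.2 (by simpa using hw))).2.1.hasFDerivAt.comp w
        planeMk.hasFDerivAt).neg)
    (by
      simp only [hdiv]
      exact (hWc.comp planeMk.continuous.continuousOn hmaps).integrableOn_compact
        (isCompact_uIcc.prod isCompact_uIcc))
  simp only [hdiv] at hstokes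
  have hQ1 : ∀ x, Q (planeMk (x, R)) = 0 := fun x =>
    hQ0 _ fun h => lt_irrefl _ (hK' _ h).2.2.2
  have hQ2 : ∀ x, Q (planeMk (x, -R)) = 0 := fun x =>
    hQ0 _ fun h => lt_irrefl _ (hK' _ h).2.2.1
  have hP1 : ∀ y, P (planeMk (R, y)) = 0 := fun y =>
    hP0 _ fun h => lt_irrefl _ (hK' _ h).2.1
  -- Of the four sides of [0, R] × [−R, R] only the one on the edge of the half-plane meets K. It is
  -- traversed with outward normal −e₀, hence the minus sign.
  simp only [hQ1, hQ2, hP1, neg_zero, intervalIntegral.integral_zero, sub_self, add_zero,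
    zero_sub] at hstokes
  have hPline : ∫ t : ℝ, P (planeMk (0, t)) = ∫ t in (-R)..R, P (planeMk (0, t)) := by
    refine (intervalIntegral.integral_eq_integral_of_support_subset fun t ht => ?_).symm
    have := hK' (0, t) (by_contra fun h => ht (hP0 _ h))
    exact ⟨this.2.2.1, this.2.2.2.le⟩
  rw [hPline, ← hstokes, ← integral_indicator hTm, integral_plane]
  have hbox : ∫ w : ℝ × ℝ, W (planeMk w) =
      ∫ w in Icc (0 : ℝ) R ×ˢ Icc (-R) R, W (planeMk w) := by
    refine (setIntegral_eq_integral_of_forall_compl_eq_zero fun w hw => ?_).symm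
    refine hW0 _ fun h => hw ?_
    obtain ⟨h1, h2, h3, h4⟩ := hK' _ h
    exact ⟨⟨h1, h2.le⟩, ⟨h3.le, h4.le⟩⟩
  rw [hbox, Measure.volume_eq_prod, setIntegral_prod, intervalIntegral.integral_of_le hR0.le,
    integral_Icc_eq_integral_Ioc]
  · refine integral_congr_ae (Eventually.of_forall fun x => ?_)
    simp only
    rw [intervalIntegral.integral_of_le (by linarith), integral_Icc_eq_integral_Ioc]
  · have := (hWc.comp planeMk.continuous.continuousOn hmaps).integrableOn_compact (μ := volume)
      (isCompact_uIcc.prod isCompact_uIcc)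
    rw [uIcc_of_le hR0.le, uIcc_of_le (by linarith)] at this
    exact this

end FlatStokes

/-! ### The area integral and Stokes' theorem on the surface -/

section AreaIntegral

variable {N : Type*} [TopologicalSpace N] [ChartedSpace (EuclideanHalfSpace 2) N]
  {f ν : N → E3}

theorem measurableSet_extChartAt_target (k : N) :
    MeasurableSet (extChartAt (𝓡∂ 2) k).target := by
  simpa using measurableSet_chart_preimage k isOpen_univ

/-- A functional which integrates continuous functions against the area of the surface. -/
structure IsAreaIntegral (f ν : N → E3) (J : (N → ℝ) → ℝ) : Prop where
  chart : ∀ (k : N) (G : N → ℝ), Continuous G → tsupport G ⊆ (extChartAt (𝓡∂ 2) k).source →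
    J G = chartInt f ν k G
  add : ∀ G H : N → ℝ, Continuous G → Continuous H → J (G + H) = J G + J H
  smul : ∀ (c : ℝ) (G : N → ℝ), Continuous G → J (c • G) = c * J G

theorem IsAreaIntegral.sum {J : (N → ℝ) → ℝ} (hJ : IsAreaIntegral f ν J) {ι : Type*}
    (s : Finset ι) (G : ι → N → ℝ) (hG : ∀ i ∈ s, Continuous (G i)) :
    J (∑ i ∈ s, G i) = ∑ i ∈ s, J (G i) := by
  classical
  induction s using Finset.induction_on with
  | empty =>
    have := hJ.smul 0 0 continuous_zero
    simpa using this
  | insert a s ha ih =>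
    rw [Finset.sum_insert ha, Finset.sum_insert ha, hJ.add, ih]
    · exact fun i hi => hG i (Finset.mem_insert_of_mem hi)
    · exact hG a (Finset.mem_insert_self _ _)
    · have : (∑ i ∈ s, G i) = fun x => ∑ i ∈ s, G i x := by ext; simp
      rw [this]
      exact continuous_finsetSum _ fun i hi => hG i (Finset.mem_insert_of_mem hi)

theorem md_eq_zero_of_notMem_tsupport {u : N → ℝ} {x : N} (hx : x ∉ tsupport u) : md u x = 0 := by
  have h : u =ᶠ[𝓝 x] fun _ => 0 := by
    filter_upwards [(isClosed_tsupport u).isOpen_compl.mem_nhds hx] with y hy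
    exact image_eq_zero_of_notMem_tsupport hy
  rw [md_eq_of_eventuallyEq h]
  exact mfderiv_const

theorem tsupport_bracket_subset (u v : N → ℝ) : tsupport (bracket f ν u v) ⊆ tsupport u := by
  refine closure_minimal (fun x hx => ?_) (isClosed_tsupport u)
  by_contra h
  exact hx (by simp [bracket, md_eq_zero_of_notMem_tsupport h, wedge])

theorem md_add {g h : N → ℝ} {x : N} (hg : MDifferentiableAt (𝓡∂ 2) 𝓘(ℝ, ℝ) g x)
    (hh : MDifferentiableAt (𝓡∂ 2) 𝓘(ℝ, ℝ) h x) : md (g + h) x = md g x + md h x :=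
  mfderiv_add hg hh

theorem md_finsetSum {ι : Type*} (s : Finset ι) (u : ι → N → ℝ) (x : N)
    (hu : ∀ i ∈ s, MDifferentiableAt (𝓡∂ 2) 𝓘(ℝ, ℝ) (u i) x) :
    md (∑ i ∈ s, u i) x = ∑ i ∈ s, md (u i) x := by
  classical
  suffices h : MDifferentiableAt (𝓡∂ 2) 𝓘(ℝ, ℝ) (∑ i ∈ s, u i) x ∧
      md (∑ i ∈ s, u i) x = ∑ i ∈ s, md (u i) x from h.2
  induction s using Finset.induction_on with
  | empty =>
    exact ⟨mdifferentiableAt_const (c := (0 : ℝ)), mfderiv_const (c := (0 : ℝ))⟩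
  | insert a s ha ih =>
    obtain ⟨ih1, ih2⟩ := ih fun i hi => hu i (Finset.mem_insert_of_mem hi)
    have ha' := hu a (Finset.mem_insert_self _ _)
    rw [Finset.sum_insert ha, Finset.sum_insert ha, md_add ha' ih1, ih2]
    exact ⟨ha'.add ih1, rfl⟩

theorem bracket_finsetSum {ι : Type*} (s : Finset ι) (u : ι → N → ℝ) (v : N → ℝ)
    (hu : ∀ i ∈ s, ContMDiff (𝓡∂ 2) 𝓘(ℝ, ℝ) ∞ (u i)) :
    bracket f ν (∑ i ∈ s, u i) v = ∑ i ∈ s, bracket f ν (u i) v := by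
  ext x
  simp only [bracket, Finset.sum_apply]
  rw [md_finsetSum s u x fun i hi => (hu i hi x).mdifferentiableAt (by simp)]
  simp only [wedge, _root_.sum_apply, Finset.sum_mul, ← Finset.sum_sub_distrib,
    Finset.sum_div]

variable [IsManifold (𝓡∂ 2) ∞ N]

/-- A chart domain may be disconnected and the orientation sign may vary over it. These open
subsets, on which the sign is fixed, are where the absolute value in the area density can be
removed. -/
theorem IsOrientedSurface.isOpen_signSet (hM : IsOrientedSurface f ν) (k : N) (s : ℝ) :
    IsOpen {x | x ∈ (extChartAt (𝓡∂ 2) k).source ∧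
      0 < s * ((chartD k (extChartAt (𝓡∂ 2) k x)).det * omega f ν x)} := by
  set e := extChartAt (𝓡∂ 2) k with he
  have h2 : ContinuousOn (fun x => s * ((chartD k (e x)).det * omega f ν x)) e.source := by
    have h3 : ContinuousOn (fun x => (chartD k (e x)).det * omega f ν (e.symm (e x))) e.source :=
      (hM.continuousOn_signedDensity k).comp (continuousOn_extChartAt k) e.mapsTo
    refine (h3.const_mul s).congr fun x hx => ?_
    simp only [e.left_inv hx]
  exact h2.isOpen_inter_preimage (isOpen_extChartAt_source k) isOpen_Ioi

theorem isInteriorPoint_chart_iff {k : N} {z : E2} (hz : z ∈ (extChartAt (𝓡∂ 2) k).target) :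
    (extChartAt (𝓡∂ 2) k).symm z ∈ (𝓡∂ 2).interior N ↔ 0 < z 0 := by
  have hs : (extChartAt (𝓡∂ 2) k).symm z ∈ (chartAt (EuclideanHalfSpace 2) k).source := by
    rw [← extChartAt_source (𝓡∂ 2)]; exact (extChartAt (𝓡∂ 2) k).map_target hz
  have h := (𝓡∂ 2).isInteriorPoint_iff_of_mem_atlas (M := N) (n := ∞) (by simp)
    (chart_mem_atlas _ k) hs
  have h' : (extChartAt (𝓡∂ 2) k).symm z ∈ (𝓡∂ 2).interior N ↔
      extChartAt (𝓡∂ 2) k ((extChartAt (𝓡∂ 2) k).symm z) ∈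
        interior (extChartAt (𝓡∂ 2) k).target := h
  rw [h', (extChartAt (𝓡∂ 2) k).right_inv hz, ← mem_interior_range_halfPlane]
  obtain ⟨O, hO, hT⟩ := extChartAt_target_relOpen k
  rw [hT] at hz ⊢
  rw [interior_inter, hO.interior_eq]
  exact ⟨fun h => h.2, fun h => ⟨hz.1, h⟩⟩

theorem isBoundaryPoint_chart_iff {k : N} {z : E2} (hz : z ∈ (extChartAt (𝓡∂ 2) k).target) :
    (extChartAt (𝓡∂ 2) k).symm z ∈ (𝓡∂ 2).boundary N ↔ z 0 = 0 := by
  rw [← ModelWithCorners.compl_interior, mem_compl_iff, isInteriorPoint_chart_iff hz, not_lt]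
  have := mem_range_halfPlane.1 (extChartAt_target_subset_range k hz)
  exact ⟨fun h => le_antisymm h this, fun h => h.le⟩

theorem isBoundaryPoint_iff_chart {k x : N} (hx : x ∈ (extChartAt (𝓡∂ 2) k).source) :
    x ∈ (𝓡∂ 2).boundary N ↔ extChartAt (𝓡∂ 2) k x 0 = 0 := by
  rw [← isBoundaryPoint_chart_iff ((extChartAt (𝓡∂ 2) k).map_source hx),
    (extChartAt (𝓡∂ 2) k).left_inv hx]

variable [CompactSpace N]

theorem IsOrientedSurface.integrableOn_chart (hM : IsOrientedSurface f ν) {k : N} {G : N → ℝ}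
    (hG : Continuous G) (hk : tsupport G ⊆ (extChartAt (𝓡∂ 2) k).source) :
    IntegrableOn (fun z => G ((extChartAt (𝓡∂ 2) k).symm z) * areaDensity f ν k z)
      (extChartAt (𝓡∂ 2) k).target := by
  set e := extChartAt (𝓡∂ 2) k
  have hK : IsCompact (e '' tsupport G) :=
    (isClosed_tsupport G).isCompact.image_of_continuousOn
      ((continuousOn_extChartAt k).mono hk)
  have hKT : e '' tsupport G ⊆ e.target := by
    rintro _ ⟨x, hx, rfl⟩
    exact e.map_source (hk hx)
  have hc : ContinuousOn (fun z => G (e.symm z) * areaDensity f ν k z) e.target :=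
    (hG.comp_continuousOn (continuousOn_extChartAt_symm k)).mul (hM.continuousOn_areaDensity k)
  refine ((hc.mono hKT).integrableOn_compact hK).of_forall_sdiff_eq_zero
    (measurableSet_extChartAt_target k) ?_
  rintro z ⟨hz1, hz2⟩
  have : G (e.symm z) = 0 := by
    by_contra h
    exact hz2 ⟨e.symm z, subset_tsupport G h, e.right_inv hz1⟩
  simp only [this, zero_mul]

/-- Stokes' theorem for functions supported in one chart. -/
theorem IsAreaIntegral.bracket_chart (hM : IsOrientedSurface f ν) {J : (N → ℝ) → ℝ}
    (hJ : IsAreaIntegral f ν J) {u v : N → ℝ} (hu : ContMDiff (𝓡∂ 2) 𝓘(ℝ, ℝ) ∞ u)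
    (hv : ContMDiff (𝓡∂ 2) 𝓘(ℝ, ℝ) ∞ v) {k : N}
    (hk : tsupport u ⊆ (extChartAt (𝓡∂ 2) k).source) {s : ℝ} (hs : |s| = 1)
    (hsu : ∀ z ∈ (extChartAt (𝓡∂ 2) k).target, (extChartAt (𝓡∂ 2) k).symm z ∈ tsupport u →
      0 < s * ((chartD k z).det * omega f ν ((extChartAt (𝓡∂ 2) k).symm z))) :
    J (bracket f ν u v) = -s * ∫ t : ℝ, (extChartAt (𝓡∂ 2) k).target.indicator
      (fun z => u ((extChartAt (𝓡∂ 2) k).symm z) *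
        fderivWithin ℝ (v ∘ (extChartAt (𝓡∂ 2) k).symm) (range (𝓡∂ 2)) z bv1)
      (planeMk (0, t)) := by
  set e := extChartAt (𝓡∂ 2) k with he
  obtain ⟨O, hO, hT⟩ := extChartAt_target_relOpen k
  rw [hJ.chart k _ (continuous_bracket hM hu hv) ((tsupport_bracket_subset u v).trans hk)]
  have hK : IsCompact (e '' tsupport u) :=
    (isClosed_tsupport u).isCompact.image_of_continuousOn
      ((continuousOn_extChartAt k).mono hk)
  have hKT : e '' tsupport u ⊆ e.target := by
    rintro _ ⟨x, hx, rfl⟩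
    exact e.map_source (hk hx)
  have hst := integral_wedge_halfPlane hO hT hK hKT (contDiffOn_comp_chart k hu)
    (contDiffOn_comp_chart k hv) (by
      rintro z ⟨hz1, hz2⟩
      by_contra h
      exact hz2 ⟨e.symm z, subset_tsupport u h, e.right_inv hz1⟩)
  rw [neg_mul, ← mul_neg]
  simp only [Function.comp_apply] at hst
  rw [← hst, ← integral_const_mul, chartInt]
  refine setIntegral_congr_fun (measurableSet_extChartAt_target k) fun z hz => ?_
  rw [_root_.bracket_chart hM hz ((hu _).mdifferentiableAt (by simp))
    ((hv _).mdifferentiableAt (by simp))]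
  by_cases hzu : e.symm z ∈ tsupport u
  · have h1 := abs_of_pos (hsu z hz hzu)
    rw [abs_mul, hs, one_mul] at h1
    rw [areaDensity, mul_comm |_|, ← abs_mul, h1]
    ring
  · have : bracket f ν u v (e.symm z) = 0 := by
      simp [bracket, md_eq_zero_of_notMem_tsupport hzu, wedge]
    rw [this]
    ring

variable [T2Space N]

theorem exists_finite_smooth_partition (U : N → Set N) (hU : ∀ x, IsOpen (U x))
    (hx : ∀ x, x ∈ U x) :
    ∃ (t : Finset N) (ρ : N → N → ℝ), (∀ i, ContMDiff (𝓡∂ 2) 𝓘(ℝ, ℝ) ∞ (ρ i)) ∧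
      (∀ i, tsupport (ρ i) ⊆ U i) ∧ ∀ x, ∑ i ∈ t, ρ i x = 1 := by
  obtain ⟨ρ, hρ⟩ := SmoothPartitionOfUnity.exists_isSubordinate (𝓡∂ 2) (M := N) isClosed_univ U hU
    fun x _ => mem_iUnion.2 ⟨x, hx x⟩
  have hfin := ρ.locallyFinite.finite_nonempty_of_compact
  refine ⟨hfin.toFinset, fun i x => ρ i x, fun i => (ρ i).contMDiff, hρ, fun x => ?_⟩
  rw [← ρ.sum_eq_one (mem_univ x), finsum_eq_sum_of_support_subset]
  intro i hi
  simp only [Finite.coe_toFinset, mem_ofPred_eq]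
  exact ⟨x, hi⟩

/-- The integral is glued with a finite partition of unity subordinate to charts. For G supported in
the chart k every summand can be computed in k by `chartInt_eq`, and the partition functions sum to
1. -/
theorem IsOrientedSurface.exists_areaIntegral (hM : IsOrientedSurface f ν) :
    ∃ J, IsAreaIntegral f ν J := by
  obtain ⟨t, ρ, hρs, hρU, hρ1⟩ := exists_finite_smooth_partition
    (fun x : N => (extChartAt (𝓡∂ 2) x).source) isOpen_extChartAt_source
    (fun x => mem_extChartAt_source x)
  have hc : ∀ i {G : N → ℝ}, Continuous G → Continuous (ρ i * G) := fun i G hG =>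
    (hρs i).continuous.mul hG
  have hs : ∀ i (G : N → ℝ), tsupport (ρ i * G) ⊆ (extChartAt (𝓡∂ 2) i).source := fun i G =>
    (tsupport_mul_subset_left).trans (hρU i)
  have hsub : ∀ (G : N → ℝ) k, tsupport G ⊆ (extChartAt (𝓡∂ 2) k).source →
      ∀ x, G x ≠ 0 → x ∈ (extChartAt (𝓡∂ 2) k).source := fun G k h x hx =>
    h (subset_tsupport G hx)
  refine ⟨fun G => ∑ i ∈ t, chartInt f ν i (ρ i * G), ?_, ?_, ?_⟩
  · intro k G hG hk
    have hk' : ∀ i, tsupport (ρ i * G) ⊆ (extChartAt (𝓡∂ 2) k).source := fun i =>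
      (tsupport_mul_subset_right).trans hk
    rw [Finset.sum_congr rfl fun i _ => chartInt_eq i k (hsub _ _ (hs i G)) (hsub _ _ (hk' i))]
    simp only [chartInt]
    rw [← integral_finsetSum _ fun i _ => hM.integrableOn_chart (hc i hG) (hk' i)]
    refine integral_congr_ae (Eventually.of_forall fun z => ?_)
    simp only [Pi.mul_apply]
    rw [← Finset.sum_mul, ← Finset.sum_mul, hρ1, one_mul]
  · intro G H hG hH
    rw [← Finset.sum_add_distrib]
    refine Finset.sum_congr rfl fun i _ => ?_
    simp only [chartInt]
    rw [← integral_add (hM.integrableOn_chart (hc i hG) (hs i G))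
      (hM.integrableOn_chart (hc i hH) (hs i H))]
    refine integral_congr_ae (Eventually.of_forall fun z => ?_)
    simp only [Pi.mul_apply, Pi.add_apply]
    ring
  · intro c G hG
    rw [Finset.mul_sum]
    refine Finset.sum_congr rfl fun i _ => ?_
    simp only [chartInt]
    rw [← integral_const_mul]
    refine integral_congr_ae (Eventually.of_forall fun z => ?_)
    simp only [Pi.mul_apply, Pi.smul_apply, smul_eq_mul]
    ring

/-- Stokes' theorem for functions vanishing on the boundary. -/
theorem IsAreaIntegral.bracket_eq_zero (hM : IsOrientedSurface f ν) {J : (N → ℝ) → ℝ}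
    (hJ : IsAreaIntegral f ν J) {u v : N → ℝ} (hu : ContMDiff (𝓡∂ 2) 𝓘(ℝ, ℝ) ∞ u)
    (hv : ContMDiff (𝓡∂ 2) 𝓘(ℝ, ℝ) ∞ v) (hb : ∀ x ∈ (𝓡∂ 2).boundary N, u x = 0) :
    J (bracket f ν u v) = 0 := by
  set δ : N → ℝ := fun k => (chartD k (extChartAt (𝓡∂ 2) k k)).det * omega f ν k with hδ
  have hδ0 : ∀ k, δ k ≠ 0 := fun k =>
    mul_ne_zero (det_chartD_ne_zero (mem_extChartAt_target k)) (hM.omega_ne_zero k)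
  -- The orientation sign at the centre of the chart; the partition of unity is then subordinate to
  -- the sets where this sign persists.
  set s : N → ℝ := fun k => δ k / |δ k| with hs
  have hs1 : ∀ k, |s k| = 1 := fun k => by
    rw [hs, abs_div, abs_abs, div_self (abs_ne_zero.2 (hδ0 k))]
  have hsδ : ∀ k, 0 < s k * δ k := fun k => by
    rw [hs, div_mul_eq_mul_div]
    exact div_pos (mul_self_pos.2 (hδ0 k)) (abs_pos.2 (hδ0 k))
  obtain ⟨t, ρ, hρs, hρU, hρ1⟩ := exists_finite_smooth_partition _
    (fun k : N => hM.isOpen_signSet k (s k)) (fun k => ⟨mem_extChartAt_source k, hsδ k⟩)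
  have hsum : u = ∑ i ∈ t, ρ i * u := by
    ext x
    simp only [Finset.sum_apply, Pi.mul_apply]
    rw [← Finset.sum_mul, hρ1, one_mul]
  have hρu : ∀ i, ContMDiff (𝓡∂ 2) 𝓘(ℝ, ℝ) ∞ (ρ i * u) := fun i => (hρs i).mul hu
  rw [hsum, bracket_finsetSum t _ v fun i _ => hρu i,
    hJ.sum t _ fun i _ => continuous_bracket hM (hρu i) hv]
  refine Finset.sum_eq_zero fun i _ => ?_
  have hsupp : tsupport (ρ i * u) ⊆ _ := (tsupport_mul_subset_left).trans (hρU i)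
  rw [hJ.bracket_chart hM (hρu i) hv (k := i) (s := s i) (fun x hx => (hsupp hx).1) (hs1 i)]
  -- In each chart the boundary term integrates a multiple of u over the edge, where u = 0.
  · rw [integral_eq_zero_of_ae, mul_zero]
    refine Eventually.of_forall fun t => ?_
    by_cases hz : planeMk (0, t) ∈ (extChartAt (𝓡∂ 2) i).target
    · have hbd := (isBoundaryPoint_chart_iff hz).2 (by simp)
      simp only [Pi.zero_apply]
      rw [indicator_of_mem hz, Pi.mul_apply, hb _ hbd, mul_zero, zero_mul]
    · simp only [Pi.zero_apply]
      rw [indicator_of_notMem hz]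
  · intro z hz hzu
    have := (hsupp hzu).2
    rwa [(extChartAt (𝓡∂ 2) i).right_inv hz] at this

end AreaIntegral

/-! ### Test forms in gnomonic coordinates and their exactness -/

section TestFunctions

/-- Smooth compactly supported functions on the line. -/
structure IsTest (α : ℝ → ℝ) : Prop where
  smooth : ContDiff ℝ ∞ α
  compact : HasCompactSupport α

theorem IsTest.deriv {α : ℝ → ℝ} (h : IsTest α) : IsTest (deriv α) :=
  ⟨(contDiff_infty_iff_deriv.1 h.smooth).2, h.compact.deriv⟩

theorem IsTest.differentiable {α : ℝ → ℝ} (h : IsTest α) : Differentiable ℝ α :=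
  h.smooth.differentiable (by simp)

theorem exists_cutoff (R : ℝ) : ∃ χ : ℝ → ℝ, IsTest χ ∧ ∀ s, |s| < R → χ s = 1 := by
  let b : ContDiffBump (0 : ℝ) := ⟨max R 1, max R 1 + 1, by positivity, by linarith⟩
  refine ⟨b, ⟨b.contDiff, b.hasCompactSupport⟩, fun s hs => ?_⟩
  refine b.one_of_mem_closedBall ?_
  rw [mem_closedBall_zero_iff]
  exact hs.le.trans (le_max_left _ _)

variable {N : Type*} [TopologicalSpace N] {f : N → E3} {p : E3} {a : Fin 3 → E3}

/-- A product function in gnomonic coordinates, pulled back to the surface. -/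
def tens (a : Fin 3 → E3) (f : N → E3) (p : E3) (α β : ℝ → ℝ) (x : N) : ℝ :=
  open Classical in
  if 0 < (inner ℝ (a 0) (f x - p) : ℝ) then
    α (gno a 1 (f x - p)) * β (gno a 2 (f x - p)) else 0

theorem continuousAt_gno {i : Fin 3} {w : E3} (hw : (inner ℝ (a 0) w : ℝ) ≠ 0) :
    ContinuousAt (gno a i) w := by
  unfold gno
  exact ContinuousAt.div (by fun_prop) (by fun_prop) hw

/-- Preimages of compact boxes in gnomonic coordinates are closed. -/
theorem isClosed_gnomonicBox (ha : IsFrame a) (hf : Continuous f) (hp : p ∉ range f) {K L : Set ℝ}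
    (hK : IsCompact K) (hL : IsCompact L) :
    IsClosed {x | 0 < (inner ℝ (a 0) (f x - p) : ℝ) ∧ gno a 1 (f x - p) ∈ K ∧
      gno a 2 (f x - p) ∈ L} := by
  set S := {x | 0 < (inner ℝ (a 0) (f x - p) : ℝ) ∧ gno a 1 (f x - p) ∈ K ∧
      gno a 2 (f x - p) ∈ L} with hS
  obtain ⟨R₁, hR₁⟩ := hK.isBounded.exists_norm_le
  obtain ⟨R₂, hR₂⟩ := hL.isBounded.exists_norm_le
  have hc : ∀ i, Continuous fun x => (inner ℝ (a i) (f x - p) : ℝ) := fun i => by fun_prop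
  have hcl : IsClosed {x | 0 ≤ (inner ℝ (a 0) (f x - p) : ℝ) ∧
      |(inner ℝ (a 1) (f x - p) : ℝ)| ≤ R₁ * inner ℝ (a 0) (f x - p) ∧
      |(inner ℝ (a 2) (f x - p) : ℝ)| ≤ R₂ * inner ℝ (a 0) (f x - p)} :=
    (isClosed_le continuous_const (hc 0)).inter
      ((isClosed_le (hc 1).abs (continuous_const.mul (hc 0))).inter
        (isClosed_le (hc 2).abs (continuous_const.mul (hc 0))))
  have hsub : S ⊆ _ := fun x hx => by
    refine hcl.closure_subset (subset_closure ⟨hx.1.le, ?_, ?_⟩)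
    · have := hR₁ _ hx.2.1
      rwa [gno, Real.norm_eq_abs, abs_div, abs_of_pos hx.1, div_le_iff₀ hx.1] at this
    · have := hR₂ _ hx.2.2
      rwa [gno, Real.norm_eq_abs, abs_div, abs_of_pos hx.1, div_le_iff₀ hx.1] at this
  refine isClosed_of_closure_subset fun x hx => ?_
  obtain ⟨h0, h1, h2⟩ := closure_minimal hsub hcl hx
  -- Strict positivity survives the limit: with bounded gnomonic coordinates, ⟨a₀, f x − p⟩ = 0
  -- would make the other two components vanish as well, so f x = p.
  have hpos : 0 < (inner ℝ (a 0) (f x - p) : ℝ) := by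
    refine lt_of_le_of_ne h0 fun h => ?_
    rw [← h, mul_zero] at h1 h2
    have := ha.eq_sum (f x - p)
    rw [← h, abs_eq_zero.1 (le_antisymm h1 (abs_nonneg _)),
      abs_eq_zero.1 (le_antisymm h2 (abs_nonneg _))] at this
    simp only [zero_smul, add_zero] at this
    exact hp ⟨x, sub_eq_zero.1 this⟩
  have hg : ∀ i, ContinuousAt (fun x => gno a i (f x - p)) x := fun i =>
    ContinuousAt.comp (g := gno a i) (continuousAt_gno hpos.ne') (by fun_prop)
  refine ⟨hpos, ?_, ?_⟩
  · rw [← hK.isClosed.closure_eq]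
    exact (hg 1).continuousWithinAt.mem_closure hx fun y hy => hy.2.1
  · rw [← hL.isClosed.closure_eq]
    exact (hg 2).continuousWithinAt.mem_closure hx fun y hy => hy.2.2

theorem tsupport_tens_subset (ha : IsFrame a) (hf : Continuous f) (hp : p ∉ range f)
    {α β : ℝ → ℝ} (hα : HasCompactSupport α) (hβ : HasCompactSupport β) :
    tsupport (tens a f p α β) ⊆ {x | 0 < (inner ℝ (a 0) (f x - p) : ℝ) ∧
      gno a 1 (f x - p) ∈ tsupport α ∧ gno a 2 (f x - p) ∈ tsupport β} := by
  refine closure_minimal (fun x hx => ?_) (isClosed_gnomonicBox ha hf hp hα hβ)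
  by_cases h : 0 < (inner ℝ (a 0) (f x - p) : ℝ)
  · have hx' : α (gno a 1 (f x - p)) * β (gno a 2 (f x - p)) ≠ 0 := by
      simpa [tens, h] using hx
    exact ⟨h, subset_tsupport α (left_ne_zero_of_mul hx'),
      subset_tsupport β (right_ne_zero_of_mul hx')⟩
  · exact absurd (by simp [tens, h]) hx

theorem tens_eventuallyEq (hf : Continuous f) {x : N}
    (hx : 0 < (inner ℝ (a 0) (f x - p) : ℝ)) (α β : ℝ → ℝ) :
    tens a f p α β =ᶠ[𝓝 x]
      (fun w => α (gno a 1 (w - p)) * β (gno a 2 (w - p))) ∘ f := by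
  have : ∀ᶠ y in 𝓝 x, 0 < (inner ℝ (a 0) (f y - p) : ℝ) :=
    (by fun_prop : Continuous fun y => (inner ℝ (a 0) (f y - p) : ℝ)).continuousAt.eventually
      (lt_mem_nhds hx)
  filter_upwards [this] with y hy
  simp [tens, hy]

theorem contDiffAt_gno {i : Fin 3} {w : E3} (hw : (inner ℝ (a 0) w : ℝ) ≠ 0) :
    ContDiffAt ℝ ∞ (gno a i) w := by
  unfold gno
  exact (contDiff_const.inner ℝ contDiff_id).contDiffAt.div
    (contDiff_const.inner ℝ contDiff_id).contDiffAt hw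

theorem hasFDerivAt_gno {i : Fin 3} {w : E3} (hw : (inner ℝ (a 0) w : ℝ) ≠ 0) :
    HasFDerivAt (gno a i) (((inner ℝ (a 0) w : ℝ) ^ 2)⁻¹ •
      ((inner ℝ (a 0) w : ℝ) • innerSL ℝ (a i) - (inner ℝ (a i) w : ℝ) • innerSL ℝ (a 0))) w := by
  have h0 : HasFDerivAt (fun w => (inner ℝ (a 0) w : ℝ)⁻¹) _ w :=
    (hasDerivAt_inv hw).comp_hasFDerivAt w (innerSL ℝ (a 0)).hasFDerivAt
  have h1 : HasFDerivAt (gno a i) _ w := ((innerSL ℝ (a i)).hasFDerivAt (x := w)).mul h0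
  refine h1.congr_fderiv ?_
  ext v
  simp
  field_simp
  ring

/-- The Jacobian of the gnomonic coordinates with respect to oriented area. -/
def gnoJac (a : Fin 3 → E3) (f ν : N → E3) (p : E3) (x : N) : ℝ :=
  inner ℝ (f x - p) (ν x) / (inner ℝ (a 0) (f x - p) : ℝ) ^ 3

/-- The pull-back of a product form in gnomonic coordinates, as a density on the surface. -/
def flux (a : Fin 3 → E3) (f ν : N → E3) (p : E3) (α β : ℝ → ℝ) (x : N) : ℝ :=
  tens a f p α β x * gnoJac a f ν p x

theorem tsupport_flux_subset {ν : N → E3} {α β : ℝ → ℝ} :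
    tsupport (flux a f ν p α β) ⊆ tsupport (tens a f p α β) :=
  tsupport_mul_subset_left

variable [ChartedSpace (EuclideanHalfSpace 2) N]

theorem contMDiffAt_tens (hf : ContMDiff (𝓡∂ 2) 𝓘(ℝ, E3) ∞ f) {α β : ℝ → ℝ}
    (hα : ContDiff ℝ ∞ α) (hβ : ContDiff ℝ ∞ β) {x : N}
    (hpos : 0 < (inner ℝ (a 0) (f x - p) : ℝ)) :
    ContMDiffAt (𝓡∂ 2) 𝓘(ℝ, ℝ) ∞ (tens a f p α β) x := by
  refine ContMDiffAt.congr_of_eventuallyEq ?_ (tens_eventuallyEq hf.continuous hpos α β)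
  have hg : ∀ i, ContDiffAt ℝ ∞ (fun w => gno a i (w - p)) (f x) := fun i =>
    ContDiffAt.comp (f x) (g := gno a i) (contDiffAt_gno hpos.ne') (by fun_prop)
  have : ContDiffAt ℝ ∞ (fun w => α (gno a 1 (w - p)) * β (gno a 2 (w - p))) (f x) :=
    (hα.contDiffAt.comp (f x) (hg 1)).mul (hβ.contDiffAt.comp (f x) (hg 2))
  exact this.contMDiffAt.comp x (hf x)

theorem contMDiff_tens (ha : IsFrame a) (hf : ContMDiff (𝓡∂ 2) 𝓘(ℝ, E3) ∞ f) (hp : p ∉ range f)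
    {α β : ℝ → ℝ} (hα : IsTest α) (hβ : IsTest β) :
    ContMDiff (𝓡∂ 2) 𝓘(ℝ, ℝ) ∞ (tens a f p α β) :=
  contMDiff_of_tsupport fun _ hx => contMDiffAt_tens hf hα.smooth hβ.smooth
    (tsupport_tens_subset ha hf.continuous hp hα.compact hβ.compact hx).1

theorem md_comp_of_hasFDerivAt {φ : E3 → ℝ} {L : E3 →L[ℝ] ℝ} {x : N}
    (hφ : HasFDerivAt φ L (f x)) (hf : MDifferentiableAt (𝓡∂ 2) 𝓘(ℝ, E3) f x) :
    md (φ ∘ f) x = L ∘L md f x :=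
  (hφ.hasMFDerivAt.comp x hf.hasMFDerivAt).mfderiv

theorem md_tens (hf : ContMDiff (𝓡∂ 2) 𝓘(ℝ, E3) ∞ f) {α β : ℝ → ℝ} {x : N}
    (hx : 0 < (inner ℝ (a 0) (f x - p) : ℝ)) (hα : DifferentiableAt ℝ α (gno a 1 (f x - p)))
    (hβ : DifferentiableAt ℝ β (gno a 2 (f x - p))) (v : E2) :
    md (tens a f p α β) x v =
      ((inner ℝ (a 0) (f x - p) : ℝ) ^ 2)⁻¹ *
      (deriv α (gno a 1 (f x - p)) * β (gno a 2 (f x - p)) *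
        (inner ℝ (a 0) (f x - p) * inner ℝ (a 1) (md f x v)
          - inner ℝ (a 1) (f x - p) * inner ℝ (a 0) (md f x v))
      + α (gno a 1 (f x - p)) * deriv β (gno a 2 (f x - p)) *
        (inner ℝ (a 0) (f x - p) * inner ℝ (a 2) (md f x v)
          - inner ℝ (a 2) (f x - p) * inner ℝ (a 0) (md f x v))) := by
  have hg : ∀ i, HasFDerivAt (fun w => gno a i (w - p))
      (((inner ℝ (a 0) (f x - p) : ℝ) ^ 2)⁻¹ •
      ((inner ℝ (a 0) (f x - p) : ℝ) • innerSL ℝ (a i)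
        - (inner ℝ (a i) (f x - p) : ℝ) • innerSL ℝ (a 0))) (f x) := fun i => by
    have := (hasFDerivAt_gno (a := a) (i := i) hx.ne').comp (f x)
      ((hasFDerivAt_id (f x)).sub_const p)
    rw [ContinuousLinearMap.comp_id] at this
    exact this
  have h1 := hα.hasDerivAt.comp_hasFDerivAt (f x) (hg 1)
  have h2 := hβ.hasDerivAt.comp_hasFDerivAt (f x) (hg 2)
  have h3 : HasFDerivAt (fun w => α (gno a 1 (w - p)) * β (gno a 2 (w - p))) _ (f x) := h1.mul h2
  rw [md_eq_of_eventuallyEq (tens_eventuallyEq hf.continuous hx α β),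
    md_comp_of_hasFDerivAt h3 ((hf x).mdifferentiableAt (by simp))]
  simp
  ring

variable {ν : N → E3}

theorem IsOrientedSurface.normal_md (hM : IsOrientedSurface f ν) (x : N) (v : E2) :
    inner ℝ (ν x) (md f x v) = (0 : ℝ) :=
  hM.normal_orthogonal x v

/-- The form dy₁∧dy₂ pulled back to space is w₀⁻³ times the volume form contracted with w = f x − p,
and the cross product of two tangent vectors is a multiple of ν. -/
theorem IsOrientedSurface.gnoJac_eq (hM : IsOrientedSurface f ν) {x : N}
    (hx : 0 < (inner ℝ (a 0) (f x - p) : ℝ)) :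
    gnoJac a f ν p x * omega f ν x =
      ((inner ℝ (a 0) (f x - p) : ℝ) ^ 3)⁻¹ *
      inner ℝ (f x - p) (cross (md f x bv0) (md f x bv1)) := by
  rw [inner_cross_of_orthogonal (hM.normal_unit x) (hM.normal_md x bv0) (hM.normal_md x bv1),
    gnoJac, omega, vol]
  field_simp

/-- This is d(αβ)∧d(γδ) = (α'βγδ' − αβ'γ'δ) dy₁∧dy₂, divided by the oriented area. Only pointwise
differentiability is asked, so that γ and δ may also be constants or the identity. -/
theorem bracket_tens (ha : IsFrame a) (hM : IsOrientedSurface f ν) {x : N}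
    (hx : 0 < (inner ℝ (a 0) (f x - p) : ℝ)) {α β γ δ : ℝ → ℝ}
    (hα : DifferentiableAt ℝ α (gno a 1 (f x - p))) (hβ : DifferentiableAt ℝ β (gno a 2 (f x - p)))
    (hγ : DifferentiableAt ℝ γ (gno a 1 (f x - p)))
    (hδ : DifferentiableAt ℝ δ (gno a 2 (f x - p))) :
    bracket f ν (tens a f p α β) (tens a f p γ δ) x =
      (deriv α (gno a 1 (f x - p)) * β (gno a 2 (f x - p)) *
        (γ (gno a 1 (f x - p)) * deriv δ (gno a 2 (f x - p))) -
      α (gno a 1 (f x - p)) * deriv β (gno a 2 (f x - p)) *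
        (deriv γ (gno a 1 (f x - p)) * δ (gno a 2 (f x - p)))) * gnoJac a f ν p x := by
  rw [bracket, div_eq_iff (hM.omega_ne_zero x), mul_assoc, hM.gnoJac_eq hx, ha.triple, wedge,
    md_tens hM.smooth hx hα hβ, md_tens hM.smooth hx hα hβ, md_tens hM.smooth hx hγ hδ,
    md_tens hM.smooth hx hγ hδ]
  field_simp
  ring

theorem continuous_flux (ha : IsFrame a) (hM : IsOrientedSurface f ν) (hp : p ∉ range f)
    {α β : ℝ → ℝ} (hα : IsTest α) (hβ : IsTest β) : Continuous (flux a f ν p α β) := by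
  refine continuous_of_tsupport fun x hx => ?_
  have hpos := (tsupport_tens_subset ha hM.smooth.continuous hp hα.compact hβ.compact
    (tsupport_flux_subset hx)).1
  refine (contMDiff_tens ha hM.smooth hp hα hβ).continuous.continuousAt.mul ?_
  have := hM.normal_continuous
  have := hM.smooth.continuous
  unfold gnoJac
  exact ContinuousAt.div (by fun_prop) (by fun_prop) (pow_ne_zero _ hpos.ne')

/-- On the support of αβ the second function is the coordinate y₂, and d(αβ)∧dy₂ = α'β dy₁∧dy₂. The
cutoffs make y₂ a globally smooth function on the surface. -/
theorem bracket_eq_flux_left (ha : IsFrame a) (hM : IsOrientedSurface f ν) (hp : p ∉ range f)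
    {α β χ γ : ℝ → ℝ} (hα : IsTest α) (hβ : IsTest β) (hχ : ∀ s ∈ tsupport α, χ =ᶠ[𝓝 s] 1)
    (hγ : ∀ s ∈ tsupport β, γ =ᶠ[𝓝 s] id) :
    bracket f ν (tens a f p α β) (tens a f p χ γ) = flux a f ν p (deriv α) β := by
  ext x
  by_cases hx : x ∈ tsupport (tens a f p α β)
  · obtain ⟨h0, h1, h2⟩ := tsupport_tens_subset ha hM.smooth.continuous hp hα.compact hβ.compact hx
    have e1 := hχ _ h1
    have e2 := hγ _ h2
    rw [bracket_tens ha hM h0 (hα.differentiable _) (hβ.differentiable _)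
      (e1.differentiableAt_iff.2 (differentiableAt_const _))
      (e2.differentiableAt_iff.2 differentiableAt_id), e1.deriv_eq, e2.deriv_eq, e1.eq_of_nhds,
      e2.eq_of_nhds]
    simp [flux, tens, h0, show deriv (1 : ℝ → ℝ) = 0 from by ext; exact deriv_const _ _]
  · have h1 : bracket f ν (tens a f p α β) (tens a f p χ γ) x = 0 := by
      simp [bracket, md_eq_zero_of_notMem_tsupport hx, wedge]
    rw [h1, flux]
    by_cases h0 : 0 < (inner ℝ (a 0) (f x - p) : ℝ)
    · have hz := md_eq_zero_of_notMem_tsupport hx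
      -- Off the support of αβ∘f the value α'β still has to vanish. Where the Jacobian is nonzero,
      -- this is read off from the bracket of the locally zero function with the uncut coordinate
      -- y₂.
      by_cases hj : gnoJac a f ν p x = 0
      · rw [hj, mul_zero]
      · have hb := bracket_tens ha hM h0 (hα.differentiable _) (hβ.differentiable _)
          (differentiableAt_const (1 : ℝ)) (differentiableAt_id (𝕜 := ℝ))
        have : bracket f ν (tens a f p α β) (tens a f p (fun _ => 1) id) x = 0 := by
          simp [bracket, hz, wedge]
        rw [this] at hb
        simp [hj] at hb
        simp [tens, h0, hb]
    · simp [tens, h0]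

/-- Here the second function is y₁ on the support, and d(αβ)∧dy₁ = −αβ' dy₁∧dy₂. -/
theorem bracket_eq_flux_right (ha : IsFrame a) (hM : IsOrientedSurface f ν) (hp : p ∉ range f)
    {α β χ γ : ℝ → ℝ} (hα : IsTest α) (hβ : IsTest β) (hγ : ∀ s ∈ tsupport α, γ =ᶠ[𝓝 s] id)
    (hχ : ∀ s ∈ tsupport β, χ =ᶠ[𝓝 s] 1) :
    bracket f ν (tens a f p α β) (tens a f p γ χ) = -flux a f ν p α (deriv β) := by
  ext x
  rw [Pi.neg_apply]
  by_cases hx : x ∈ tsupport (tens a f p α β)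
  · obtain ⟨h0, h1, h2⟩ := tsupport_tens_subset ha hM.smooth.continuous hp hα.compact hβ.compact hx
    have e1 := hγ _ h1
    have e2 := hχ _ h2
    rw [bracket_tens ha hM h0 (hα.differentiable _) (hβ.differentiable _)
      (e1.differentiableAt_iff.2 differentiableAt_id)
      (e2.differentiableAt_iff.2 (differentiableAt_const _)), e1.deriv_eq, e2.deriv_eq,
      e1.eq_of_nhds, e2.eq_of_nhds]
    simp [flux, tens, h0, show deriv (1 : ℝ → ℝ) = 0 from by ext; exact deriv_const _ _]
  · have h1 : bracket f ν (tens a f p α β) (tens a f p γ χ) x = 0 := by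
      simp [bracket, md_eq_zero_of_notMem_tsupport hx, wedge]
    rw [h1, flux]
    by_cases h0 : 0 < (inner ℝ (a 0) (f x - p) : ℝ)
    · have hz := md_eq_zero_of_notMem_tsupport hx
      by_cases hj : gnoJac a f ν p x = 0
      · rw [hj, mul_zero, neg_zero]
      · have hb := bracket_tens ha hM h0 (hα.differentiable _) (hβ.differentiable _)
          (differentiableAt_id (𝕜 := ℝ)) (differentiableAt_const (1 : ℝ))
        have : bracket f ν (tens a f p α β) (tens a f p id (fun _ => 1)) x = 0 := by
          simp [bracket, hz, wedge]
        rw [this] at hb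
        simp [hj] at hb
        simp [tens, h0, hb]
    · simp [tens, h0]

/-- A cutoff function and a cut-off coordinate which are exact near two given supports. -/
theorem exists_cutoff_pair {α β : ℝ → ℝ} (hα : IsTest α) (hβ : IsTest β) :
    ∃ χ γ : ℝ → ℝ, IsTest χ ∧ IsTest γ ∧ (∀ s ∈ tsupport α ∪ tsupport β, χ =ᶠ[𝓝 s] 1) ∧
      ∀ s ∈ tsupport α ∪ tsupport β, γ =ᶠ[𝓝 s] id := by
  obtain ⟨R, hR⟩ := (hα.compact.isCompact.union hβ.compact.isCompact).isBounded.exists_norm_le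
  obtain ⟨χ, hχ, hχ1⟩ := exists_cutoff (R + 1)
  have hn : ∀ s ∈ tsupport α ∪ tsupport β, χ =ᶠ[𝓝 s] 1 := by
    intro s hs
    have h : ∀ᶠ t in 𝓝 s, |t| < R + 1 :=
      continuous_abs.continuousAt.eventually
        (gt_mem_nhds (lt_of_le_of_lt (hR s hs) (lt_add_one R)))
    filter_upwards [h] with t ht using hχ1 t ht
  refine ⟨χ, fun s => s * χ s, hχ, ⟨contDiff_id.mul hχ.smooth, hχ.compact.mul_left⟩, hn, ?_⟩
  intro s hs
  filter_upwards [hn s hs] with t ht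
  simp [ht]

variable [IsManifold (𝓡∂ 2) ∞ N] [CompactSpace N] [T2Space N]

theorem IsAreaIntegral.flux_deriv_left (ha : IsFrame a) (hM : IsOrientedSurface f ν)
    (hp : p ∉ range f) {J : (N → ℝ) → ℝ} (hJ : IsAreaIntegral f ν J) {α β : ℝ → ℝ}
    (hα : IsTest α) (hβ : IsTest β) (hb : ∀ x ∈ (𝓡∂ 2).boundary N, tens a f p α β x = 0) :
    J (flux a f ν p (deriv α) β) = 0 := by
  obtain ⟨χ, γ, hχ, hγ, h1, h2⟩ := exists_cutoff_pair hα hβ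
  rw [← bracket_eq_flux_left ha hM hp hα hβ (fun s hs => h1 s (Or.inl hs))
    (fun s hs => h2 s (Or.inr hs))]
  exact hJ.bracket_eq_zero hM (contMDiff_tens ha hM.smooth hp hα hβ)
    (contMDiff_tens ha hM.smooth hp hχ hγ) hb

theorem IsAreaIntegral.flux_deriv_right (ha : IsFrame a) (hM : IsOrientedSurface f ν)
    (hp : p ∉ range f) {J : (N → ℝ) → ℝ} (hJ : IsAreaIntegral f ν J) {α β : ℝ → ℝ}
    (hα : IsTest α) (hβ : IsTest β) (hb : ∀ x ∈ (𝓡∂ 2).boundary N, tens a f p α β x = 0) :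
    J (flux a f ν p α (deriv β)) = 0 := by
  obtain ⟨χ, γ, hχ, hγ, h1, h2⟩ := exists_cutoff_pair hα hβ
  have h3 := bracket_eq_flux_right ha hM hp hα hβ (fun s hs => h2 s (Or.inl hs))
    (fun s hs => h1 s (Or.inr hs))
  have h4 := hJ.bracket_eq_zero hM (contMDiff_tens ha hM.smooth hp hα hβ)
    (contMDiff_tens ha hM.smooth hp hγ hχ) hb
  rw [h3] at h4
  have h5 := hJ.smul (-1) _ (continuous_flux ha hM hp hα hβ.deriv)
  rw [neg_one_smul, h4] at h5
  linarith

end TestFunctions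

/-! ### Test functions on the line and their antiderivatives -/

section Line

theorem IsTest.integrable {α : ℝ → ℝ} (h : IsTest α) : Integrable α :=
  h.smooth.continuous.integrable_of_hasCompactSupport h.compact

theorem IsTest.add {α β : ℝ → ℝ} (hα : IsTest α) (hβ : IsTest β) : IsTest (α + β) :=
  ⟨hα.smooth.add hβ.smooth, hα.compact.add hβ.compact⟩

theorem IsTest.const_smul {α : ℝ → ℝ} (hα : IsTest α) (c : ℝ) : IsTest (c • α) :=
  ⟨hα.smooth.const_smul c, hα.compact.mono' (subset_closure.trans' (Function.support_const_smul_subset c α))⟩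

/-- A test function of zero mean is the derivative of a test function with the same bounds on the
support. -/
theorem IsTest.exists_antideriv {α : ℝ → ℝ} (h : IsTest α) {l u : ℝ} (hlu : tsupport α ⊆ Ioo l u)
    (h0 : ∫ t, α t = 0) :
    ∃ A : ℝ → ℝ, IsTest A ∧ tsupport A ⊆ Ioo l u ∧ _root_.deriv A = α ∧
      ∀ s, A s = ∫ t in l..s, α t := by
  have hd : ∀ s, HasDerivAt (fun s => ∫ t in l..s, α t) (α s) s := fun s =>
    intervalIntegral.integral_hasDerivAt_right (h.smooth.continuous.intervalIntegrable _ _)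
      (h.smooth.continuous.stronglyMeasurableAtFilter _ _) h.smooth.continuous.continuousAt
  have hderiv : _root_.deriv (fun s => ∫ t in l..s, α t) = α := funext fun s => (hd s).deriv
  have hsupp : tsupport (fun s => ∫ t in l..s, α t) ⊆ Ioo l u := by
    rcases (tsupport α).eq_empty_or_nonempty with he | hne
    · have hα : α = 0 := tsupport_eq_empty_iff.1 he
      have : (fun s => ∫ t in l..s, α t) = 0 := by ext s; simp [hα]
      rw [this, tsupport_eq_empty_iff.2 rfl]
      exact empty_subset _
    · have hc : IsCompact (tsupport α) := h.compact
      have hm := hlu (hc.sInf_mem hne)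
      have hM := hlu (hc.sSup_mem hne)
      have hsub : tsupport α ⊆ Icc (sInf (tsupport α)) (sSup (tsupport α)) := fun t ht =>
        ⟨csInf_le hc.bddBelow ht, le_csSup hc.bddAbove ht⟩
      refine Subset.trans (closure_minimal (fun s hs => ?_) isClosed_Icc)
        (Icc_subset_Ioo hm.1 hM.2)
      by_contra hns
      apply hs
      rcases not_and_or.1 hns with h1 | h1
      · rw [not_le] at h1
        refine intervalIntegral.integral_zero_ae (Eventually.of_forall fun t ht => ?_)
        refine image_eq_zero_of_notMem_tsupport fun hts => ?_
        have h2 := (hsub hts).1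
        rcases le_total l s with hls | hls
        · rw [uIoc_of_le hls] at ht; linarith [ht.2]
        · rw [uIoc_of_ge hls] at ht; linarith [ht.2, hm.1]
      · rw [not_le] at h1
        simp only
        -- Beyond the support the antiderivative is the full integral; this is where zero mean is
        -- needed.
        rw [intervalIntegral.integral_eq_integral_of_support_subset, h0]
        intro t ht
        have h2 := subset_tsupport α ht
        exact ⟨(hlu h2).1, ((hsub h2).2.trans h1.le)⟩
  refine ⟨fun s => ∫ t in l..s, α t, ⟨?_, ?_⟩, hsupp, hderiv, fun s => rfl⟩
  · exact contDiff_infty_iff_deriv.2 ⟨fun s => (hd s).differentiableAt, hderiv.symm ▸ h.smooth⟩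
  · exact HasCompactSupport.of_support_subset_isCompact isCompact_Icc
      (subset_closure.trans (hsupp.trans Ioo_subset_Icc_self))

theorem exists_isTest {l u : ℝ} (h : l < u) :
    ∃ α : ℝ → ℝ, IsTest α ∧ tsupport α ⊆ Ioo l u ∧ ∫ t, α t = 1 := by
  let b : ContDiffBump ((l + u) / 2) := ⟨(u - l) / 8, (u - l) / 4, by linarith, by linarith⟩
  have hI : 0 < ∫ t, b t := b.integral_pos
  have hb : IsTest b := ⟨b.contDiff, b.hasCompactSupport⟩
  refine ⟨(∫ t, b t)⁻¹ • ⇑b, hb.const_smul _, ?_, ?_⟩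
  · refine (closure_mono (Function.support_const_smul_subset _ _)).trans ?_
    have := b.tsupport_eq
    rw [tsupport] at this
    rw [this, Real.closedBall_eq_Icc]
    have h1 : b.rOut = (u - l) / 4 := rfl
    rw [h1]
    exact Icc_subset_Ioo (by linarith) (by linarith)
  · simp only [Pi.smul_apply, smul_eq_mul]
    rw [integral_const_mul, inv_mul_cancel₀ hI.ne']

end Line

/-! ### Separation by boxes and local sheets over the gnomonic plane -/

section Flux

variable {N : Type*} [TopologicalSpace N] {f ν : N → E3} {p : E3} {a : Fin 3 → E3}

theorem det_planeMk_prod (A B : E2 →L[ℝ] ℝ) : (planeMk ∘L (A.prod B)).det = wedge A B := by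
  rw [det_plane, wedge]
  simp
  ring

theorem exists_sup_box {W : Set (ℝ × ℝ)} {y : ℝ × ℝ} (hW : W ∈ 𝓝 y) :
    ∃ δ > 0, ∀ w : ℝ × ℝ, |w.1 - y.1| < δ → |w.2 - y.2| < δ → w ∈ W := by
  obtain ⟨δ, hδ, h⟩ := Metric.mem_nhds_iff.1 hW
  refine ⟨δ, hδ, fun w h1 h2 => h ?_⟩
  rw [Metric.mem_ball, Prod.dist_eq, Real.dist_eq, Real.dist_eq]
  exact max_lt h1 h2

/-- A closed set of the surface missing a direction misses a box around it. -/
theorem exists_box_avoiding [CompactSpace N] (ha : IsFrame a) (hf : Continuous f) (hp : p ∉ range f) {C : Set N}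
    (hC : IsClosed C) (y₁ y₂ : ℝ)
    (hy : ∀ x ∈ C, 0 < (inner ℝ (a 0) (f x - p) : ℝ) → gno a 1 (f x - p) = y₁ →
      gno a 2 (f x - p) = y₂ → False) :
    ∃ δ > 0, ∀ x ∈ C, 0 < (inner ℝ (a 0) (f x - p) : ℝ) → |gno a 1 (f x - p) - y₁| < δ →
      |gno a 2 (f x - p) - y₂| < δ → False := by
  have hB := isClosed_gnomonicBox ha hf hp (isCompact_Icc (a := y₁ - 1) (b := y₁ + 1))
    (isCompact_Icc (a := y₂ - 1) (b := y₂ + 1))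
  set B := {x | 0 < (inner ℝ (a 0) (f x - p) : ℝ) ∧ gno a 1 (f x - p) ∈ Icc (y₁ - 1) (y₁ + 1) ∧
    gno a 2 (f x - p) ∈ Icc (y₂ - 1) (y₂ + 1)} with hBdef
  have hK : IsCompact (C ∩ B) := (hC.inter hB).isCompact
  have hcont : ContinuousOn (fun x => (gno a 1 (f x - p), gno a 2 (f x - p))) (C ∩ B) := by
    intro x hx
    refine ContinuousAt.continuousWithinAt (ContinuousAt.prodMk ?_ ?_)
    · exact ContinuousAt.comp (g := gno a 1) (continuousAt_gno hx.2.1.ne') (by fun_prop)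
    · exact ContinuousAt.comp (g := gno a 2) (continuousAt_gno hx.2.1.ne') (by fun_prop)
  have himg := (hK.image_of_continuousOn hcont).isClosed
  have hn : (y₁, y₂) ∉ (fun x => (gno a 1 (f x - p), gno a 2 (f x - p))) '' (C ∩ B) := by
    rintro ⟨x, hx, h⟩
    rw [Prod.mk.injEq] at h
    exact hy x hx.1 hx.2.1 h.1 h.2
  obtain ⟨δ, hδ, h⟩ := exists_sup_box (himg.isOpen_compl.mem_nhds hn)
  refine ⟨min δ 1, by positivity, fun x hx h0 h1 h2 => ?_⟩
  refine h (gno a 1 (f x - p), gno a 2 (f x - p)) (h1.trans_le (min_le_left _ _))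
    (h2.trans_le (min_le_left _ _)) ⟨x, ⟨hx, h0, ?_, ?_⟩, rfl⟩
  · have := abs_lt.1 (h1.trans_le (min_le_right _ _))
    constructor <;> linarith
  · have := abs_lt.1 (h2.trans_le (min_le_right _ _))
    constructor <;> linarith

variable [ChartedSpace (EuclideanHalfSpace 2) N] [IsManifold (𝓡∂ 2) ∞ N]

/-- Near a transversal interior point the flux is given by a change of variables. -/
theorem exists_local_sheet (ha : IsFrame a) (hM : IsOrientedSurface f ν) {x : N}
    (hx : x ∉ (𝓡∂ 2).boundary N) (h0 : 0 < (inner ℝ (a 0) (f x - p) : ℝ))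
    (hreg : (inner ℝ (f x - p) (ν x) : ℝ) ≠ 0) :
    ∃ V : Set N, IsOpen V ∧ x ∈ V ∧ V ⊆ (extChartAt (𝓡∂ 2) x).source ∧
      (∀ y ∈ V, ∀ z ∈ V, gno a 1 (f y - p) = gno a 1 (f z - p) →
        gno a 2 (f y - p) = gno a 2 (f z - p) → y = z) ∧
      ∀ V' ⊆ V, IsOpen V' →
        IsOpen ((fun y => (gno a 1 (f y - p), gno a 2 (f y - p))) '' V') ∧
        ∀ α β : ℝ → ℝ, (∀ s t, α s ≠ 0 → β t ≠ 0 →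
          (s, t) ∈ (fun y => (gno a 1 (f y - p), gno a 2 (f y - p))) '' V') →
          chartInt f ν x (V'.indicator (flux a f ν p α β)) =
            (SignType.sign (inner ℝ (f x - p) (ν x) : ℝ) : ℝ) * ((∫ s, α s) * ∫ t, β t) := by
  set e := extChartAt (𝓡∂ 2) x with he
  set σ : ℝ := (SignType.sign (inner ℝ (f x - p) (ν x) : ℝ) : ℝ) with hσ
  set u := tens a f p id (fun _ => 1) with hu
  set v := tens a f p (fun _ => 1) id with hv
  have hfc := hM.smooth.continuous
  have hνc := hM.normal_continuous
  have huval : ∀ y, 0 < (inner ℝ (a 0) (f y - p) : ℝ) → u y = gno a 1 (f y - p) := fun y hy => by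
    simp [hu, tens, hy]
  have hvval : ∀ y, 0 < (inner ℝ (a 0) (f y - p) : ℝ) → v y = gno a 2 (f y - p) := fun y hy => by
    simp [hv, tens, hy]
  have hus : ∀ y, 0 < (inner ℝ (a 0) (f y - p) : ℝ) →
      ContMDiffAt (𝓡∂ 2) 𝓘(ℝ, ℝ) ∞ u y := fun y hy =>
    contMDiffAt_tens hM.smooth contDiff_id contDiff_const hy
  have hvs : ∀ y, 0 < (inner ℝ (a 0) (f y - p) : ℝ) →
      ContMDiffAt (𝓡∂ 2) 𝓘(ℝ, ℝ) ∞ v y := fun y hy =>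
    contMDiffAt_tens hM.smooth contDiff_const contDiff_id hy
  set hh : E2 → E2 := fun z => planeMk (u (e.symm z), v (e.symm z)) with hhh
  set H := range (𝓡∂ 2) with hH
  set A : E2 → E2 →L[ℝ] E2 := fun z => planeMk ∘L
    ((fderivWithin ℝ (u ∘ e.symm) H z).prod (fderivWithin ℝ (v ∘ e.symm) H z)) with hA
  have hder : ∀ z ∈ e.target, z ∈ interior H → 0 < (inner ℝ (a 0) (f (e.symm z) - p) : ℝ) →
      HasFDerivAt hh (A z) z := by
    intro z hz hzi hz0
    have hn := mem_interior_iff_mem_nhds.1 hzi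
    have h1 := (hasFDerivWithinAt_comp_chart hz
      ((hus _ hz0).mdifferentiableAt (by simp))).differentiableWithinAt.hasFDerivWithinAt.hasFDerivAt
        hn
    have h2 := (hasFDerivWithinAt_comp_chart hz
      ((hvs _ hz0).mdifferentiableAt (by simp))).differentiableWithinAt.hasFDerivWithinAt.hasFDerivAt
        hn
    exact planeMk.hasFDerivAt.comp z (h1.prodMk h2)
  -- The Jacobian of (y₁, y₂) in the chart is the wedge of the two coordinate differentials, hence
  -- their bracket times the oriented area density.
  have hdet : ∀ z ∈ e.target, 0 < (inner ℝ (a 0) (f (e.symm z) - p) : ℝ) →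
      (A z).det = gnoJac a f ν p (e.symm z) * ((chartD x z).det * omega f ν (e.symm z)) := by
    intro z hz hz0
    rw [hA, det_planeMk_prod, bracket_chart hM hz ((hus _ hz0).mdifferentiableAt (by simp))
      ((hvs _ hz0).mdifferentiableAt (by simp)), hu, hv,
      bracket_tens ha hM hz0 differentiableAt_id (differentiableAt_const _)
        (differentiableAt_const _) differentiableAt_id]
    simp only [deriv_id, deriv_const, ← he]
    ring
  have hxs : x ∈ e.source := mem_extChartAt_source x
  have hz0 : e x ∈ e.target := e.map_source hxs
  have hzx : e.symm (e x) = x := e.left_inv hxs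
  have hzi : e x ∈ interior H := by
    rw [mem_interior_range_halfPlane, ← isInteriorPoint_chart_iff hz0, ← he, hzx]
    rwa [← ModelWithCorners.compl_interior, mem_compl_iff, not_not] at hx
  obtain ⟨O, hO, hT⟩ := extChartAt_target_relOpen x
  have hTn : e.target ∈ 𝓝 (e x) := by
    rw [he, hT]
    rw [he, hT] at hz0
    exact inter_mem (hO.mem_nhds hz0.1) (mem_interior_iff_mem_nhds.1 hzi)
  have hcd : ContDiffAt ℝ ∞ hh (e x) := by
    have h1 : ∀ {w : N → ℝ}, ContMDiffAt (𝓡∂ 2) 𝓘(ℝ, ℝ) ∞ w x →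
        ContDiffAt ℝ ∞ (fun z => w (e.symm z)) (e x) := by
      intro w hw
      have h2 : ContMDiffWithinAt 𝓘(ℝ, E2) 𝓘(ℝ, ℝ) ∞ (w ∘ e.symm) e.target (e x) :=
        ContMDiffAt.comp_contMDiffWithinAt (e x) (by rwa [hzx])
          (contMDiffOn_extChartAt_symm (I := 𝓡∂ 2) (n := ∞) x (e x) hz0)
      exact h2.contDiffWithinAt.contDiffAt hTn
    exact planeMk.contDiff.contDiffAt.comp (e x) ((h1 (hus x h0)).prodMk (h1 (hvs x h0)))
  have hdet0 : (A (e x)).det ≠ 0 := by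
    rw [hdet _ hz0 (by rwa [hzx]), hzx]
    exact mul_ne_zero (div_ne_zero hreg (pow_ne_zero _ h0.ne'))
      (mul_ne_zero (det_chartD_ne_zero hz0) (hM.omega_ne_zero x))
  have hstrict : HasStrictFDerivAt hh
      (((A (e x)).toContinuousLinearEquivOfDetNeZero hdet0 : E2 ≃L[ℝ] E2) : E2 →L[ℝ] E2)
      (e x) := by
    rw [ContinuousLinearMap.coe_toContinuousLinearEquivOfDetNeZero]
    exact hcd.hasStrictFDerivAt' (hder _ hz0 hzi (by rwa [hzx])) (by simp)
  -- The inverse function theorem applies since x is interior and the line of sight is transversal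
  -- to the surface at x.
  set Φ := hstrict.toOpenPartialHomeomorph hh with hΦ
  have hΦx : e x ∈ Φ.source := hstrict.mem_toOpenPartialHomeomorph_source
  have hΦc : ∀ z, Φ z = hh z := fun z => rfl
  -- Besides the domain of the local inverse, V fixes the sign of ⟨f y − p, ν y⟩, so the whole sheet
  -- counts with the sign σ of its centre.
  set V : Set N := (e.source ∩ e ⁻¹' (Φ.source ∩ interior H)) ∩
    ({y | 0 < (inner ℝ (a 0) (f y - p) : ℝ)} ∩
      {y | 0 < σ * (inner ℝ (f y - p) (ν y) : ℝ)}) with hV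
  have hVo : IsOpen V := by
    refine ((continuousOn_extChartAt x).isOpen_inter_preimage (isOpen_extChartAt_source x)
      (Φ.open_source.inter isOpen_interior)).inter (IsOpen.inter ?_ ?_)
    · exact isOpen_lt continuous_const (by fun_prop)
    · exact isOpen_lt continuous_const (by fun_prop)
  have hσ1 : |σ| = 1 := by
    rcases lt_or_gt_of_ne hreg with h | h <;> simp [hσ, sign_neg, sign_pos, h]
  have hxV : x ∈ V := by
    refine ⟨⟨hxs, hΦx, hzi⟩, h0, ?_⟩
    rcases lt_or_gt_of_ne hreg with h | h <;> simp [hσ, sign_neg, sign_pos, h]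
  have hhval : ∀ y ∈ V, hh (e y) = planeMk (gno a 1 (f y - p), gno a 2 (f y - p)) := by
    intro y hy
    simp only [hhh, e.left_inv hy.1.1, huval y hy.2.1, hvval y hy.2.1]
  refine ⟨V, hVo, hxV, fun y hy => hy.1.1, ?_, ?_⟩
  · intro y hy z hz h1 h2
    have : hh (e y) = hh (e z) := by rw [hhval y hy, hhval z hz, h1, h2]
    exact e.injOn hy.1.1 hz.1.1 (Φ.injOn hy.1.2.1 hz.1.2.1 this)
  intro V' hV' hV'o
  set O' : Set E2 := e.target ∩ e.symm ⁻¹' V' with hO'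
  have hO'V : ∀ z ∈ O', z ∈ e.target ∧ e.symm z ∈ V ∧ z ∈ Φ.source ∧ z ∈ interior H := by
    intro z hz
    have h1 := hV' hz.2
    have h2 := h1.1.2
    simp only [mem_preimage, e.right_inv hz.1] at h2
    exact ⟨hz.1, h1, h2⟩
  have hO'o : IsOpen O' := by
    obtain ⟨U, hU, hUe⟩ := extChartAt_preimage_relOpen x hV'o
    have : O' = U ∩ interior H := by
      refine Subset.antisymm (fun z hz => ⟨?_, (hO'V z hz).2.2.2⟩) fun z hz => ?_
      · have : z ∈ U ∩ range (𝓡∂ 2) := hUe ▸ hz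
        exact this.1
      · have : z ∈ U ∩ range (𝓡∂ 2) := ⟨hz.1, interior_subset hz.2⟩
        rw [← hUe] at this
        exact this
    rw [this]
    exact hU.inter isOpen_interior
  have himgo : IsOpen (hh '' O') :=
    Φ.isOpen_image_of_subset_source hO'o fun z hz => (hO'V z hz).2.2.1
  have himg : (fun y => (gno a 1 (f y - p), gno a 2 (f y - p))) '' V' = planeMk ⁻¹' (hh '' O') := by
    ext w
    constructor
    · rintro ⟨y, hy, rfl⟩
      refine ⟨e y, ⟨e.map_source (hV' hy).1.1, ?_⟩, hhval y (hV' hy)⟩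
      simpa only [mem_preimage, e.left_inv (hV' hy).1.1] using hy
    · rintro ⟨z, hz, hzw⟩
      refine ⟨e.symm z, hz.2, ?_⟩
      have h1 := hhval _ (hV' hz.2)
      rw [e.right_inv hz.1, hzw] at h1
      exact (planeMk_measurableEmbedding.injective h1).symm
  refine ⟨himg ▸ himgo.preimage planeMk.continuous, fun α β hαβ => ?_⟩
  have hcv := integral_image_eq_integral_abs_det_fderiv_smul volume hO'o.measurableSet
    (fun z hz => (hder z (hO'V z hz).1 (hO'V z hz).2.2.2
      (hO'V z hz).2.1.2.1).hasFDerivWithinAt)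
    (fun z hz w hw h => Φ.injOn (hO'V z hz).2.2.1 (hO'V w hw).2.2.1 h)
    (fun y : E2 => α (y 0) * β (y 1))
  have hfull : ∫ y in hh '' O', α (y 0) * β (y 1) = (∫ s, α s) * ∫ t, β t := by
    rw [setIntegral_eq_integral_of_forall_compl_eq_zero, integral_plane]
    · simp only [planeMk_zero, planeMk_one]
      rw [Measure.volume_eq_prod, integral_prod_mul]
    · intro y hy
      by_contra hne
      have h1 := hαβ _ _ (left_ne_zero_of_mul hne) (right_ne_zero_of_mul hne)
      rw [himg, mem_preimage, planeMk_eta] at h1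
      exact hy h1
  rw [hfull] at hcv
  rw [hcv, ← integral_const_mul, chartInt, ← he]
  have hsub : ∫ z in e.target, V'.indicator (flux a f ν p α β) (e.symm z) * areaDensity f ν x z =
      ∫ z in O', V'.indicator (flux a f ν p α β) (e.symm z) * areaDensity f ν x z := by
    refine setIntegral_eq_of_subset_of_forall_sdiff_eq_zero
      (measurableSet_extChartAt_target x) inter_subset_left ?_
    rintro z ⟨hz1, hz2⟩
    rw [indicator_of_notMem (show e.symm z ∉ V' from fun h => hz2 ⟨hz1, h⟩), zero_mul]
  rw [hsub]
  refine setIntegral_congr_fun hO'o.measurableSet fun z hz => ?_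
  obtain ⟨hzT, hzV, -, -⟩ := hO'V z hz
  have hpos := hzV.2.1
  simp only [mem_ofPred_eq] at hpos
  have hval := hhval _ hzV
  rw [e.right_inv hzT] at hval
  simp only [smul_eq_mul]
  rw [indicator_of_mem (show e.symm z ∈ V' from hz.2), hdet z hzT hpos, hval, planeMk_zero, planeMk_one, flux, areaDensity,
    abs_mul, abs_mul]
  -- The change of variables yields |det|, whereas the flux carries the signed Jacobian; on V they
  -- differ by the constant factor σ.
  have hjac : gnoJac a f ν p (e.symm z) = σ * |gnoJac a f ν p (e.symm z)| := by
    have h1 : 0 < σ * gnoJac a f ν p (e.symm z) := by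
      rw [gnoJac, ← mul_div_assoc]
      exact div_pos hzV.2.2 (pow_pos hpos 3)
    have h2 : |gnoJac a f ν p (e.symm z)| = σ * gnoJac a f ν p (e.symm z) := by
      rw [← abs_of_pos h1, abs_mul, hσ1, one_mul]
    rw [h2, ← mul_assoc]
    have : σ * σ = 1 := by rw [← abs_mul_abs_self, hσ1, one_mul]
    rw [this, one_mul]
  have htens : tens a f p α β (e.symm z) =
      α (gno a 1 (f (e.symm z) - p)) * β (gno a 2 (f (e.symm z) - p)) := by
    simp [tens, hpos]
  rw [htens]
  conv_lhs => rw [hjac]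
  simp only [← he]
  ring

end Flux

/-! ### The degree of a box and the signed count of a fibre -/

section Degree

variable {N : Type*} [TopologicalSpace N] [ChartedSpace (EuclideanHalfSpace 2) N]
  {f ν : N → E3} {p : E3} {a : Fin 3 → E3}

/-- The parameters of the surface lying over the point `(y₁, y₂)` of the gnomonic plane. -/
def gnoFiber (a : Fin 3 → E3) (f : N → E3) (p : E3) (y₁ y₂ : ℝ) : Set N :=
  {x | 0 < (inner ℝ (a 0) (f x - p) : ℝ) ∧ gno a 1 (f x - p) = y₁ ∧ gno a 2 (f x - p) = y₂}

variable [IsManifold (𝓡∂ 2) ∞ N] [CompactSpace N] [T2Space N]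

/-- Over a regular value the flux of concentrated test functions is the signed count. -/
theorem IsAreaIntegral.exists_concentration (ha : IsFrame a) (hM : IsOrientedSurface f ν)
    (hp : p ∉ range f) {J : (N → ℝ) → ℝ} (hJ : IsAreaIntegral f ν J) {y₁ y₂ : ℝ}
    (hS : ∀ x ∈ gnoFiber a f p y₁ y₂, x ∉ (𝓡∂ 2).boundary N ∧
      (inner ℝ (f x - p) (ν x) : ℝ) ≠ 0) :
    ∃ δ > 0, ∀ α β : ℝ → ℝ, IsTest α → IsTest β →
      tsupport α ⊆ Ioo (y₁ - δ) (y₁ + δ) → tsupport β ⊆ Ioo (y₂ - δ) (y₂ + δ) →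
      J (flux a f ν p α β) =
        ((∑ᶠ x ∈ gnoFiber a f p y₁ y₂,
          (SignType.sign (inner ℝ (f x - p) (ν x) : ℝ) : ℤ) : ℤ) : ℝ) *
        ((∫ s, α s) * ∫ t, β t) := by
  classical
  set S := gnoFiber a f p y₁ y₂ with hSdef
  have hfc := hM.smooth.continuous
  have hScpt : IsCompact S := by
    have := (isClosed_gnomonicBox ha hfc hp (isCompact_singleton (x := y₁))
      (isCompact_singleton (x := y₂))).isCompact
    exact this
  choose! V hVo hxV hVsrc hVinj hVflux using fun x (hx : x ∈ S) =>
    exists_local_sheet ha hM (hS x hx).1 hx.1 (hS x hx).2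
  -- The fibre is compact, and each sheet contains only one of its points.
  have hfin : S.Finite := by
    obtain ⟨t, ht, hcov⟩ := hScpt.elim_nhds_subcover V fun x hx => (hVo x hx).mem_nhds (hxV x hx)
    refine t.finite_toSet.subset fun x hx => ?_
    obtain ⟨y, hy, hxy⟩ := mem_iUnion₂.1 (hcov hx)
    have hyS := ht y hy
    have := hVinj y hyS x hxy y (hxV y hyS) (hx.2.1.trans hyS.2.1.symm)
      (hx.2.2.trans hyS.2.2.symm)
    rw [this]
    exact hy
  obtain ⟨U, hU, hUd⟩ := hfin.t2_separation
  set W : N → Set N := fun x => V x ∩ U x with hW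
  have hWo : ∀ x ∈ S, IsOpen (W x) := fun x hx => (hVo x hx).inter (hU x).2
  have hxW : ∀ x ∈ S, x ∈ W x := fun x hx => ⟨hxV x hx, (hU x).1⟩
  have hWd : ∀ x ∈ S, ∀ y ∈ S, x ≠ y → Disjoint (W x) (W y) := fun x hx y hy hxy =>
    (hUd hx hy hxy).mono inter_subset_right inter_subset_right
  -- Two smallness conditions: δ₀ keeps the support of the flux inside the sheets, and δ₁ below
  -- makes every sheet cover the whole box, so that each contributes the full ∫α ∫β.
  obtain ⟨δ₀, hδ₀, hav⟩ := exists_box_avoiding ha hfc hp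
    (C := (⋃ x ∈ S, W x)ᶜ) (isOpen_biUnion hWo).isClosed_compl y₁ y₂
    (fun x hxC h0 h1 h2 => hxC (mem_biUnion (show x ∈ S from ⟨h0, h1, h2⟩) (hxW x ⟨h0, h1, h2⟩)))
  have hbox : ∀ x ∈ S, ∃ δ > 0, ∀ w : ℝ × ℝ, |w.1 - y₁| < δ → |w.2 - y₂| < δ →
      w ∈ (fun y => (gno a 1 (f y - p), gno a 2 (f y - p))) '' W x := by
    intro x hx
    exact exists_sup_box (y := (y₁, y₂))
      (((hVflux x hx) (W x) inter_subset_left (hWo x hx)).1.mem_nhds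
        ⟨x, hxW x hx, by simp only [hx.2.1, hx.2.2]⟩)
  choose! d hd hdW using hbox
  obtain ⟨δ₁, hδ₁, hδ₁d⟩ : ∃ δ₁ > 0, ∀ x ∈ S, δ₁ ≤ d x := by
    rcases S.eq_empty_or_nonempty with he | hne
    · exact ⟨1, one_pos, fun x hx => by rw [he] at hx; exact hx.elim⟩
    · obtain ⟨x, hx, hmin⟩ := hfin.exists_minimalFor d S hne
      refine ⟨d x, hd x hx, fun y hy => ?_⟩
      by_contra h
      exact h (hmin hy (not_le.1 h).le)
  refine ⟨min δ₀ δ₁, lt_min hδ₀ hδ₁, fun α β hα hβ hαs hβs => ?_⟩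
  have habs : ∀ {s y : ℝ}, s ∈ Ioo (y - min δ₀ δ₁) (y + min δ₀ δ₁) →
      |s - y| < δ₀ ∧ |s - y| < δ₁ := by
    intro s y hs
    have : |s - y| < min δ₀ δ₁ := abs_lt.2 ⟨by linarith [hs.1], by linarith [hs.2]⟩
    exact ⟨this.trans_le (min_le_left _ _), this.trans_le (min_le_right _ _)⟩
  set G := flux a f ν p α β with hG
  have hGc : Continuous G := continuous_flux ha hM hp hα hβ
  have hGs : ∀ w ∈ tsupport G, ∃ x ∈ S, w ∈ W x := by
    intro w hw
    obtain ⟨h0, h1, h2⟩ := tsupport_tens_subset ha hfc hp hα.compact hβ.compact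
      (tsupport_flux_subset hw)
    by_contra hcon
    refine hav w (fun h => hcon ?_) h0 (habs (hαs h1)).1 (habs (hβs h2)).1
    obtain ⟨x, hx, hxw⟩ := mem_iUnion₂.1 h
    exact ⟨x, hx, hxw⟩
  -- The support of G is covered by disjoint open sheets, so it does not meet the frontier of any of
  -- them. Hence the restriction of G to one sheet is continuous and supported in one chart.
  have hnotcl : ∀ x ∈ S, ∀ w ∈ tsupport G, w ∈ closure (W x) → w ∈ W x := by
    intro x hx w hw hcl
    obtain ⟨y, hy, hwy⟩ := hGs w hw
    by_cases hxy : x = y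
    · rwa [hxy]
    · exact absurd hcl (((hWd x hx y hy hxy).closure_left (hWo y hy)).notMem_of_mem_right hwy)
  have hic : ∀ x ∈ S, Continuous ((W x).indicator G) := by
    intro x hx
    refine hGc.indicator fun w hw => ?_
    by_contra hne
    have h1 := hnotcl x hx w (subset_tsupport G hne) (frontier_subset_closure hw)
    rw [(hWo x hx).frontier_eq] at hw
    exact hw.2 h1
  have his : ∀ x ∈ S, tsupport ((W x).indicator G) ⊆ (extChartAt (𝓡∂ 2) x).source := by
    intro x hx w hw
    refine hVsrc x hx (hnotcl x hx w ?_ ?_).1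
    · exact closure_mono (support_indicator.subset.trans inter_subset_right) hw
    · exact closure_mono (support_indicator.subset.trans inter_subset_left) hw
  have hsum : G = ∑ x ∈ hfin.toFinset, (W x).indicator G := by
    ext w
    rw [Finset.sum_apply]
    by_cases hw : G w = 0
    · rw [hw]
      refine (Finset.sum_eq_zero fun x _ => ?_).symm
      rw [indicator_apply_eq_zero]
      exact fun _ => hw
    · obtain ⟨x, hx, hwx⟩ := hGs w (subset_tsupport G hw)
      rw [Finset.sum_eq_single_of_mem x (hfin.mem_toFinset.2 hx), indicator_of_mem hwx]
      intro y hy hyx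
      exact indicator_of_notMem ((hWd x hx y (hfin.mem_toFinset.1 hy) hyx.symm).notMem_of_mem_left
        hwx) _
  rw [hsum, hJ.sum _ _ fun x hx => hic x (hfin.mem_toFinset.1 hx),
    finsum_mem_eq_finite_toFinset_sum _ hfin, Int.cast_sum, Finset.sum_mul]
  refine Finset.sum_congr rfl fun x hx => ?_
  have hx := hfin.mem_toFinset.1 hx
  rw [hJ.chart x _ (hic x hx) (his x hx),
    ((hVflux x hx) (W x) inter_subset_left (hWo x hx)).2 α β]
  · congr 1
    cases SignType.sign (inner ℝ (f x - p) (ν x) : ℝ) <;> simp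
  · intro s t hs ht
    exact hdW x hx (s, t) ((habs (hαs (subset_tsupport _ hs))).2.trans_le (hδ₁d x hx))
      ((habs (hβs (subset_tsupport _ ht))).2.trans_le (hδ₁d x hx))

/-- On a box off the projected boundary the flux is a multiple of the integral. -/
theorem IsAreaIntegral.exists_degree (ha : IsFrame a) (hM : IsOrientedSurface f ν)
    (hp : p ∉ range f) {J : (N → ℝ) → ℝ} (hJ : IsAreaIntegral f ν J) {l₁ u₁ l₂ u₂ : ℝ}
    (h₁ : l₁ < u₁) (h₂ : l₂ < u₂)
    (hb : ∀ x ∈ (𝓡∂ 2).boundary N, 0 < (inner ℝ (a 0) (f x - p) : ℝ) →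
      gno a 1 (f x - p) ∈ Ioo l₁ u₁ → gno a 2 (f x - p) ∉ Ioo l₂ u₂) :
    ∃ κ : ℝ, ∀ α β : ℝ → ℝ, IsTest α → IsTest β → tsupport α ⊆ Ioo l₁ u₁ →
      tsupport β ⊆ Ioo l₂ u₂ → J (flux a f ν p α β) = κ * ((∫ s, α s) * ∫ t, β t) := by
  have htens : ∀ α β : ℝ → ℝ, tsupport α ⊆ Ioo l₁ u₁ → tsupport β ⊆ Ioo l₂ u₂ →
      ∀ x ∈ (𝓡∂ 2).boundary N, tens a f p α β x = 0 := by
    intro α β hα hβ x hx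
    by_contra hne
    by_cases h0 : 0 < (inner ℝ (a 0) (f x - p) : ℝ)
    · simp only [tens, if_pos h0] at hne
      exact hb x hx h0 (hα (subset_tsupport _ (left_ne_zero_of_mul hne)))
        (hβ (subset_tsupport _ (right_ne_zero_of_mul hne)))
    · exact hne (by simp [tens, h0])
  obtain ⟨φ, hφ, hφs, hφ1⟩ := exists_isTest h₁
  obtain ⟨ψ, hψ, hψs, hψ1⟩ := exists_isTest h₂
  -- Subtracting (∫α)φ leaves a function of zero mean, hence a derivative within the same interval.
  -- Applied in each variable, this reduces every flux to the flux of φ ⊗ ψ, whose value is κ.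
  have hsub : ∀ {α φ : ℝ → ℝ} {l u : ℝ}, IsTest α → IsTest φ → tsupport α ⊆ Ioo l u →
      tsupport φ ⊆ Ioo l u → ∫ t, φ t = 1 → ∃ A : ℝ → ℝ, IsTest A ∧ tsupport A ⊆ Ioo l u ∧
      α = deriv A + (∫ t, α t) • φ := by
    intro α φ l u hα hφ hαs hφs hφ1
    have hT : IsTest (α + (-∫ t, α t) • φ) := hα.add (hφ.const_smul _)
    have hTs : tsupport (α + (-∫ t, α t) • φ) ⊆ Ioo l u :=
      (tsupport_add _ _).trans (union_subset hαs
        ((closure_mono (Function.support_const_smul_subset _ _)).trans hφs))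
    have hT0 : ∫ t, (α + (-∫ t, α t) • φ) t = 0 := by
      simp only [Pi.add_apply, Pi.smul_apply, smul_eq_mul]
      rw [integral_add hα.integrable (hφ.integrable.const_mul _), integral_const_mul, hφ1]
      ring
    obtain ⟨A, hA, hAs, hAd, -⟩ := hT.exists_antideriv hTs hT0
    refine ⟨A, hA, hAs, ?_⟩
    rw [hAd, add_assoc, ← add_smul, neg_add_cancel, zero_smul, add_zero]
  refine ⟨J (flux a f ν p φ ψ), fun α β hα hβ hαs hβs => ?_⟩
  obtain ⟨A, hA, hAs, hAe⟩ := hsub hα hφ hαs hφs hφ1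
  obtain ⟨B, hB, hBs, hBe⟩ := hsub hβ hψ hβs hψs hψ1
  have e1 : flux a f ν p α β = flux a f ν p (deriv A) β + (∫ t, α t) • flux a f ν p φ β := by
    ext x
    conv_lhs => rw [hAe]
    simp only [flux, tens, Pi.add_apply, Pi.smul_apply, smul_eq_mul]
    split_ifs <;> ring
  have e2 : flux a f ν p φ β = flux a f ν p φ (deriv B) + (∫ t, β t) • flux a f ν p φ ψ := by
    ext x
    conv_lhs => rw [hBe]
    simp only [flux, tens, Pi.add_apply, Pi.smul_apply, smul_eq_mul]
    split_ifs <;> ring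
  have hc := continuous_flux ha hM hp hφ hψ
  have hc1 := continuous_flux ha hM hp hφ hβ
  rw [e1, hJ.add _ _ (continuous_flux ha hM hp hA.deriv hβ) (hc1.const_smul _),
    hJ.smul _ _ hc1, hJ.flux_deriv_left ha hM hp hA hβ (htens _ _ hAs hβs),
    e2, hJ.add _ _ (continuous_flux ha hM hp hφ hB.deriv) (hc.const_smul _),
    hJ.smul _ _ hc, hJ.flux_deriv_right ha hM hp hφ hB (htens _ _ hφs hBs)]
  ring

/-- The degree of a box counts the fibre of each regular value in it. -/
theorem IsAreaIntegral.degree_eq_count (ha : IsFrame a) (hM : IsOrientedSurface f ν)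
    (hp : p ∉ range f) {J : (N → ℝ) → ℝ} (hJ : IsAreaIntegral f ν J) {l₁ u₁ l₂ u₂ κ : ℝ}
    (hb : ∀ x ∈ (𝓡∂ 2).boundary N, 0 < (inner ℝ (a 0) (f x - p) : ℝ) →
      gno a 1 (f x - p) ∈ Ioo l₁ u₁ → gno a 2 (f x - p) ∉ Ioo l₂ u₂)
    (hκ : ∀ α β : ℝ → ℝ, IsTest α → IsTest β → tsupport α ⊆ Ioo l₁ u₁ →
      tsupport β ⊆ Ioo l₂ u₂ → J (flux a f ν p α β) = κ * ((∫ s, α s) * ∫ t, β t))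
    {y₁ y₂ : ℝ} (h₁ : y₁ ∈ Ioo l₁ u₁) (h₂ : y₂ ∈ Ioo l₂ u₂)
    (hreg : ∀ x ∈ gnoFiber a f p y₁ y₂, (inner ℝ (f x - p) (ν x) : ℝ) ≠ 0) :
    ((∑ᶠ x ∈ gnoFiber a f p y₁ y₂,
      (SignType.sign (inner ℝ (f x - p) (ν x) : ℝ) : ℤ) : ℤ) : ℝ) = κ := by
  obtain ⟨δ, hδ, hconc⟩ := hJ.exists_concentration ha hM hp (y₁ := y₁) (y₂ := y₂)
    fun x hx => ⟨fun hbd => hb x hbd hx.1 (hx.2.1 ▸ h₁) (hx.2.2 ▸ h₂), hreg x hx⟩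
  -- Unit bumps are supported both in the box and near y; the two evaluations of their flux are κ
  -- and the count.
  obtain ⟨φ, hφ, hφs, hφ1⟩ := exists_isTest
    (show max l₁ (y₁ - δ) < min u₁ (y₁ + δ) from
      max_lt (lt_min (h₁.1.trans h₁.2) (by linarith [h₁.1])) (lt_min (by linarith [h₁.2])
        (by linarith)))
  obtain ⟨ψ, hψ, hψs, hψ1⟩ := exists_isTest
    (show max l₂ (y₂ - δ) < min u₂ (y₂ + δ) from
      max_lt (lt_min (h₂.1.trans h₂.2) (by linarith [h₂.1])) (lt_min (by linarith [h₂.2])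
        (by linarith)))
  have e1 := hconc φ ψ hφ hψ
    (hφs.trans (Ioo_subset_Ioo (le_max_right _ _) (min_le_right _ _)))
    (hψs.trans (Ioo_subset_Ioo (le_max_right _ _) (min_le_right _ _)))
  have e2 := hκ φ ψ hφ hψ
    (hφs.trans (Ioo_subset_Ioo (le_max_left _ _) (min_le_left _ _)))
    (hψs.trans (Ioo_subset_Ioo (le_max_left _ _) (min_le_left _ _)))
  rw [e1, hφ1, hψ1] at e2
  simpa using e2

end Degree

/-! ### Tangent directions are negligible; the count on a region -/

section Regular

variable {N : Type*} {f ν : N → E3} {p : E3} {a : Fin 3 → E3}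

/-- The directions in which the surface is tangent to the line of sight. -/
def badDirs (f ν : N → E3) (p : E3) : Set E3 :=
  (fun x => sphereProj p (f x)) '' {x | (inner ℝ (f x - p) (ν x) : ℝ) = 0}

theorem mem_rayHits_iff (hp : p ∉ range f) {q : E3} (hq : ‖q - p‖ = 1) {x : N} :
    x ∈ rayHits f p q ↔ sphereProj p (f x) = q := by
  have hx : f x ≠ p := fun h => hp ⟨x, h⟩
  rw [sphereProj_eq_iff hx hq]
  constructor
  · rintro ⟨t, ht, h⟩
    refine ⟨t, lt_of_le_of_ne ht ?_, by rw [h]; abel⟩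
    rintro rfl
    exact hx (by simpa using h)
  · rintro ⟨t, ht, h⟩
    exact ⟨t, ht.le, by rw [← h]; abel⟩

theorem IsFrame.rayHits_eq (ha : IsFrame a) (hp : p ∉ range f) {q : E3} (hq : ‖q - p‖ = 1)
    (hq0 : 0 < (inner ℝ (a 0) (q - p) : ℝ)) :
    rayHits f p q = gnoFiber a f p (gno a 1 (q - p)) (gno a 2 (q - p)) := by
  ext x
  have hx : f x ≠ p := fun h => hp ⟨x, h⟩
  rw [mem_rayHits_iff hp hq, ha.sphereProj_eq_iff hx hq hq0]
  rfl

/-- Along the ray f x − p is a positive multiple of q − p, so the sign is unchanged. -/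
theorem signedCount_eq (hp : p ∉ range f) {q : E3} (hq : ‖q - p‖ = 1) :
    signedCount f ν p q =
      ∑ᶠ x ∈ rayHits f p q, (SignType.sign (inner ℝ (f x - p) (ν x) : ℝ) : ℤ) := by
  refine finsum_mem_congr rfl fun x hx => ?_
  rw [mem_rayHits_iff hp hq, sphereProj_eq_iff (fun h => hp ⟨x, h⟩) hq] at hx
  obtain ⟨t, ht, h⟩ := hx
  rw [h, real_inner_smul_left, sign_mul, sign_pos ht, one_mul]

theorem notMem_badDirs (hp : p ∉ range f) {q : E3} (hq : ‖q - p‖ = 1) (hb : q ∉ badDirs f ν p)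
    {x : N} (hx : x ∈ rayHits f p q) : (inner ℝ (f x - p) (ν x) : ℝ) ≠ 0 := fun h =>
  hb ⟨x, h, (mem_rayHits_iff hp hq).1 hx⟩

/-- The cone over the tangent directions. -/
def badCone (f ν : N → E3) (p : E3) : Set E3 :=
  {w | ∃ (r : ℝ) (x : N), (inner ℝ (f x - p) (ν x) : ℝ) = 0 ∧ w = r • (f x - p)}

theorem sphereProj_continuousAt {y : E3} (hy : y ≠ p) : ContinuousAt (sphereProj p) y := by
  have h : ContinuousAt (fun y : E3 => y - p) y := continuousAt_id.sub continuousAt_const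
  have h0 : ‖y - p‖ ≠ 0 := by simpa [sub_eq_zero] using hy
  exact continuousAt_const.add ((h.norm.inv₀ h0).smul h)

theorem smul_mem_badCone {q : E3} (hq : q ∈ badDirs f ν p) (r : ℝ) :
    r • (q - p) ∈ badCone f ν p := by
  obtain ⟨x, hx, rfl⟩ := hq
  refine ⟨r * ‖f x - p‖⁻¹, x, hx, ?_⟩
  simp [sphereProj, smul_smul]

variable [TopologicalSpace N] [ChartedSpace (EuclideanHalfSpace 2) N] [CompactSpace N]

theorem IsOrientedSurface.isCompact_badDirs (hM : IsOrientedSurface f ν) (hp : p ∉ range f) :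
    IsCompact (badDirs f ν p) := by
  have hf := hM.smooth.continuous
  have hν := hM.normal_continuous
  have hcl : IsClosed {x | (inner ℝ (f x - p) (ν x) : ℝ) = 0} :=
    isClosed_eq (by fun_prop) continuous_const
  refine hcl.isCompact.image ?_
  unfold sphereProj
  have hne : ∀ x, ‖f x - p‖ ≠ 0 := fun x => by
    simpa [sub_eq_zero] using fun h => hp ⟨x, h⟩
  exact continuous_const.add (((hf.sub continuous_const).norm.inv₀ hne).smul
    (hf.sub continuous_const))

variable [IsManifold (𝓡∂ 2) ∞ N]

/-- Sard's argument for the cone map (z, r) ↦ r(f(z) − p) in finitely many charts. At a tangency its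
partial derivatives are all orthogonal to ν, so its Jacobian vanishes; the image of such points is
null, boundary charts included. -/
theorem IsOrientedSurface.volume_badCone (hM : IsOrientedSurface f ν) :
    volume (badCone f ν p) = 0 := by
  obtain ⟨t, ht⟩ := CompactSpace.elim_nhds_subcover
    (fun x : N => (extChartAt (𝓡∂ 2) x).source) fun x => extChartAt_source_mem_nhds x
  set pr : E3 →L[ℝ] E2 := planeMk ∘L ((EuclideanSpace.proj (𝕜 := ℝ) (0 : Fin 3)).prod
    (EuclideanSpace.proj (𝕜 := ℝ) (1 : Fin 3))) with hpr
  set Φ : N → E3 → E3 := fun k w => w 2 • (f ((extChartAt (𝓡∂ 2) k).symm (pr w)) - p) with hΦ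
  set S : N → Set E3 := fun k => {w | pr w ∈ (extChartAt (𝓡∂ 2) k).target ∧
    (inner ℝ (f ((extChartAt (𝓡∂ 2) k).symm (pr w)) - p)
      (ν ((extChartAt (𝓡∂ 2) k).symm (pr w))) : ℝ) = 0} with hS
  have hcov : badCone f ν p ⊆ ⋃ k ∈ t, Φ k '' S k := by
    rintro _ ⟨r, x, hx, rfl⟩
    have hxt : x ∈ ⋃ k ∈ t, (extChartAt (𝓡∂ 2) k).source := by rw [ht]; trivial
    obtain ⟨k, hk, hxk⟩ := mem_iUnion₂.1 hxt
    refine mem_biUnion hk ?_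
    set z := extChartAt (𝓡∂ 2) k x with hz
    have hprz : pr (WithLp.toLp 2 ![z 0, z 1, r]) = z := by
      ext i
      fin_cases i <;> simp [hpr]
    have hzx : (extChartAt (𝓡∂ 2) k).symm z = x := (extChartAt (𝓡∂ 2) k).left_inv hxk
    refine ⟨WithLp.toLp 2 ![z 0, z 1, r], ⟨?_, ?_⟩, ?_⟩
    · rw [hprz]; exact (extChartAt (𝓡∂ 2) k).map_source hxk
    · rw [hprz, hzx]; exact hx
    · simp only [hΦ, hprz, hzx]
      simp
  refine measure_mono_null hcov ((measure_biUnion_null_iff t.countable_toSet).2 fun k _ => ?_)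
  set e := extChartAt (𝓡∂ 2) k with he
  refine addHaar_image_eq_zero_of_det_fderivWithin_eq_zero volume
    (f' := fun w => w 2 • ((md f (e.symm (pr w)) ∘L chartD k (pr w)) ∘L pr) +
      (EuclideanSpace.proj (𝕜 := ℝ) (2 : Fin 3)).smulRight (f (e.symm (pr w)) - p)) ?_ ?_
  · rintro w ⟨hw, -⟩
    have h1 := hasFDerivWithinAt_comp_chart hw (hM.mdiffAt (e.symm (pr w)))
    have h2 : HasFDerivWithinAt (fun w => f (e.symm (pr w)))
        ((md f (e.symm (pr w)) ∘L chartD k (pr w)) ∘L pr) (S k) w :=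
      h1.comp w pr.hasFDerivWithinAt fun y hy => extChartAt_target_subset_range k hy.1
    exact (EuclideanSpace.proj (𝕜 := ℝ) (2 : Fin 3)).hasFDerivWithinAt.smul (h2.sub_const p)
  · rintro w ⟨hw, hw0⟩
    by_contra hdet
    -- A nonzero determinant would put ν in the range of the derivative, contradicting
    -- orthogonality.
    obtain ⟨v, hv⟩ := (ContinuousLinearMap.toContinuousLinearEquivOfDetNeZero _ hdet).surjective
      (ν (e.symm (pr w)))
    rw [ContinuousLinearMap.toContinuousLinearEquivOfDetNeZero_apply] at hv
    have h1 := congrArg (fun y : E3 => (inner ℝ (ν (e.symm (pr w))) y : ℝ)) hv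
    have h2 : (inner ℝ (ν (e.symm (pr w))) (f (e.symm (pr w)) - p) : ℝ) = 0 := by
      rw [real_inner_comm]; exact hw0
    have h3 : (inner ℝ (ν (e.symm (pr w))) (ν (e.symm (pr w))) : ℝ) = 1 := by
      rw [real_inner_self_eq_norm_sq, hM.normal_unit]; norm_num
    simp only [add_apply, smul_apply, ContinuousLinearMap.comp_apply,
      ContinuousLinearMap.smulRight_apply, inner_add_right, inner_smul_right, hM.normal_md, h2,
      h3, mul_zero, add_zero] at h1
    exact zero_ne_one h1

/-- Almost every direction is transversal to the surface. -/
theorem IsOrientedSurface.sphereArea_badDirs (hM : IsOrientedSurface f ν) (hp : p ∉ range f) :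
    sphereArea p (badDirs f ν p) = 0 := by
  have hm : Measurable (fun u : Metric.sphere (0 : E3) 1 => p + (u : E3)) := by fun_prop
  have hB := (hM.isCompact_badDirs hp).measurableSet
  -- Area on the sphere is a multiple of the volume of the solid cone over a set.
  rw [sphereArea, Measure.map_apply hm hB, Measure.toSphere_apply' _ (hm hB)]
  refine mul_eq_zero_of_right _ (measure_mono_null ?_ (hM.volume_badCone (p := p)))
  rintro _ ⟨r, -, _, ⟨u, hu, rfl⟩, rfl⟩
  have := smul_mem_badCone (r := r) (show p + (u : E3) ∈ badDirs f ν p from hu)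
  simpa using this

/-- Transversal directions are dense in the sphere. -/
theorem IsOrientedSurface.exists_regular (hM : IsOrientedSurface f ν) {U : Set E3} (hU : IsOpen U)
    {q : E3} (hq : q ∈ U) (hq1 : ‖q - p‖ = 1) :
    ∃ q' ∈ U, ‖q' - p‖ = 1 ∧ q' ∉ badDirs f ν p := by
  have hqp : q ≠ p := by rintro rfl; simp at hq1
  have hqq : sphereProj p q = q := by simp [sphereProj, hq1]
  set W : Set E3 := (fun w => p + w) ⁻¹' ({p}ᶜ ∩ sphereProj p ⁻¹' U) with hW
  have hWo : IsOpen W := by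
    refine IsOpen.preimage (by fun_prop) ?_
    exact ContinuousOn.isOpen_inter_preimage
      (fun y hy => (sphereProj_continuousAt hy).continuousWithinAt) isOpen_compl_singleton hU
  have hWn : W.Nonempty := by
    refine ⟨q - p, ?_⟩
    simp only [hW, mem_preimage, add_sub_cancel, mem_inter_iff, mem_compl_iff, mem_singleton_iff]
    exact ⟨hqp, hqq.symm ▸ hq⟩
  -- The open cone over U has positive volume, so it is not contained in the null cone of
  -- tangencies.
  have hpos := hWo.measure_pos volume hWn
  obtain ⟨w, hw, hwb⟩ : ∃ w ∈ W, w ∉ badCone f ν p := by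
    by_contra! h
    exact hpos.ne' (measure_mono_null h hM.volume_badCone)
  refine ⟨sphereProj p (p + w), hw.2, sphereProj_sub_norm hw.1, fun hb => hwb ?_⟩
  have := smul_mem_badCone hb ‖w‖
  have hw0 : w ≠ 0 := fun h => hw.1 (by simp [h])
  rwa [sphereProj, add_sub_cancel_left, add_sub_cancel_left, smul_smul,
    mul_inv_cancel₀ (norm_ne_zero_iff.2 hw0), one_smul] at this

theorem IsOrientedSurface.isCountOn (hM : IsOrientedSurface f ν) (hp : p ∉ range f)
    {A : Set E3} {k : ℤ} (hk : ∀ q ∈ A, q ∉ badDirs f ν p → signedCount f ν p q = k) :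
    IsCountOn f ν p A k := by
  have h : ∀ᵐ q ∂(sphereArea p), q ∉ badDirs f ν p := by
    rw [ae_iff]
    simpa using hM.sphereArea_badDirs hp
  filter_upwards [h] with q hq hqA using hk q hqA hq

variable [T2Space N]

theorem IsAreaIntegral.signedCount_eq_degree (ha : IsFrame a) (hM : IsOrientedSurface f ν)
    (hp : p ∉ range f) {J : (N → ℝ) → ℝ} (hJ : IsAreaIntegral f ν J) {l₁ u₁ l₂ u₂ κ : ℝ}
    (hb : ∀ x ∈ (𝓡∂ 2).boundary N, 0 < (inner ℝ (a 0) (f x - p) : ℝ) →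
      gno a 1 (f x - p) ∈ Ioo l₁ u₁ → gno a 2 (f x - p) ∉ Ioo l₂ u₂)
    (hκ : ∀ α β : ℝ → ℝ, IsTest α → IsTest β → tsupport α ⊆ Ioo l₁ u₁ →
      tsupport β ⊆ Ioo l₂ u₂ → J (flux a f ν p α β) = κ * ((∫ s, α s) * ∫ t, β t))
    {q : E3} (hq : ‖q - p‖ = 1) (hqb : q ∉ badDirs f ν p)
    (h₀ : 0 < (inner ℝ (a 0) (q - p) : ℝ)) (h₁ : gno a 1 (q - p) ∈ Ioo l₁ u₁)
    (h₂ : gno a 2 (q - p) ∈ Ioo l₂ u₂) : (signedCount f ν p q : ℝ) = κ := by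
  rw [signedCount_eq hp hq, ha.rayHits_eq hp hq h₀]
  refine hJ.degree_eq_count ha hM hp hb hκ h₁ h₂ fun x hx => ?_
  rw [← ha.rayHits_eq hp hq h₀] at hx
  exact notMem_badDirs hp hq hqb hx

theorem isOpen_gnomonicBox (a : Fin 3 → E3) (p : E3) (l₁ u₁ l₂ u₂ : ℝ) :
    IsOpen {q : E3 | 0 < (inner ℝ (a 0) (q - p) : ℝ) ∧ gno a 1 (q - p) ∈ Ioo l₁ u₁ ∧
      gno a 2 (q - p) ∈ Ioo l₂ u₂} := by
  have hg : ∀ i, ContinuousOn (fun q => gno a i (q - p))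
      {q : E3 | 0 < (inner ℝ (a 0) (q - p) : ℝ)} := fun i q hq =>
    (ContinuousAt.comp (g := gno a i) (f := fun q => q - p) (continuousAt_gno (ne_of_gt hq))
      (continuousAt_id.sub continuousAt_const)).continuousWithinAt
  exact ((hg 1).prodMk (hg 2)).isOpen_inter_preimage (isOpen_lt continuous_const (by fun_prop))
    (isOpen_Ioo.prod isOpen_Ioo)

/-- The signed count is locally constant off the projected boundary. -/
theorem IsOrientedSurface.exists_local_count (hM : IsOrientedSurface f ν) (hp : p ∉ range f)
    {q : E3} (hq : q ∈ Metric.sphere p 1 \ projBoundary f p) :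
    ∃ U : Set E3, IsOpen U ∧ q ∈ U ∧ ∃ k : ℤ, ∀ q' ∈ U, ‖q' - p‖ = 1 → q' ∉ badDirs f ν p →
      signedCount f ν p q' = k := by
  have hq1 : ‖q - p‖ = 1 := by simpa [dist_eq_norm] using hq.1
  obtain ⟨J, hJ⟩ := hM.exists_areaIntegral
  -- With a₀ = q − p the direction q is the origin of the gnomonic plane.
  obtain ⟨a, ha, ha0⟩ := exists_isFrame hq1
  have hi : ∀ i, (inner ℝ (a i) (q - p) : ℝ) = if i = 0 then 1 else 0 := fun i => by
    rw [← ha0, ha.inner_eq]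
  have hg1 : gno a 1 (q - p) = 0 := by simp [gno, hi]
  have hg2 : gno a 2 (q - p) = 0 := by simp [gno, hi]
  have h0 : 0 < (inner ℝ (a 0) (q - p) : ℝ) := by simp [hi]
  obtain ⟨δ, hδ, hav⟩ := exists_box_avoiding ha hM.smooth.continuous hp
    ((𝓡∂ 2).isClosed_boundary (M := N) (n := ∞) (by simp)) 0 0 (by
      intro x hx hx0 hx1 hx2
      refine hq.2 ⟨x, hx, ?_⟩
      exact (ha.sphereProj_eq_iff (fun h => hp ⟨x, h⟩) hq1 h0).2
        ⟨hx0, hx1.trans hg1.symm, hx2.trans hg2.symm⟩)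
  have hb : ∀ x ∈ (𝓡∂ 2).boundary N, 0 < (inner ℝ (a 0) (f x - p) : ℝ) →
      gno a 1 (f x - p) ∈ Ioo (-δ) δ → gno a 2 (f x - p) ∉ Ioo (-δ) δ := by
    intro x hx hx0 hx1 hx2
    exact hav x hx hx0 (by rw [sub_zero]; exact abs_lt.2 hx1)
      (by rw [sub_zero]; exact abs_lt.2 hx2)
  obtain ⟨κ, hκ⟩ := hJ.exists_degree ha hM hp (neg_lt_self hδ) (neg_lt_self hδ) hb
  have hU := isOpen_gnomonicBox a p (-δ) δ (-δ) δ
  set U := {q : E3 | 0 < (inner ℝ (a 0) (q - p) : ℝ) ∧ gno a 1 (q - p) ∈ Ioo (-δ) δ ∧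
      gno a 2 (q - p) ∈ Ioo (-δ) δ}
  have hqU : q ∈ U := ⟨h0, by rw [hg1]; exact ⟨by linarith, hδ⟩, by rw [hg2]; exact ⟨by linarith, hδ⟩⟩
  have hval : ∀ q' ∈ U, ‖q' - p‖ = 1 → q' ∉ badDirs f ν p → (signedCount f ν p q' : ℝ) = κ :=
    fun q' h h1 h2 => hJ.signedCount_eq_degree ha hM hp hb hκ h1 h2 h.1 h.2.1 h.2.2
  -- A transversal direction in the box shows that the real constant κ is an integer.
  obtain ⟨q₁, hq₁U, hq₁n, hq₁b⟩ := hM.exists_regular hU hqU hq1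
  refine ⟨U, hU, hqU, signedCount f ν p q₁, fun q' h h1 h2 => ?_⟩
  exact_mod_cast (hval q' h h1 h2).trans (hval q₁ hq₁U hq₁n hq₁b).symm

/-- The signed count is constant on a region. -/
theorem IsOrientedSurface.exists_region_count (hM : IsOrientedSurface f ν) (hp : p ∉ range f)
    {A : Set E3} (hA : IsRegion f p A) :
    ∃ k : ℤ, ∀ q ∈ A, q ∉ badDirs f ν p → signedCount f ν p q = k := by
  obtain ⟨q₀, hq₀, rfl⟩ := hA
  set X := Metric.sphere p 1 \ projBoundary f p with hX
  have hn : ∀ q ∈ X, ‖q - p‖ = 1 := fun q hq => by simpa [dist_eq_norm] using hq.1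
  choose! U hUo hqU k hk using fun q (hq : q ∈ X) => hM.exists_local_count hp hq
  have hsub := connectedComponentIn_subset X q₀
  have hcont : ContinuousOn k (connectedComponentIn X q₀) := by
    intro q hq
    refine (continuousWithinAt_const (b := k q)).congr_of_eventuallyEq ?_ rfl
    filter_upwards [self_mem_nhdsWithin,
      mem_nhdsWithin_of_mem_nhds ((hUo q (hsub hq)).mem_nhds (hqU q (hsub hq)))] with q' hq' hqq'
    -- A transversal direction in the overlap of two neighbourhoods compares their constants, so k
    -- is locally constant even at tangent directions.
    obtain ⟨r, hr, hr1, hrb⟩ := hM.exists_regular ((hUo q (hsub hq)).inter (hUo q' (hsub hq')))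
      ⟨hqq', hqU q' (hsub hq')⟩ (hn q' (hsub hq'))
    rw [← hk q (hsub hq) r hr.1 hr1 hrb, ← hk q' (hsub hq') r hr.2 hr1 hrb]
  refine ⟨k q₀, fun q hq hqb => ?_⟩
  rw [hk q (hsub hq) q (hqU q (hsub hq)) (hn q (hsub hq)) hqb]
  exact isPreconnected_connectedComponentIn.constant hcont hq (mem_connectedComponentIn hq₀)

end Regular

/-! ### The boundary as an arc in a chart -/

section BoundaryArc

variable {N : Type*} [TopologicalSpace N] [ChartedSpace (EuclideanHalfSpace 2) N]
  {V : Type*} [NormedAddCommGroup V] [NormedSpace ℝ V]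

theorem planeMk_mem_range (t : ℝ) : planeMk (0, t) ∈ range (𝓡∂ 2) :=
  mem_range_halfPlane.2 (by simp)

theorem hasDerivAt_planeMk (t : ℝ) : HasDerivAt (fun t : ℝ => planeMk (0, t)) bv1 t := by
  have h := planeMk.hasFDerivAt.comp_hasDerivAt t ((hasDerivAt_const t (0 : ℝ)).prodMk
    (hasDerivAt_id t))
  refine h.congr_deriv ?_
  ext i
  fin_cases i <;> simp

/-- The parameters of the boundary arc in the chart at `k`. -/
def arcDom (k : N) : Set ℝ := {t | planeMk (0, t) ∈ (extChartAt (𝓡∂ 2) k).target}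

/-- The boundary arc in the chart at `k`. -/
def arc (k : N) (t : ℝ) : N := (extChartAt (𝓡∂ 2) k).symm (planeMk (0, t))

theorem isOpen_arcDom (k : N) : IsOpen (arcDom k) := by
  obtain ⟨O, hO, h⟩ := extChartAt_target_relOpen k
  have : arcDom k = (fun t : ℝ => planeMk (0, t)) ⁻¹' O := by
    ext t
    simp only [arcDom, h, mem_ofPred_eq, mem_inter_iff, planeMk_mem_range, and_true, mem_preimage]
  rw [this]
  exact hO.preimage (by fun_prop)

theorem arc_injOn (k : N) : InjOn (arc k) (arcDom k) := fun s hs t ht h => by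
  have := (extChartAt (𝓡∂ 2) k).symm.injOn hs ht h
  simpa using congrArg (fun z : E2 => z 1) this

theorem continuousAt_arc {k : N} {t : ℝ} (ht : t ∈ arcDom k) : ContinuousAt (arc k) t := by
  have h := (continuousOn_extChartAt_symm (I := 𝓡∂ 2) k).comp
    (f := fun t : ℝ => planeMk (0, t)) (s := arcDom k) (by fun_prop) fun t ht => ht
  exact h.continuousAt ((isOpen_arcDom k).mem_nhds ht)

variable [IsManifold (𝓡∂ 2) ∞ N]

theorem arc_mem_boundary {k : N} {t : ℝ} (ht : t ∈ arcDom k) : arc k t ∈ (𝓡∂ 2).boundary N :=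
  (isBoundaryPoint_chart_iff ht).2 (by simp)

theorem planeMk_boundary {k x : N} (hx : x ∈ (extChartAt (𝓡∂ 2) k).source)
    (hb : x ∈ (𝓡∂ 2).boundary N) :
    planeMk (0, extChartAt (𝓡∂ 2) k x 1) = extChartAt (𝓡∂ 2) k x := by
  rw [← (isBoundaryPoint_iff_chart hx).1 hb, planeMk_eta]

theorem boundary_mem_arcDom {k x : N} (hx : x ∈ (extChartAt (𝓡∂ 2) k).source)
    (hb : x ∈ (𝓡∂ 2).boundary N) : extChartAt (𝓡∂ 2) k x 1 ∈ arcDom k := by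
  rw [arcDom, mem_ofPred_eq, planeMk_boundary hx hb]
  exact (extChartAt (𝓡∂ 2) k).map_source hx

theorem arc_boundary {k x : N} (hx : x ∈ (extChartAt (𝓡∂ 2) k).source)
    (hb : x ∈ (𝓡∂ 2).boundary N) : arc k (extChartAt (𝓡∂ 2) k x 1) = x := by
  rw [arc, planeMk_boundary hx hb, (extChartAt (𝓡∂ 2) k).left_inv hx]

theorem contDiffAt_comp_arc {g : N → V} (hg : ContMDiff (𝓡∂ 2) 𝓘(ℝ, V) ∞ g) {k : N} {t : ℝ}
    (ht : t ∈ arcDom k) : ContDiffAt ℝ ∞ (fun t => g (arc k t)) t := by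
  have h : ContDiffOn ℝ ∞ ((g ∘ (extChartAt (𝓡∂ 2) k).symm) ∘ fun t : ℝ => planeMk (0, t))
      (arcDom k) :=
    (contDiffOn_comp_chart k hg).comp (f := fun t : ℝ => planeMk (0, t)) (by fun_prop)
      fun t ht => ht
  exact h.contDiffAt ((isOpen_arcDom k).mem_nhds ht)

theorem hasDerivAt_comp_arc {g : N → V} {k : N} {t : ℝ} (ht : t ∈ arcDom k)
    (hg : MDifferentiableAt (𝓡∂ 2) 𝓘(ℝ, V) g (arc k t)) :
    HasDerivAt (fun t => g (arc k t))
      (md g (arc k t) (chartD k (planeMk (0, t)) bv1)) t := by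
  have h1 := hasFDerivWithinAt_comp_chart (k := k) (z := planeMk (0, t)) ht hg
  have h2 := h1.comp_hasDerivWithinAt (s := univ) t (hasDerivAt_planeMk t).hasDerivWithinAt
    fun t _ => planeMk_mem_range t
  exact hasDerivWithinAt_univ.1 h2

theorem fderivWithin_comp_chart_arc {g : N → V} {k : N} {t : ℝ} (ht : t ∈ arcDom k)
    (hg : MDifferentiableAt (𝓡∂ 2) 𝓘(ℝ, V) g (arc k t)) :
    fderivWithin ℝ (g ∘ (extChartAt (𝓡∂ 2) k).symm) (range (𝓡∂ 2)) (planeMk (0, t)) bv1 =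
      deriv (fun t => g (arc k t)) t := by
  rw [(hasDerivAt_comp_arc ht hg).deriv]
  exact congrArg (fun L : E2 →L[ℝ] V => L bv1) (fderivWithin_comp_chart (k := k) ht hg)

/-- At its own centre the chart is the preferred one in which manifold derivatives are expressed, so
no coordinate change remains there. -/
theorem chartD_self (k : N) : chartD k (extChartAt (𝓡∂ 2) k k) = ContinuousLinearMap.id ℝ E2 := by
  have : IsManifold (𝓡∂ 2) 1 N := IsManifold.of_le (n := ∞) (by simp)
  exact mfderivWithin_range_extChartAt_symm

/-- The boundary arc is tangent to the boundary direction of every chart. -/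
theorem chartD_planeMk_bv1_zero {k : N} {t : ℝ} (ht : t ∈ arcDom k) :
    chartD k (planeMk (0, t)) bv1 0 = 0 := by
  have : IsManifold (𝓡∂ 2) 1 N := IsManifold.of_le (n := ∞) (by simp)
  set x := arc k t with hx
  have hm : MDifferentiableAt (𝓡∂ 2) 𝓘(ℝ, E2) (extChartAt (𝓡∂ 2) x) (arc k t) :=
    mdifferentiableAt_extChartAt (mem_chart_source _ x)
  have h1 := hasDerivAt_comp_arc ht hm
  have h2 : md (extChartAt (𝓡∂ 2) x) (arc k t) = ContinuousLinearMap.id ℝ E2 :=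
    mfderiv_extChartAt_self (I := 𝓡∂ 2) (x := x)
  rw [h2] at h1
  have h3 := (EuclideanSpace.proj (𝕜 := ℝ) (0 : Fin 2)).hasFDerivAt.comp_hasDerivAt t h1
  have h4 : (fun s => (EuclideanSpace.proj (𝕜 := ℝ) (0 : Fin 2))
      (extChartAt (𝓡∂ 2) x (arc k s))) =ᶠ[𝓝 t] fun _ => (0 : ℝ) := by
    filter_upwards [(isOpen_arcDom k).mem_nhds ht,
      (continuousAt_arc ht).eventually (extChartAt_source_mem_nhds (I := 𝓡∂ 2) x)] with s hs hsx
    exact (isBoundaryPoint_iff_chart hsx).1 (arc_mem_boundary hs)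
  exact h3.unique ((hasDerivAt_const t (0 : ℝ)).congr_of_eventuallyEq h4)

end BoundaryArc

/-! ### A box crossed by a single boundary arc -/

section BoundaryBox

variable {N : Type*} [TopologicalSpace N] [ChartedSpace (EuclideanHalfSpace 2) N]
  {f ν : N → E3} {p : E3} {a : Fin 3 → E3}

/-- The gnomonic coordinates along the boundary arc in the chart at `k`. -/
def arcGno (a : Fin 3 → E3) (f : N → E3) (p : E3) (k : N) (i : Fin 3) (t : ℝ) : ℝ :=
  gno a i (f (arc k t) - p)

/-- In the gnomonic box `(-r, r) × (-δ, δ)` the projected boundary is a single arc, which crosses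
the box from bottom to top (if `σ = 1`) or from top to bottom (if `σ = -1`), and the surface
lies to the left of it. -/
structure IsBoundaryBox (a : Fin 3 → E3) (f ν : N → E3) (p : E3) (k : N) (σ t₀ η r δ : ℝ) :
    Prop where
  abs_eq : |σ| = 1
  η_pos : 0 < η
  r_pos : 0 < r
  δ_pos : 0 < δ
  dom : Icc (t₀ - η) (t₀ + η) ⊆ arcDom k
  front : ∀ t ∈ Icc (t₀ - η) (t₀ + η), 0 < (inner ℝ (a 0) (f (arc k t) - p) : ℝ)
  signed : ∀ t ∈ Icc (t₀ - η) (t₀ + η), arc k t ∈ {x | x ∈ (extChartAt (𝓡∂ 2) k).source ∧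
    0 < -σ * ((chartD k (extChartAt (𝓡∂ 2) k x)).det * omega f ν x)}
  abs_fst_lt : ∀ t ∈ Icc (t₀ - η) (t₀ + η), |arcGno a f p k 1 t| < r / 2
  deriv_pos : ∀ t ∈ Icc (t₀ - η) (t₀ + η), 0 < σ * deriv (arcGno a f p k 2) t
  left : σ * arcGno a f p k 2 (t₀ - η) ≤ -δ
  right : δ ≤ σ * arcGno a f p k 2 (t₀ + η)
  only : ∀ x ∈ (𝓡∂ 2).boundary N, 0 < (inner ℝ (a 0) (f x - p) : ℝ) → |gno a 1 (f x - p)| < r →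
    |gno a 2 (f x - p)| < δ → ∃ t ∈ Ioo (t₀ - η) (t₀ + η), arc k t = x

variable [IsManifold (𝓡∂ 2) ∞ N]

theorem contDiffAt_arcGno (hf : ContMDiff (𝓡∂ 2) 𝓘(ℝ, E3) ∞ f) {k : N} {t : ℝ}
    (ht : t ∈ arcDom k) (h0 : 0 < (inner ℝ (a 0) (f (arc k t) - p) : ℝ)) (i : Fin 3) :
    ContDiffAt ℝ ∞ (arcGno a f p k i) t :=
  ContDiffAt.comp t (g := gno a i) (f := fun t => f (arc k t) - p) (contDiffAt_gno h0.ne')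
    ((contDiffAt_comp_arc hf ht).sub contDiffAt_const)

theorem continuousAt_deriv_of_contDiffAt {h : ℝ → ℝ} {t : ℝ} (hh : ContDiffAt ℝ ∞ h t) :
    ContinuousAt (deriv h) t := by
  have := (hh.continuousAt_fderiv (by simp)).clm_apply (continuousAt_const (y := (1 : ℝ)))
  exact this

theorem strictMonoOn_of_contDiffAt {h : ℝ → ℝ} {l u σ : ℝ}
    (hh : ∀ t ∈ Icc l u, ContDiffAt ℝ ∞ h t) (hd : ∀ t ∈ Icc l u, 0 < σ * deriv h t) :
    StrictMonoOn (fun t => σ * h t) (Icc l u) := by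
  refine strictMonoOn_of_deriv_pos (convex_Icc l u)
    (fun t ht => ((hh t ht).continuousAt.const_mul σ).continuousWithinAt) fun t ht => ?_
  rw [deriv_const_mul _ ((hh t (interior_subset ht)).differentiableAt (by simp))]
  exact hd t (interior_subset ht)

/-- The order of choices matters. First an arc on which y₂ is strictly monotone; then r, by
compactness, so that the r-box meets no other part of the boundary; then a shorter arc with |y₁| <
r/2; last δ, below the heights of its endpoints. The condition on `omega` orients the surface to the
left of the arc. -/
theorem IsOrientedSurface.exists_isBoundaryBox [CompactSpace N] [T2Space N] (ha : IsFrame a)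
    (hM : IsOrientedSurface f ν) (hp : p ∉ range f) {k : N} (hk : k ∈ (𝓡∂ 2).boundary N)
    (h0 : 0 < (inner ℝ (a 0) (f k - p) : ℝ)) (h1 : gno a 1 (f k - p) = 0)
    (h2 : gno a 2 (f k - p) = 0)
    (honce : ∀ x ∈ (𝓡∂ 2).boundary N, 0 < (inner ℝ (a 0) (f x - p) : ℝ) →
      gno a 1 (f x - p) = 0 → gno a 2 (f x - p) = 0 → x = k) {σ : ℝ} (hσ : |σ| = 1)
    (hd : 0 < σ * deriv (arcGno a f p k 2) (extChartAt (𝓡∂ 2) k k 1))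
    (hω : 0 < -σ * omega f ν k) :
    ∃ η r δ, IsBoundaryBox a f ν p k σ (extChartAt (𝓡∂ 2) k k 1) η r δ := by
  set t₀ := extChartAt (𝓡∂ 2) k k 1 with ht₀
  have hks := mem_extChartAt_source (I := 𝓡∂ 2) k
  have hdom : t₀ ∈ arcDom k := boundary_mem_arcDom hks hk
  have harc : arc k t₀ = k := arc_boundary hks hk
  have hf0 : 0 < (inner ℝ (a 0) (f (arc k t₀) - p) : ℝ) := by rwa [harc]
  have hc := continuousAt_arc hdom
  have hfc := hM.smooth.continuous
  have e0 : ∀ᶠ t in 𝓝 t₀, t ∈ arcDom k := (isOpen_arcDom k).mem_nhds hdom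
  have e1 : ∀ᶠ t in 𝓝 t₀, 0 < (inner ℝ (a 0) (f (arc k t) - p) : ℝ) := by
    have : ContinuousAt (fun t => (inner ℝ (a 0) (f (arc k t) - p) : ℝ)) t₀ :=
      ContinuousAt.comp (g := fun x => (inner ℝ (a 0) (f x - p) : ℝ)) (by fun_prop) hc
    exact this.eventually (lt_mem_nhds hf0)
  have e2 : ∀ᶠ t in 𝓝 t₀, arc k t ∈ {x | x ∈ (extChartAt (𝓡∂ 2) k).source ∧
      0 < -σ * ((chartD k (extChartAt (𝓡∂ 2) k x)).det * omega f ν x)} := by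
    refine hc.eventually ((hM.isOpen_signSet k (-σ)).mem_nhds ?_)
    rw [harc]
    refine ⟨hks, ?_⟩
    rw [chartD_self]
    simpa [ContinuousLinearMap.det] using hω
  have e3 : ∀ᶠ t in 𝓝 t₀, 0 < σ * deriv (arcGno a f p k 2) t := by
    exact (continuousAt_const.mul (continuousAt_deriv_of_contDiffAt
      (contDiffAt_arcGno hM.smooth hdom hf0 2))).eventually (lt_mem_nhds hd)
  obtain ⟨ε, hε, hball⟩ := Metric.eventually_nhds_iff.1 (e0.and (e1.and (e2.and e3)))
  set η₀ := ε / 2 with hη₀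
  have hη₀p : 0 < η₀ := by positivity
  have hall : ∀ t ∈ Icc (t₀ - η₀) (t₀ + η₀), _ := fun t ht => hball (y := t) (by
    rw [Real.dist_eq, abs_lt]; constructor <;> linarith [ht.1, ht.2])
  have hsm : ∀ t ∈ Icc (t₀ - η₀) (t₀ + η₀), ∀ i, ContDiffAt ℝ ∞ (arcGno a f p k i) t :=
    fun t ht i => contDiffAt_arcGno hM.smooth (hall t ht).1 (hall t ht).2.1 i
  have hmono : StrictMonoOn (fun t => σ * arcGno a f p k 2 t) (Icc (t₀ - η₀) (t₀ + η₀)) :=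
    strictMonoOn_of_contDiffAt (fun t ht => hsm t ht 2) fun t ht => (hall t ht).2.2.2
  have hmem₀ : t₀ ∈ Icc (t₀ - η₀) (t₀ + η₀) := ⟨by linarith, by linarith⟩
  have hv1 : arcGno a f p k 1 t₀ = 0 := by rw [arcGno, harc, h1]
  have hv2 : arcGno a f p k 2 t₀ = 0 := by rw [arcGno, harc, h2]
  -- isolate the arc from the rest of the boundary
  set W := (extChartAt (𝓡∂ 2) k).source ∩
    extChartAt (𝓡∂ 2) k ⁻¹' {z | |z 1 - t₀| < η₀} with hW
  have hWo : IsOpen W := (continuousOn_extChartAt k).isOpen_inter_preimage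
    (isOpen_extChartAt_source k) (isOpen_lt (by fun_prop) continuous_const)
  have hkW : k ∈ W := ⟨hks, by
    change |extChartAt (𝓡∂ 2) k k 1 - t₀| < η₀
    rwa [← ht₀, sub_self, abs_zero]⟩
  obtain ⟨r, hr, hbox⟩ := exists_box_avoiding ha hfc hp
    (((𝓡∂ 2).isClosed_boundary (M := N) (n := ∞) (by simp)).inter hWo.isClosed_compl) 0 0
    fun x hx hx0 hx1 hx2 => hx.2 (honce x hx.1 hx0 hx1 hx2 ▸ hkW)
  have e4 : ∀ᶠ t in 𝓝 t₀, |arcGno a f p k 1 t| < r / 2 :=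
    (hsm t₀ hmem₀ 1).continuousAt.abs.eventually (gt_mem_nhds (by
      change |arcGno a f p k 1 t₀| < r / 2
      rw [hv1, abs_zero]; positivity))
  obtain ⟨ε', hε', hball'⟩ := Metric.eventually_nhds_iff.1 e4
  set η := min η₀ (ε' / 2) with hη
  have hηp : 0 < η := by positivity
  have hηη : η ≤ η₀ := min_le_left _ _
  have hηε : η ≤ ε' / 2 := min_le_right _ _
  have hsub : Icc (t₀ - η) (t₀ + η) ⊆ Icc (t₀ - η₀) (t₀ + η₀) :=
    Icc_subset_Icc (by linarith) (by linarith)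
  have hml : t₀ - η ∈ Icc (t₀ - η) (t₀ + η) := ⟨le_rfl, by linarith⟩
  have hmr : t₀ + η ∈ Icc (t₀ - η) (t₀ + η) := ⟨by linarith, le_rfl⟩
  have hl : σ * arcGno a f p k 2 (t₀ - η) < 0 := by
    simpa [hv2] using hmono (hsub hml) hmem₀ (by linarith)
  have hr' : 0 < σ * arcGno a f p k 2 (t₀ + η) := by
    simpa [hv2] using hmono hmem₀ (hsub hmr) (by linarith)
  -- With this height both endpoints of the short arc lie at or beyond the top and bottom of the
  -- box, so strict monotonicity of σy₂ places every boundary point of the box on that arc.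
  set δ := min r (min (-(σ * arcGno a f p k 2 (t₀ - η))) (σ * arcGno a f p k 2 (t₀ + η))) with hδ
  have hδr : δ ≤ r := min_le_left _ _
  have hδl : δ ≤ -(σ * arcGno a f p k 2 (t₀ - η)) := (min_le_right _ _).trans (min_le_left _ _)
  have hδu : δ ≤ σ * arcGno a f p k 2 (t₀ + η) := (min_le_right _ _).trans (min_le_right _ _)
  refine ⟨η, r, δ, hσ, hηp, hr, lt_min hr (lt_min (by linarith) hr'),
    fun t ht => (hall t (hsub ht)).1, fun t ht => (hall t (hsub ht)).2.1,
    fun t ht => (hall t (hsub ht)).2.2.1, fun t ht => hball' ?_,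
    fun t ht => (hall t (hsub ht)).2.2.2, by linarith, hδu, ?_⟩
  · rw [Real.dist_eq, abs_lt]
    constructor <;> linarith [ht.1, ht.2]
  · intro x hx hx0 hx1 hx2
    have hxW : x ∈ W := by
      by_contra h
      exact hbox x ⟨hx, h⟩ hx0 (by rwa [sub_zero]) (by rw [sub_zero]; exact hx2.trans_le hδr)
    have harcx : arc k (extChartAt (𝓡∂ 2) k x 1) = x := arc_boundary hxW.1 hx
    have hxt : |extChartAt (𝓡∂ 2) k x 1 - t₀| < η₀ := hxW.2
    set t := extChartAt (𝓡∂ 2) k x 1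
    rw [abs_lt] at hxt
    have ht : t ∈ Icc (t₀ - η₀) (t₀ + η₀) := ⟨by linarith, by linarith⟩
    have h3 : |σ * arcGno a f p k 2 t| < δ := by
      rwa [abs_mul, hσ, one_mul, arcGno, harcx]
    rw [abs_lt] at h3
    refine ⟨t, ⟨?_, ?_⟩, harcx⟩
    · exact (hmono.lt_iff_lt (hsub hml) ht).1 (by linarith)
    · exact (hmono.lt_iff_lt ht (hsub hmr)).1 (by linarith)

end BoundaryBox

/-! ### The boundary term of Stokes' theorem at the arc -/

section FluxJump

theorem intervalIntegral_of_support_le {β : ℝ → ℝ} {δ x : ℝ} (hβ : tsupport β ⊆ Ioo (-δ) δ)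
    (hx : x ≤ -δ) : ∫ s in (-δ)..x, β s = 0 := by
  refine (intervalIntegral.integral_congr (g := fun _ => (0 : ℝ)) fun s hs => ?_).trans (by simp)
  rw [uIcc_of_ge hx] at hs
  exact image_eq_zero_of_notMem_tsupport fun h => (hβ h).1.not_ge hs.2

theorem intervalIntegral_of_support_ge {β : ℝ → ℝ} {δ x : ℝ} (hβ : tsupport β ⊆ Ioo (-δ) δ)
    (hx : δ ≤ x) : ∫ s in (-δ)..x, β s = ∫ s, β s :=
  intervalIntegral.integral_eq_integral_of_support_subset fun _ hs =>
    ⟨(hβ (subset_tsupport β hs)).1, (hβ (subset_tsupport β hs)).2.le.trans hx⟩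

/-- Change of variables along a function which crosses the support of the integrand once. -/
theorem integral_comp_mul_deriv_crossing {β h : ℝ → ℝ} {σ l u δ : ℝ} (hσ : |σ| = 1) (hlu : l ≤ u)
    (hβ : IsTest β) (hβs : tsupport β ⊆ Ioo (-δ) δ)
    (hh : ∀ t ∈ Icc l u, ContDiffAt ℝ ∞ h t) (hl : σ * h l ≤ -δ) (hu : δ ≤ σ * h u) :
    σ * ∫ t, (Ioo l u).indicator (fun t => β (h t) * deriv h t) t = ∫ s, β s := by
  set B : ℝ → ℝ := fun x => ∫ s in (-δ)..x, β s with hB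
  have hBd : ∀ s, HasDerivAt B (β s) s := fun s =>
    intervalIntegral.integral_hasDerivAt_right (hβ.smooth.continuous.intervalIntegrable _ _)
      (hβ.smooth.continuous.stronglyMeasurableAtFilter _ _) hβ.smooth.continuous.continuousAt
  rw [integral_indicator measurableSet_Ioo, ← integral_Ioc_eq_integral_Ioo, ← intervalIntegral.integral_of_le hlu,
    intervalIntegral.integral_eq_sub_of_hasDerivAt (f := B ∘ h)]
  -- The antiderivative B is 0 below the support of β and ∫β above it. The factor σ corrects the
  -- sign when h crosses downwards.
  · rcases (abs_eq zero_le_one).1 hσ with rfl | rfl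
    · simp only [Function.comp_apply, hB]
      rw [intervalIntegral_of_support_le hβs (x := h l) (by linarith),
        intervalIntegral_of_support_ge hβs (x := h u) (by linarith)]
      ring
    · simp only [Function.comp_apply, hB]
      rw [intervalIntegral_of_support_le hβs (x := h u) (by linarith),
        intervalIntegral_of_support_ge hβs (x := h l) (by linarith)]
      ring
  · intro t ht
    rw [uIcc_of_le hlu] at ht
    exact (hBd (h t)).comp t ((hh t ht).differentiableAt (by simp)).hasDerivAt
  · refine ContinuousOn.intervalIntegrable fun t ht => ?_
    rw [uIcc_of_le hlu] at ht
    exact ((hβ.smooth.continuous.continuousAt.comp (hh t ht).continuousAt).mul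
      (continuousAt_deriv_of_contDiffAt (hh t ht))).continuousWithinAt

variable {N : Type*} [TopologicalSpace N] [ChartedSpace (EuclideanHalfSpace 2) N]
  {f ν : N → E3} {p : E3} {a : Fin 3 → E3} {k : N} {σ t₀ η r δ : ℝ}

theorem bracket_add {u₁ u₂ : N → ℝ} (v : N → ℝ) (h₁ : ContMDiff (𝓡∂ 2) 𝓘(ℝ, ℝ) ∞ u₁)
    (h₂ : ContMDiff (𝓡∂ 2) 𝓘(ℝ, ℝ) ∞ u₂) :
    bracket f ν (u₁ + u₂) v = bracket f ν u₁ v + bracket f ν u₂ v := by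
  ext x
  simp only [bracket, Pi.add_apply]
  rw [md_add ((h₁ x).mdifferentiableAt (by simp)) ((h₂ x).mdifferentiableAt (by simp))]
  simp only [wedge, add_apply]
  ring

theorem IsBoundaryBox.tens_arc (hb : IsBoundaryBox a f ν p k σ t₀ η r δ) {t : ℝ}
    (ht : t ∈ Icc (t₀ - η) (t₀ + η)) (α β : ℝ → ℝ) :
    tens a f p α β (arc k t) = α (arcGno a f p k 1 t) * β (arcGno a f p k 2 t) := by
  rw [tens, if_pos (hb.front t ht)]
  rfl

variable [IsManifold (𝓡∂ 2) ∞ N]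

theorem IsBoundaryBox.deriv_tens_arc (hb : IsBoundaryBox a f ν p k σ t₀ η r δ)
    (hM : IsOrientedSurface f ν) {χ γ : ℝ → ℝ} {t : ℝ} (ht : t ∈ Ioo (t₀ - η) (t₀ + η))
    (hχ : χ =ᶠ[𝓝 (arcGno a f p k 1 t)] 1) (hγ : γ =ᶠ[𝓝 (arcGno a f p k 2 t)] id) :
    deriv (fun t => tens a f p χ γ (arc k t)) t = deriv (arcGno a f p k 2) t := by
  refine Filter.EventuallyEq.deriv_eq ?_
  have hc : ∀ i, ContinuousAt (arcGno a f p k i) t := fun i =>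
    (contDiffAt_arcGno hM.smooth (hb.dom (Ioo_subset_Icc_self ht))
      (hb.front t (Ioo_subset_Icc_self ht)) i).continuousAt
  filter_upwards [(hc 1).eventually hχ, (hc 2).eventually hγ, isOpen_Ioo.mem_nhds ht]
    with s h1 h2 hs
  rw [hb.tens_arc (Ioo_subset_Icc_self hs), h1, h2]
  simp

variable [CompactSpace N] [T2Space N]

theorem exists_smooth_cutoff {K S : Set N} (hK : IsClosed K) (hS : IsOpen S) (hKS : K ⊆ S) :
    ∃ θ : N → ℝ, ContMDiff (𝓡∂ 2) 𝓘(ℝ, ℝ) ∞ θ ∧ tsupport θ ⊆ S ∧ ∀ x ∈ K, θ x = 1 := by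
  obtain ⟨U, hU, hKU, hUS⟩ := normal_exists_closure_subset hK hS hKS
  obtain ⟨θ, h0, h1, -⟩ := exists_contMDiffMap_zero_one_of_isClosed (𝓡∂ 2) (n := ⊤)
    hU.isClosed_compl hK (disjoint_left.2 fun x hx hxK => hx (hKU hxK))
  refine ⟨θ, θ.contMDiff, (closure_mono fun x hx => ?_).trans hUS, h1⟩
  by_contra h
  exact hx (h0 h)

/-- The boundary contributes its crossing number to the flux. -/
theorem IsBoundaryBox.flux_deriv (hb : IsBoundaryBox a f ν p k σ t₀ η r δ) (ha : IsFrame a)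
    (hM : IsOrientedSurface f ν) (hp : p ∉ range f) {J : (N → ℝ) → ℝ} (hJ : IsAreaIntegral f ν J)
    {α β : ℝ → ℝ} (hα : IsTest α) (hβ : IsTest β) (hαs : tsupport α ⊆ Ioo (-r) r)
    (hα1 : ∀ s, |s| < r / 2 → α s = 1) (hβs : tsupport β ⊆ Ioo (-δ) δ) :
    J (flux a f ν p (deriv α) β) = ∫ s, β s := by
  obtain ⟨χ, γ, hχ, hγ, hχ1, hγ1⟩ := exists_cutoff_pair hα hβ
  have hsub : Ioo (t₀ - η) (t₀ + η) ⊆ Icc (t₀ - η) (t₀ + η) := Ioo_subset_Icc_self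
  have hK : IsCompact (arc k '' Icc (t₀ - η) (t₀ + η)) :=
    isCompact_Icc.image_of_continuousOn fun t ht =>
      (continuousAt_arc (hb.dom ht)).continuousWithinAt
  -- The cutoff θ localises u to the chart k and to one orientation sign while leaving u unchanged
  -- on the arc. The remainder (1 − θ)u vanishes on the boundary and contributes nothing.
  obtain ⟨θ, hθ, hθS, hθ1⟩ := exists_smooth_cutoff hK.isClosed (hM.isOpen_signSet k (-σ))
    (image_subset_iff.2 hb.signed)
  set u := tens a f p α β with hu
  set v := tens a f p χ γ with hv
  have hus : ContMDiff (𝓡∂ 2) 𝓘(ℝ, ℝ) ∞ u := contMDiff_tens ha hM.smooth hp hα hβ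
  have hvs : ContMDiff (𝓡∂ 2) 𝓘(ℝ, ℝ) ∞ v := contMDiff_tens ha hM.smooth hp hχ hγ
  have hθu : ContMDiff (𝓡∂ 2) 𝓘(ℝ, ℝ) ∞ (θ * u) := hθ.mul hus
  have hθu' : ContMDiff (𝓡∂ 2) 𝓘(ℝ, ℝ) ∞ ((1 - θ) * u) := (contMDiff_const.sub hθ).mul hus
  have hbox : ∀ x ∈ (𝓡∂ 2).boundary N, u x ≠ 0 → ∃ t ∈ Ioo (t₀ - η) (t₀ + η), arc k t = x := by
    intro x hx hux
    obtain ⟨h0, h1, h2⟩ := tsupport_tens_subset ha hM.smooth.continuous hp hα.compact hβ.compact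
      (subset_tsupport _ hux)
    exact hb.only x hx h0 (abs_lt.2 (hαs h1)) (abs_lt.2 (hβs h2))
  have hzero : J (bracket f ν ((1 - θ) * u) v) = 0 := by
    refine hJ.bracket_eq_zero hM hθu' hvs fun x hx => ?_
    by_contra h
    obtain ⟨t, ht, rfl⟩ := hbox x hx (right_ne_zero_of_mul h)
    exact h (by simp [hθ1 _ (mem_image_of_mem _ (hsub ht))])
  have hsplit : bracket f ν u v = bracket f ν (θ * u) v + bracket f ν ((1 - θ) * u) v := by
    rw [← bracket_add v hθu hθu', ← add_mul, add_sub_cancel, one_mul]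
  rw [← bracket_eq_flux_left ha hM hp hα hβ (fun s hs => hχ1 s (Or.inl hs))
    (fun s hs => hγ1 s (Or.inr hs)), ← hu, ← hv, hsplit,
    hJ.add _ _ (continuous_bracket hM hθu hvs) (continuous_bracket hM hθu' hvs), hzero, add_zero]
  have hts : tsupport (θ * u) ⊆ tsupport θ := tsupport_mul_subset_left
  rw [hJ.bracket_chart hM hθu hvs (k := k) (s := -σ) (fun x hx => (hθS (hts hx)).1)
    (by rw [abs_neg, hb.abs_eq]) (fun z hz hzs => by
      have := (hθS (hts hzs)).2
      rwa [(extChartAt (𝓡∂ 2) k).right_inv hz] at this), neg_neg]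
  -- Along the arc α = 1 and v = y₂ wherever β ≠ 0, so the boundary integrand is β(y₂) dy₂, which
  -- integrates to ∫β over one crossing. The sign −σ of the density cancels the minus sign of
  -- Stokes.
  rw [← integral_comp_mul_deriv_crossing (l := t₀ - η) (u := t₀ + η) (h := arcGno a f p k 2)
    hb.abs_eq (by linarith [hb.η_pos]) hβ hβs
    (fun t ht => contDiffAt_arcGno hM.smooth (hb.dom ht) (hb.front t ht) 2) hb.left hb.right]
  congr 2
  ext t
  by_cases ht : t ∈ Ioo (t₀ - η) (t₀ + η)
  · have htd : t ∈ arcDom k := hb.dom (hsub ht)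
    rw [indicator_of_mem ht, indicator_of_mem (show planeMk (0, t) ∈ (extChartAt (𝓡∂ 2) k).target from htd),
      fderivWithin_comp_chart_arc htd ((hvs _).mdifferentiableAt (by simp))]
    change (θ (arc k t) * u (arc k t)) * _ = _
    have hα1' := hα1 _ (hb.abs_fst_lt t (hsub ht))
    rw [hθ1 _ (mem_image_of_mem _ (hsub ht)), one_mul, hu, hb.tens_arc (hsub ht), hα1', one_mul]
    by_cases hβ0 : β (arcGno a f p k 2 t) = 0
    · rw [hβ0, zero_mul, zero_mul]
    · rw [hv, hb.deriv_tens_arc hM ht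
        (hχ1 _ (Or.inl (subset_tsupport _ (by rw [Function.mem_support, hα1']; norm_num))))
        (hγ1 _ (Or.inr (subset_tsupport _ hβ0)))]
  · rw [indicator_of_notMem ht]
    by_cases htd : planeMk (0, t) ∈ (extChartAt (𝓡∂ 2) k).target
    · rw [indicator_of_mem htd]
      -- The chart may contain further boundary outside the chosen interval; a point of it over the
      -- box would repeat a point of the arc.
      have : u (arc k t) = 0 := by
        by_contra h
        obtain ⟨s, hs, hst⟩ := hbox _ (arc_mem_boundary htd) h
        exact ht (arc_injOn k (hb.dom (hsub hs)) htd hst ▸ hs)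
      change (θ (arc k t) * u (arc k t)) * _ = _
      rw [this, mul_zero, zero_mul]
    · rw [indicator_of_notMem htd]

end FluxJump

/-! ### The two sides of the arc and the jump of the count -/

section BoxSides

variable {p : E3} {a : Fin 3 → E3}

/-- The direction with given gnomonic coordinates. -/
def gnoPt (a : Fin 3 → E3) (p : E3) (y : ℝ × ℝ) : E3 :=
  sphereProj p (p + (a 0 + y.1 • a 1 + y.2 • a 2))

theorem IsFrame.inner_gnoVec (ha : IsFrame a) (y : ℝ × ℝ) :
    (inner ℝ (a 0) (a 0 + y.1 • a 1 + y.2 • a 2) : ℝ) = 1 ∧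
      (inner ℝ (a 1) (a 0 + y.1 • a 1 + y.2 • a 2) : ℝ) = y.1 ∧
      (inner ℝ (a 2) (a 0 + y.1 • a 1 + y.2 • a 2) : ℝ) = y.2 := by
  simp only [inner_add_right, inner_smul_right, ha.inner_eq]
  simp

theorem IsFrame.gnoVec_ne (ha : IsFrame a) (y : ℝ × ℝ) :
    p + (a 0 + y.1 • a 1 + y.2 • a 2) ≠ p := by
  intro h
  have h1 := (ha.inner_gnoVec y).1
  rw [add_eq_left.1 h, inner_zero_right] at h1
  exact zero_ne_one h1

theorem IsFrame.norm_gnoPt_sub (ha : IsFrame a) (y : ℝ × ℝ) : ‖gnoPt a p y - p‖ = 1 :=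
  sphereProj_sub_norm (ha.gnoVec_ne y)

theorem IsFrame.gnoPt_coords (ha : IsFrame a) (y : ℝ × ℝ) :
    0 < (inner ℝ (a 0) (gnoPt a p y - p) : ℝ) ∧ gno a 1 (gnoPt a p y - p) = y.1 ∧
      gno a 2 (gnoPt a p y - p) = y.2 := by
  have hn : 0 < ‖p + (a 0 + y.1 • a 1 + y.2 • a 2) - p‖⁻¹ :=
    inv_pos.2 (norm_pos_iff.2 (sub_ne_zero.2 (ha.gnoVec_ne y)))
  obtain ⟨h0, h1, h2⟩ := ha.inner_gnoVec y
  rw [gnoPt, sphereProj, add_sub_cancel_left, gno_smul a 1 hn.ne', gno_smul a 2 hn.ne',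
    add_sub_cancel_left, inner_smul_right, gno, gno, h0, h1, h2, mul_one, div_one, div_one]
  rw [add_sub_cancel_left] at hn
  exact ⟨hn, rfl, rfl⟩

theorem IsFrame.sphereProj_eq_gnoPt_iff (ha : IsFrame a) {y : E3} (hy : y ≠ p) (z : ℝ × ℝ) :
    sphereProj p y = gnoPt a p z ↔ 0 < (inner ℝ (a 0) (y - p) : ℝ) ∧ gno a 1 (y - p) = z.1 ∧
      gno a 2 (y - p) = z.2 := by
  obtain ⟨h0, h1, h2⟩ := ha.gnoPt_coords (p := p) z
  rw [ha.sphereProj_eq_iff hy (ha.norm_gnoPt_sub z) h0, h1, h2]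

theorem IsFrame.eq_gnoPt (ha : IsFrame a) {q : E3} (hq : ‖q - p‖ = 1)
    (h0 : 0 < (inner ℝ (a 0) (q - p) : ℝ)) :
    q = gnoPt a p (gno a 1 (q - p), gno a 2 (q - p)) := by
  have hqp : q ≠ p := by rintro rfl; simp at hq
  have h := (ha.sphereProj_eq_gnoPt_iff hqp (gno a 1 (q - p), gno a 2 (q - p))).2 ⟨h0, rfl, rfl⟩
  rw [← h, sphereProj, hq, inv_one, one_smul, add_sub_cancel]

theorem IsFrame.continuous_gnoPt (ha : IsFrame a) : Continuous (gnoPt a p) :=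
  continuous_iff_continuousAt.2 fun y =>
    ContinuousAt.comp (g := sphereProj p) (f := fun y : ℝ × ℝ => p + (a 0 + y.1 • a 1 + y.2 • a 2))
      (sphereProj_continuousAt (ha.gnoVec_ne y)) (by fun_prop)

variable {N : Type*} [TopologicalSpace N] [ChartedSpace (EuclideanHalfSpace 2) N]
  {f ν : N → E3} {k : N} {σ t₀ η r δ ε : ℝ}

/-- The part of a gnomonic box on one side (`ε = 1` or `ε = -1`) of the boundary arc. -/
def boxSide (a : Fin 3 → E3) (f : N → E3) (p : E3) (k : N) (t₀ η r δ ε : ℝ) : Set E3 :=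
  (fun z : ℝ × ℝ => gnoPt a p
    ((1 - z.1) * (ε * r) + z.1 * arcGno a f p k 1 z.2, arcGno a f p k 2 z.2)) ''
    (Ioo 0 1 ×ˢ {t | t ∈ Ioo (t₀ - η) (t₀ + η) ∧ |arcGno a f p k 2 t| < δ})

theorem gnoPt_mem_boxSide (hε : |ε| = 1)
    {t y : ℝ} (ht : t ∈ Ioo (t₀ - η) (t₀ + η)) (h2 : |arcGno a f p k 2 t| < δ) (hy : |y| < r)
    (h1 : ε * arcGno a f p k 1 t < ε * y) :
    gnoPt a p (y, arcGno a f p k 2 t) ∈ boxSide a f p k t₀ η r δ ε := by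
  set h := arcGno a f p k 1 t with hh
  have hεε : ε * ε = 1 := by rw [← abs_mul_abs_self, hε, one_mul]
  have hyr : ε * y < r := (le_abs_self _).trans_lt (by rwa [abs_mul, hε, one_mul])
  have hpos : 0 < r - ε * h := by linarith
  -- The parameter l solves (1 − l)εr + lh = y, using ε² = 1.
  refine ⟨((r - ε * y) / (r - ε * h), t), ⟨⟨by apply div_pos <;> linarith, ?_⟩, ht, h2⟩, ?_⟩
  · rw [div_lt_one hpos]; linarith
  · have : (1 - (r - ε * y) / (r - ε * h)) * (ε * r) + (r - ε * y) / (r - ε * h) * h = y := by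
      field_simp
      linear_combination (y * r - h * r) * hεε
    simp only [← hh, this]

variable [IsManifold (𝓡∂ 2) ∞ N]

theorem IsBoundaryBox.strictMonoOn (hb : IsBoundaryBox a f ν p k σ t₀ η r δ)
    (hM : IsOrientedSurface f ν) :
    StrictMonoOn (fun t => σ * arcGno a f p k 2 t) (Icc (t₀ - η) (t₀ + η)) :=
  strictMonoOn_of_contDiffAt (fun t ht => contDiffAt_arcGno hM.smooth (hb.dom ht) (hb.front t ht) 2)
    hb.deriv_pos

theorem IsBoundaryBox.arcGno_injOn (hb : IsBoundaryBox a f ν p k σ t₀ η r δ)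
    (hM : IsOrientedSurface f ν) : InjOn (arcGno a f p k 2) (Icc (t₀ - η) (t₀ + η)) :=
  fun _ hs _ ht h => (hb.strictMonoOn hM).injOn hs ht (congrArg (σ * ·) h)

theorem IsBoundaryBox.continuousAt_arcGno (hb : IsBoundaryBox a f ν p k σ t₀ η r δ)
    (hM : IsOrientedSurface f ν) (i : Fin 3) {t : ℝ} (ht : t ∈ Icc (t₀ - η) (t₀ + η)) :
    ContinuousAt (arcGno a f p k i) t :=
  (contDiffAt_arcGno hM.smooth (hb.dom ht) (hb.front t ht) i).continuousAt

theorem IsBoundaryBox.exists_arcGno_eq (hb : IsBoundaryBox a f ν p k σ t₀ η r δ)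
    (hM : IsOrientedSurface f ν) {y : ℝ} (hy : |y| < δ) :
    ∃ t ∈ Ioo (t₀ - η) (t₀ + η), arcGno a f p k 2 t = y := by
  have hc : ContinuousOn (fun t => σ * arcGno a f p k 2 t) (Icc (t₀ - η) (t₀ + η)) :=
    fun t ht => ((hb.continuousAt_arcGno hM 2 ht).const_mul σ).continuousWithinAt
  have hσ : σ ≠ 0 := by
    intro h
    simpa [h] using hb.abs_eq
  have hy' : |σ * y| < δ := by rwa [abs_mul, hb.abs_eq, one_mul]
  rw [abs_lt] at hy'
  obtain ⟨t, ht, h⟩ := intermediate_value_Ioo (by linarith [hb.η_pos]) hc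
    (show σ * y ∈ _ from ⟨hb.left.trans_lt hy'.1, hy'.2.trans_le hb.right⟩)
  exact ⟨t, ht, mul_left_cancel₀ hσ h⟩

/-- Monotonicity of y₂ makes the admissible arc parameters an interval, so a side is a continuous
image of a product of intervals. -/
theorem IsBoundaryBox.isPreconnected_boxSide (hb : IsBoundaryBox a f ν p k σ t₀ η r δ)
    (ha : IsFrame a) (hM : IsOrientedSurface f ν) (ε : ℝ) :
    IsPreconnected (boxSide a f p k t₀ η r δ ε) := by
  have hmono := hb.strictMonoOn hM
  have habs : ∀ t, |σ * arcGno a f p k 2 t| = |arcGno a f p k 2 t| := fun t => by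
    rw [abs_mul, hb.abs_eq, one_mul]
  have hT : OrdConnected {t | t ∈ Ioo (t₀ - η) (t₀ + η) ∧ |arcGno a f p k 2 t| < δ} := by
    refine ⟨fun s hs t ht w hw => ?_⟩
    have hwI : w ∈ Ioo (t₀ - η) (t₀ + η) := ⟨hs.1.1.trans_le hw.1, hw.2.trans_lt ht.1.2⟩
    have h1 := hs.2
    have h2 := ht.2
    rw [← habs, abs_lt] at h1 h2
    refine ⟨hwI, ?_⟩
    rw [← habs, abs_lt]
    exact ⟨h1.1.trans_le (hmono.monotoneOn (Ioo_subset_Icc_self hs.1) (Ioo_subset_Icc_self hwI) hw.1),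
      (hmono.monotoneOn (Ioo_subset_Icc_self hwI) (Ioo_subset_Icc_self ht.1) hw.2).trans_lt h2.2⟩
  refine (isPreconnected_Ioo.prod hT.isPreconnected).image _ fun z hz => ?_
  have hc : ∀ i, ContinuousAt (fun z : ℝ × ℝ => arcGno a f p k i z.2) z := fun i =>
    ContinuousAt.comp (g := arcGno a f p k i)
      (hb.continuousAt_arcGno hM i (Ioo_subset_Icc_self hz.2.1)) continuousAt_snd
  refine (ha.continuous_gnoPt.continuousAt.comp (f := fun z : ℝ × ℝ =>
    ((1 - z.1) * (ε * r) + z.1 * arcGno a f p k 1 z.2, arcGno a f p k 2 z.2)) ?_).continuousWithinAt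
  exact ((by fun_prop : ContinuousAt (fun z : ℝ × ℝ => (1 - z.1) * (ε * r)) z).add
    (continuousAt_fst.mul (hc 1))).prodMk (hc 2)

/-- A projected boundary point on a side would lie on the arc at the same height y₂, hence at the
same parameter. Equality of y₁ then forces l = 1 or |y₁| = r on the arc, both excluded. -/
theorem IsBoundaryBox.boxSide_subset (hb : IsBoundaryBox a f ν p k σ t₀ η r δ)
    (ha : IsFrame a) (hM : IsOrientedSurface f ν) (hp : p ∉ range f) (hε : |ε| = 1) :
    boxSide a f p k t₀ η r δ ε ⊆ Metric.sphere p 1 \ projBoundary f p := by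
  rintro _ ⟨⟨l, t⟩, ⟨hl, ht, ht2⟩, rfl⟩
  simp only at hl ht ht2 ⊢
  refine ⟨by rw [mem_sphere_iff_norm]; exact ha.norm_gnoPt_sub _, ?_⟩
  rintro ⟨x, hx, hxq⟩
  obtain ⟨h0, h1, h2⟩ := (ha.sphereProj_eq_gnoPt_iff (fun h => hp ⟨x, h⟩) _).1 hxq
  simp only at h1 h2
  have ht' := Ioo_subset_Icc_self ht
  have hlt := abs_lt.1 (hb.abs_fst_lt t ht')
  have hr := hb.r_pos
  have hεr : |ε * r| = r := by rw [abs_mul, hε, one_mul, abs_of_pos hr]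
  have habs : |gno a 1 (f x - p)| < r := by
    rw [h1]
    calc _ ≤ |(1 - l) * (ε * r)| + |l * arcGno a f p k 1 t| := abs_add_le _ _
      _ = (1 - l) * r + l * |arcGno a f p k 1 t| := by
        rw [abs_mul, hεr, abs_mul, abs_of_pos hl.1, abs_of_pos (sub_pos.2 hl.2)]
      _ < r := by nlinarith [hb.abs_fst_lt t ht', hl.1]
  obtain ⟨s, hs, rfl⟩ := hb.only x hx h0 habs (by rwa [h2])
  have hst : s = t := hb.arcGno_injOn hM (Ioo_subset_Icc_self hs) ht' h2
  subst hst
  have h3 : (1 - l) * (ε * r - arcGno a f p k 1 s) = 0 := by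
    have : arcGno a f p k 1 s = (1 - l) * (ε * r) + l * arcGno a f p k 1 s := h1
    linear_combination -this
  rcases mul_eq_zero.1 h3 with h | h
  · linarith [hl.2]
  · have h4 := hb.abs_fst_lt s ht'
    rw [← sub_eq_zero.1 h, hεr] at h4
    linarith

theorem IsBoundaryBox.mem_boxSide_or (hb : IsBoundaryBox a f ν p k σ t₀ η r δ)
    (ha : IsFrame a) (hM : IsOrientedSurface f ν) (hp : p ∉ range f) {q : E3}
    (hq : q ∈ Metric.sphere p 1 \ projBoundary f p) (h0 : 0 < (inner ℝ (a 0) (q - p) : ℝ))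
    (h1 : |gno a 1 (q - p)| < r) (h2 : |gno a 2 (q - p)| < δ) :
    q ∈ boxSide a f p k t₀ η r δ 1 ∨ q ∈ boxSide a f p k t₀ η r δ (-1) := by
  have hqe := ha.eq_gnoPt (mem_sphere_iff_norm.1 hq.1) h0
  obtain ⟨t, ht, hty⟩ := hb.exists_arcGno_eq hM h2
  rw [← hty] at hqe h2
  have ht' := Ioo_subset_Icc_self ht
  rcases lt_trichotomy (arcGno a f p k 1 t) (gno a 1 (q - p)) with h | h | h
  · left
    rw [hqe]
    exact gnoPt_mem_boxSide abs_one ht h2 h1 (by linarith)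
  · refine absurd ⟨arc k t, arc_mem_boundary (hb.dom ht'), ?_⟩ hq.2
    rw [hqe]
    exact (ha.sphereProj_eq_gnoPt_iff (fun h => hp ⟨_, h⟩) _).2 ⟨hb.front t ht', h, rfl⟩
  · right
    rw [hqe]
    exact gnoPt_mem_boxSide (by simp) ht h2 h1 (by linarith)

variable [CompactSpace N] [T2Space N]

/-- Away from the arc, the degree is the signed count. -/
theorem IsBoundaryBox.flux_eq (hb : IsBoundaryBox a f ν p k σ t₀ η r δ) (ha : IsFrame a)
    (hM : IsOrientedSurface f ν) (hp : p ∉ range f) {J : (N → ℝ) → ℝ} (hJ : IsAreaIntegral f ν J)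
    (hε : |ε| = 1) {l u : ℝ} (hlu : l < u) (hI : ∀ y ∈ Ioo l u, r / 2 < ε * y ∧ ε * y < r) {c : ℤ}
    (hc : ∀ q ∈ boxSide a f p k t₀ η r δ ε, q ∉ badDirs f ν p → signedCount f ν p q = c)
    {α β : ℝ → ℝ} (hα : IsTest α) (hβ : IsTest β) (hαs : tsupport α ⊆ Ioo l u)
    (hβs : tsupport β ⊆ Ioo (-δ) δ) :
    J (flux a f ν p α β) = c * ((∫ s, α s) * ∫ t, β t) := by
  have hδ := hb.δ_pos
  have habs : ∀ y ∈ Ioo l u, |y| < r := fun y hy => by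
    have h : |y| = |ε * y| := by rw [abs_mul, hε, one_mul]
    rw [h, abs_of_pos (by linarith [hb.r_pos, (hI y hy).1])]
    exact (hI y hy).2
  have hlt : ∀ y ∈ Ioo l u, ∀ t ∈ Ioo (t₀ - η) (t₀ + η), ε * arcGno a f p k 1 t < ε * y := by
    intro y hy t ht
    have : |ε * arcGno a f p k 1 t| < r / 2 := by
      rw [abs_mul, hε, one_mul]; exact hb.abs_fst_lt t (Ioo_subset_Icc_self ht)
    linarith [le_abs_self (ε * arcGno a f p k 1 t), (hI y hy).1]
  -- The strip r/2 < εy₁ < r misses the arc, which stays within |y₁| < r/2, so the degree is defined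
  -- on it.
  have hbd : ∀ x ∈ (𝓡∂ 2).boundary N, 0 < (inner ℝ (a 0) (f x - p) : ℝ) →
      gno a 1 (f x - p) ∈ Ioo l u → gno a 2 (f x - p) ∉ Ioo (-δ) δ := by
    intro x hx h0 h1 h2
    obtain ⟨t, ht, rfl⟩ := hb.only x hx h0 (habs _ h1) (abs_lt.2 h2)
    exact (hlt _ h1 t ht).ne rfl
  obtain ⟨κ, hκ⟩ := hJ.exists_degree ha hM hp hlu (neg_lt_self hδ) hbd
  obtain ⟨hm0, hm1, hm2⟩ := ha.gnoPt_coords (p := p) ((l + u) / 2, 0)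
  obtain ⟨q, ⟨hq0, hq1, hq2⟩, hqn, hqb⟩ := hM.exists_regular (p := p)
    (isOpen_gnomonicBox a p l u (-δ) δ) (q := gnoPt a p ((l + u) / 2, 0))
    ⟨hm0, by rw [hm1]; constructor <;> simp only <;> linarith, by rw [hm2]; exact ⟨by simpa, hδ⟩⟩
    (ha.norm_gnoPt_sub _)
  have hqs : q ∈ boxSide a f p k t₀ η r δ ε := by
    obtain ⟨t, ht, hty⟩ := hb.exists_arcGno_eq hM (abs_lt.2 hq2)
    rw [ha.eq_gnoPt hqn hq0, ← hty]
    exact gnoPt_mem_boxSide hε ht (hty ▸ abs_lt.2 hq2) (habs _ hq1) (hlt _ hq1 t ht)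
  rw [← hc q hqs hqb, hJ.signedCount_eq_degree ha hM hp hbd hκ hqn hqb hq0 hq1 hq2]
  exact hκ α β hα hβ hαs hβs

/-- The signed count jumps by one across the boundary arc. -/
theorem IsBoundaryBox.count_eq_add_one (hb : IsBoundaryBox a f ν p k σ t₀ η r δ) (ha : IsFrame a)
    (hM : IsOrientedSurface f ν) (hp : p ∉ range f) {c d : ℤ}
    (hc : ∀ q ∈ boxSide a f p k t₀ η r δ (-1), q ∉ badDirs f ν p → signedCount f ν p q = c)
    (hd : ∀ q ∈ boxSide a f p k t₀ η r δ 1, q ∉ badDirs f ν p → signedCount f ν p q = d) :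
    c = d + 1 := by
  obtain ⟨J, hJ⟩ := hM.exists_areaIntegral
  have hr := hb.r_pos
  obtain ⟨β, hβ, hβs, hβ1⟩ := exists_isTest (neg_lt_self hb.δ_pos)
  obtain ⟨L, hL, hLs, hL1⟩ := exists_isTest (show -r < -(r / 2) by linarith)
  obtain ⟨R, hR, hRs, hR1⟩ := exists_isTest (show r / 2 < r by linarith)
  have hJL := hb.flux_eq ha hM hp hJ (ε := -1) (by simp) (by linarith)
    (fun y hy => ⟨by linarith [hy.2], by linarith [hy.1]⟩) hc hL hβ hLs hβs
  have hJR := hb.flux_eq ha hM hp hJ (ε := 1) (by simp) (by linarith)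
    (fun y hy => ⟨by linarith [hy.1], by linarith [hy.2]⟩) hd hR hβ hRs hβs
  -- Opposite unit bumps on the two sides: the antiderivative is compactly supported and equals 1 on
  -- |y₁| < r/2, where the arc runs.
  set α := L + (-1 : ℝ) • R with hα
  have hαt : IsTest α := hL.add (hR.const_smul _)
  have hαs : tsupport α ⊆ Ioo (-r) r := by
    refine (tsupport_add L _).trans (union_subset (hLs.trans ?_) ?_)
    · exact Ioo_subset_Ioo le_rfl (by linarith)
    · exact (closure_mono (Function.support_const_smul_subset _ _)).trans
        (hRs.trans (Ioo_subset_Ioo (by linarith) le_rfl))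
  have hα0 : ∫ t, α t = 0 := by
    have h1 : ∫ t, α t = (∫ t, L t) + ∫ t, ((-1 : ℝ) • R) t :=
      integral_add hL.integrable (hR.const_smul (-1)).integrable
    have h2 : ∫ t, ((-1 : ℝ) • R) t = (-1 : ℝ) • ∫ t, R t :=
      integral_const_mul (-1) R
    rw [h1, h2, hL1, hR1]
    norm_num
  obtain ⟨A, hA, hAs, hAd, hAv⟩ := hαt.exists_antideriv hαs hα0
  have hA1 : ∀ s, |s| < r / 2 → A s = 1 := by
    intro s hs
    rw [abs_lt] at hs
    rw [hAv, ← hL1]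
    have : ∀ t ∈ uIcc (-r) s, α t = L t := by
      intro t ht
      rw [uIcc_of_le (by linarith)] at ht
      have : R t = 0 := image_eq_zero_of_notMem_tsupport fun h => by
        linarith [(hRs h).1, ht.2]
      simp [hα, this]
    rw [intervalIntegral.integral_congr this]
    exact intervalIntegral.integral_eq_integral_of_support_subset fun t ht =>
      ⟨(hLs (subset_tsupport L ht)).1, by linarith [(hLs (subset_tsupport L ht)).2]⟩
  have hflux := hb.flux_deriv ha hM hp hJ hA hβ hAs hA1 hβs
  have hsplit : flux a f ν p (deriv A) β = flux a f ν p L β + (-1 : ℝ) • flux a f ν p R β := by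
    ext x
    rw [hAd]
    simp only [flux, tens, hα, Pi.add_apply, Pi.smul_apply, smul_eq_mul]
    split_ifs <;> ring
  have hcR := continuous_flux ha hM hp hR hβ
  rw [hsplit, hJ.add _ _ (continuous_flux ha hM hp hL hβ) (hcR.const_smul (-1 : ℝ)),
    hJ.smul _ _ hcR, hJL, hJR, hL1, hR1, hβ1] at hflux
  have : (c : ℝ) = (d + 1 : ℤ) := by push_cast; linarith
  exact_mod_cast this

end BoxSides

/-! ### Orientation and tangent of the projected boundary -/

section BoundaryTangent

variable {p : E3}

theorem sphereProj_differentiableAt {y : E3} (hy : y ≠ p) :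
    DifferentiableAt ℝ (sphereProj p) y := by
  have h : DifferentiableAt ℝ (fun y : E3 => y - p) y := differentiableAt_id.sub_const p
  have h0 : y - p ≠ 0 := sub_ne_zero.2 hy
  exact (((h.norm ℝ h0).inv (norm_ne_zero_iff.2 h0)).smul h).const_add p

theorem inner_fderiv_sphereProj_self {y : E3} (hy : y ≠ p) (w : E3) :
    (inner ℝ (sphereProj p y - p) (fderiv ℝ (sphereProj p) y w) : ℝ) = 0 := by
  have h := ((sphereProj_differentiableAt hy).hasFDerivAt.sub_const p).norm_sq
  have h1 : (fun y => ‖sphereProj p y - p‖ ^ 2) =ᶠ[𝓝 y] fun _ => (1 : ℝ) := by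
    filter_upwards [isOpen_compl_singleton.mem_nhds hy] with z hz
    rw [sphereProj_sub_norm hz, one_pow]
  have h2 := congrArg (fun L : E3 →L[ℝ] ℝ => L w)
    (h.unique ((hasFDerivAt_const (1 : ℝ) y).congr_of_eventuallyEq h1))
  simpa [← inner_sub_left] using h2

/-- The derivative of the normalising factor contributes a multiple of y − p, which c annihilates.
-/
theorem inner_fderiv_sphereProj {y c : E3} (hy : y ≠ p) (hc : (inner ℝ c (y - p) : ℝ) = 0)
    (w : E3) : (inner ℝ c (fderiv ℝ (sphereProj p) y w) : ℝ) = ‖y - p‖⁻¹ * inner ℝ c w := by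
  have h : DifferentiableAt ℝ (fun y : E3 => y - p) y := differentiableAt_id.sub_const p
  have h0 : y - p ≠ 0 := sub_ne_zero.2 hy
  have hn := ((h.norm ℝ h0).inv (norm_ne_zero_iff.2 h0)).hasFDerivAt
  have h1 : HasFDerivAt (sphereProj p) _ y :=
    (hn.smul ((hasFDerivAt_id y).sub_const p)).const_add p
  rw [h1.fderiv]
  simp [inner_add_right, inner_smul_right, hc]

theorem cross_eq_smul_normal {n u v : E3} (hn : ‖n‖ = 1) (hu : (inner ℝ n u : ℝ) = 0)
    (hv : (inner ℝ n v : ℝ) = 0) : cross u v = (inner ℝ n (cross u v) : ℝ) • n := by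
  refine ext_inner_left ℝ fun w => ?_
  rw [inner_cross_of_orthogonal hn hu hv, inner_smul_right, mul_comm]

theorem cross_smul_right (c : ℝ) (u v : E3) : cross u (c • v) = c • cross u v := by
  ext i
  fin_cases i <;>
  simp only [Fin.zero_eta, Fin.mk_one, Fin.reduceFinMk, cross_zero, cross_one, cross_two,
    PiLp.smul_apply, smul_eq_mul] <;> ring

theorem cross_swap (u v : E3) : cross u v = -cross v u := by
  ext i
  fin_cases i <;>
  simp only [Fin.zero_eta, Fin.mk_one, Fin.reduceFinMk, cross_zero, cross_one, cross_two,
    PiLp.neg_apply] <;> ring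

theorem cross_cross_self (u v : E3) :
    cross v (cross u v) = (inner ℝ v v : ℝ) • u - (inner ℝ u v : ℝ) • v := by
  ext i
  fin_cases i <;>
  simp only [Fin.zero_eta, Fin.mk_one, Fin.reduceFinMk, cross_zero, cross_one, cross_two,
    PiLp.sub_apply, PiLp.smul_apply, smul_eq_mul, inner_E3] <;> ring

theorem eq_smul_bv1 {v : E2} (hv : v 0 = 0) : v = v 1 • bv1 := by
  conv_lhs => rw [E2.eq_sum v, hv, zero_smul, zero_add]

variable {N : Type*} [TopologicalSpace N] [ChartedSpace (EuclideanHalfSpace 2) N] {f ν : N → E3}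

theorem IsOrientedSurface.md_bv1_ne_zero (hM : IsOrientedSurface f ν) (x : N) :
    md f x bv1 ≠ 0 := fun h => by
  have h3 := hM.immersion x (h.trans (map_zero (md f x)).symm)
  simpa using congrArg (fun z : E2 => z 1) h3

/-- Write a, b for the images of the basis vectors, so a × b = ων. Then ν × (−ωb) = b × (a × b) =
|b|²a − ⟨a,b⟩b, which has positive inward component |b|². -/
theorem IsOrientedSurface.exists_isPosBoundaryTangent (hM : IsOrientedSurface f ν) (x : N) :
    IsPosBoundaryTangent f ν x (-omega f ν x • bv1) := by
  refine ⟨by simp, (inner ℝ (md f x bv1) (md f x bv1) : ℝ) • bv0 -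
    (inner ℝ (md f x bv0) (md f x bv1) : ℝ) • bv1, ?_, ?_⟩
  · have := norm_pos_iff.2 (hM.md_bv1_ne_zero x)
    simpa using pow_pos this 2
  · change cross (ν x) (md f x _) = md f x _
    have h := cross_eq_smul_normal (hM.normal_unit x) (hM.normal_md x bv0) (hM.normal_md x bv1)
    rw [map_sub, map_smul, map_smul, map_smul, ← cross_cross_self, h, cross_smul_right,
      cross_smul_right, cross_swap (md f x bv1), omega, vol, neg_smul, smul_neg]

/-- With b the image of v, (ν × b) × b = −|b|²ν. Pairing with ν and substituting ν × b = Df(w) gives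
w₀ v₁ ω = −|b|² < 0. -/
theorem IsPosBoundaryTangent.mul_omega_neg (hM : IsOrientedSurface f ν) {x : N} {v : E2}
    (hv : IsPosBoundaryTangent f ν x v) (hv0 : v 1 ≠ 0) : v 1 * omega f ν x < 0 := by
  obtain ⟨hz, w, hw, h⟩ := hv
  change cross (ν x) (md f x v) = md f x w at h
  set b := md f x v with hb
  have hb1 : b = v 1 • md f x bv1 := by rw [hb, eq_smul_bv1 hz]; simp
  have hw1 : md f x w = w 0 • md f x bv0 + w 1 • md f x bv1 := by
    conv_lhs => rw [E2.eq_sum w]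
    simp
  have hbb : 0 < (inner ℝ b b : ℝ) := by
    rw [real_inner_self_eq_norm_sq]
    have : b ≠ 0 := by rw [hb1]; exact smul_ne_zero hv0 (hM.md_bv1_ne_zero x)
    positivity
  have h1 : (inner ℝ (ν x) (cross (cross (ν x) b) b) : ℝ) = -inner ℝ b b := by
    rw [cross_swap, cross_cross_self, inner_neg_right, inner_sub_right, inner_smul_right,
      inner_smul_right, hM.normal_md x v, real_inner_self_eq_norm_sq (ν x), hM.normal_unit]
    ring
  have h2 : (inner ℝ (ν x) (cross (md f x w) b) : ℝ) = w 0 * (v 1 * omega f ν x) := by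
    rw [hw1, hb1, omega, vol]
    simp only [inner_E3, cross_zero, cross_one, cross_two, PiLp.add_apply, PiLp.smul_apply,
      smul_eq_mul]
    ring
  rw [h, h2] at h1
  by_contra! hcon
  nlinarith [mul_nonneg hw.le hcon]

variable [IsManifold (𝓡∂ 2) ∞ N]

/-- The projected boundary is regular somewhere on an edge which it traverses once. -/
theorem IsOrientedSurface.exists_projTangent_ne_zero (hM : IsOrientedSurface f ν) (hp : p ∉ range f)
    {A B E : Set E3} (hE : IsCommonEdge f p A B E) :
    ∃ x ∈ (𝓡∂ 2).boundary N, sphereProj p (f x) ∈ E ∧ projTangent f p x bv1 ≠ 0 := by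
  by_contra! hcon
  obtain ⟨U, hU, hEU⟩ := hE.relOpen
  obtain ⟨q, hq⟩ := hE.nonempty
  obtain ⟨⟨k, hk, rfl⟩, hqU⟩ := hEU ▸ hq
  set t₀ := extChartAt (𝓡∂ 2) k k 1 with ht₀
  have hks := mem_extChartAt_source (I := 𝓡∂ 2) k
  have hdom : t₀ ∈ arcDom k := boundary_mem_arcDom hks hk
  have harc : arc k t₀ = k := arc_boundary hks hk
  have hfp : ∀ x, f x ≠ p := fun x h => hp ⟨x, h⟩
  have hc : ContinuousAt (fun t => sphereProj p (f (arc k t))) t₀ :=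
    ContinuousAt.comp (g := sphereProj p) (sphereProj_continuousAt (hfp _))
      (contDiffAt_comp_arc hM.smooth hdom).continuousAt
  have hcd : ∀ᶠ t in 𝓝 t₀, t ∈ arcDom k := (isOpen_arcDom k).mem_nhds hdom
  obtain ⟨ε, hε, hball⟩ := Metric.eventually_nhds_iff.1 (hcd.and
    (hc.eventually (hU.mem_nhds (show sphereProj p (f (arc k t₀)) ∈ U from harc.symm ▸ hqU))))
  have hin : ∀ t ∈ Metric.ball t₀ ε, sphereProj p (f (arc k t)) ∈ E := fun t ht => by
    rw [hEU]
    exact ⟨⟨_, arc_mem_boundary (hball ht).1, rfl⟩, (hball ht).2⟩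
  have hder : ∀ t ∈ Metric.ball t₀ ε,
      HasDerivAt (fun t => sphereProj p (f (arc k t))) 0 t := by
    intro t ht
    have htd := (hball ht).1
    have h1 := (sphereProj_differentiableAt (hfp (arc k t))).hasFDerivAt.comp_hasDerivAt t
      (hasDerivAt_comp_arc htd (hM.mdiffAt _))
    have h2 := hcon _ (arc_mem_boundary htd) (hin t ht)
    refine h1.congr_deriv ?_
    rw [eq_smul_bv1 (chartD_planeMk_bv1_zero htd), map_smul, map_smul]
    exact smul_eq_zero_of_right _ h2
  have h1 : t₀ + ε / 2 ∈ Metric.ball t₀ ε := by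
    rw [Metric.mem_ball, Real.dist_eq, add_sub_cancel_left, abs_of_pos (by positivity)]
    linarith
  have h0 : t₀ ∈ Metric.ball t₀ ε := Metric.mem_ball_self hε
  -- If the tangent vanished over all of E, the projected arc would be constant near the point, so
  -- several boundary points would share one image in E.
  have heq := Metric.isOpen_ball.is_const_of_deriv_eq_zero
    (convex_ball t₀ ε).isPreconnected
    (fun t ht => (hder t ht).differentiableAt.differentiableWithinAt)
    (fun t ht => (hder t ht).deriv) h1 h0
  have := hE.once _ (arc_mem_boundary (hball h1).1) _ (arc_mem_boundary hdom) (hin _ h1) heq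
  have := arc_injOn k (hball h1).1 hdom this
  linarith

theorem deriv_arcGno (hM : IsOrientedSurface f ν) {a : Fin 3 → E3} {k : N}
    (hk : k ∈ (𝓡∂ 2).boundary N) (h0 : 0 < (inner ℝ (a 0) (f k - p) : ℝ)) {i : Fin 3}
    (hi : (inner ℝ (a i) (f k - p) : ℝ) = 0) :
    deriv (arcGno a f p k i) (extChartAt (𝓡∂ 2) k k 1) =
      (inner ℝ (a 0) (f k - p) : ℝ)⁻¹ * inner ℝ (a i) (md f k bv1) := by
  have hks := mem_extChartAt_source (I := 𝓡∂ 2) k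
  have harc : arc k (extChartAt (𝓡∂ 2) k k 1) = k := arc_boundary hks hk
  have h1 := hasDerivAt_comp_arc (boundary_mem_arcDom hks hk) (hM.mdiffAt _)
  rw [planeMk_boundary hks hk, chartD_self, harc] at h1
  have h2 := hasFDerivAt_gno (a := a) (i := i) (w := f (arc k (extChartAt (𝓡∂ 2) k k 1)) - p)
    (by rw [harc]; exact h0.ne')
  have h3 := (h2.comp_hasDerivAt _ (h1.sub_const p)).deriv
  rw [harc] at h3
  refine Eq.trans h3 ?_
  simp [hi]
  field_simp

end BoundaryTangent

/-! ### Regions on the two sides of an edge -/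

section Jump

variable {N : Type*} [TopologicalSpace N] [ChartedSpace (EuclideanHalfSpace 2) N]
  {f ν : N → E3} {p : E3} {A B E : Set E3}

theorem IsRegion.subset_of_inter_nonempty (hA : IsRegion f p A) {S : Set E3}
    (hS : IsPreconnected S) (hSX : S ⊆ Metric.sphere p 1 \ projBoundary f p)
    (h : (A ∩ S).Nonempty) : S ⊆ A := by
  obtain ⟨q, -, rfl⟩ := hA
  obtain ⟨z, hzA, hzS⟩ := h
  rw [connectedComponentIn_eq hzA]
  exact hS.subset_connectedComponentIn hzS hSX

theorem IsRegion.subset (hA : IsRegion f p A) : A ⊆ Metric.sphere p 1 \ projBoundary f p := by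
  obtain ⟨q, -, rfl⟩ := hA
  exact connectedComponentIn_subset _ _

theorem IsRegion.eq_of_mem (hA : IsRegion f p A) (hB : IsRegion f p B) {z : E3} (hzA : z ∈ A)
    (hzB : z ∈ B) : A = B := by
  obtain ⟨q, -, rfl⟩ := hA
  obtain ⟨q', -, rfl⟩ := hB
  rw [connectedComponentIn_eq hzA, connectedComponentIn_eq hzB]

/-- Since q is the centre of the box, moving by ∓εc a₁ keeps y₂ = 0 and gives y₁ = ∓εc, on the left
and right of the arc point y₁ = 0. -/
theorem IsBoundaryBox.pointsFromInto {a : Fin 3 → E3} {k : N} {σ t₀ η r δ c : ℝ} {q : E3}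
    (hb : IsBoundaryBox a f ν p k σ t₀ η r δ) (hc : 0 < c) (hq : q = p + a 0)
    (h1 : arcGno a f p k 1 t₀ = 0) (h2 : arcGno a f p k 2 t₀ = 0)
    (hA : boxSide a f p k t₀ η r δ (-1) ⊆ A) (hB : boxSide a f p k t₀ η r δ 1 ⊆ B) :
    PointsFromInto p q (-(c • a 1)) B A := by
  have ht : t₀ ∈ Ioo (t₀ - η) (t₀ + η) := by constructor <;> linarith [hb.η_pos]
  have h2' : |arcGno a f p k 2 t₀| < δ := by rw [h2, abs_zero]; exact hb.δ_pos
  filter_upwards [Ioo_mem_nhdsGT (div_pos hb.r_pos hc)] with ε hε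
  have hpos : 0 < ε * c := mul_pos hε.1 hc
  have hlt : ε * c < r := (lt_div_iff₀ hc).1 hε.2
  have e1 : sphereProj p (q + ε • -(c • a 1)) = gnoPt a p (-(ε * c), arcGno a f p k 2 t₀) := by
    rw [gnoPt, h2, hq]
    congr 1
    module
  have e2 : sphereProj p (q - ε • -(c • a 1)) = gnoPt a p (ε * c, arcGno a f p k 2 t₀) := by
    rw [gnoPt, h2, hq]
    congr 1
    module
  rw [e1, e2]
  refine ⟨hA (gnoPt_mem_boxSide (by simp) ht h2' ?_ ?_), hB (gnoPt_mem_boxSide abs_one ht h2' ?_ ?_)⟩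
  · rwa [abs_neg, abs_of_pos hpos]
  · rw [h1]; linarith
  · rwa [abs_of_pos hpos]
  · rw [h1]; linarith

theorem projTangent_smul (x : N) (c : ℝ) (v : E2) :
    projTangent f p x (c • v) = c • projTangent f p x v := by
  change fderiv ℝ (sphereProj p) (f x) (md f x (c • v)) =
    c • fderiv ℝ (sphereProj p) (f x) (md f x v)
  rw [map_smul, map_smul]

variable [IsManifold (𝓡∂ 2) ∞ N]

/-- Two distinct regions at the centre of a boundary box contain the two sides of the box. -/
theorem IsBoundaryBox.region_sides {a : Fin 3 → E3} {k : N} {σ t₀ η r δ : ℝ} {q : E3}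
    (hb : IsBoundaryBox a f ν p k σ t₀ η r δ) (ha : IsFrame a) (hM : IsOrientedSurface f ν)
    (hp : p ∉ range f) (hA : IsRegion f p A) (hB : IsRegion f p B) (hAB : A ≠ B)
    (h0 : 0 < (inner ℝ (a 0) (q - p) : ℝ)) (h1 : gno a 1 (q - p) = 0) (h2 : gno a 2 (q - p) = 0)
    (hqA : q ∈ closure A) (hqB : q ∈ closure B) :
    boxSide a f p k t₀ η r δ (-1) ⊆ A ∧ boxSide a f p k t₀ η r δ 1 ⊆ B ∨
      boxSide a f p k t₀ η r δ (-1) ⊆ B ∧ boxSide a f p k t₀ η r δ 1 ⊆ A := by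
  have hU := isOpen_gnomonicBox a p (-r) r (-δ) δ
  have hr := hb.r_pos
  have hδ := hb.δ_pos
  have hqU : q ∈ {q : E3 | 0 < (inner ℝ (a 0) (q - p) : ℝ) ∧ gno a 1 (q - p) ∈ Ioo (-r) r ∧
      gno a 2 (q - p) ∈ Ioo (-δ) δ} :=
    ⟨h0, by rw [h1]; exact ⟨by linarith, hr⟩, by rw [h2]; exact ⟨by linarith, hδ⟩⟩
  have key : ∀ C, IsRegion f p C → q ∈ closure C →
      ∃ ε, (ε = 1 ∨ ε = -1) ∧ (C ∩ boxSide a f p k t₀ η r δ ε).Nonempty ∧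
        boxSide a f p k t₀ η r δ ε ⊆ C := by
    intro C hC hqC
    obtain ⟨z, ⟨hz0, hz1, hz2⟩, hzC⟩ := mem_closure_iff.1 hqC _ hU hqU
    rcases hb.mem_boxSide_or ha hM hp (hC.subset hzC) hz0 (abs_lt.2 hz1) (abs_lt.2 hz2) with h | h
    · exact ⟨1, Or.inl rfl, ⟨z, hzC, h⟩, hC.subset_of_inter_nonempty
        (hb.isPreconnected_boxSide ha hM 1) (hb.boxSide_subset ha hM hp abs_one) ⟨z, hzC, h⟩⟩
    · exact ⟨-1, Or.inr rfl, ⟨z, hzC, h⟩, hC.subset_of_inter_nonempty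
        (hb.isPreconnected_boxSide ha hM (-1)) (hb.boxSide_subset ha hM hp (by simp)) ⟨z, hzC, h⟩⟩
  obtain ⟨ε, hε, ⟨z, hzA, hz⟩, hεA⟩ := key A hA hqA
  obtain ⟨ε', hε', -, hεB⟩ := key B hB hqB
  -- Each region contains a whole side, and distinct regions are disjoint, so they take different
  -- sides.
  have hne : ε ≠ ε' := fun h => hAB (hA.eq_of_mem hB hzA (hεB (h ▸ hz)))
  rcases hε with rfl | rfl <;> rcases hε' with rfl | rfl
  · exact absurd rfl hne
  · exact Or.inr ⟨hεB, hεA⟩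
  · exact Or.inl ⟨hεA, hεB⟩
  · exact absurd rfl hne

variable [CompactSpace N] [T2Space N]

/-- Across a regular point of the projected boundary the signed count increases by one in the
direction of the left normal. -/
theorem IsOrientedSurface.count_jump (hM : IsOrientedSurface f ν) (hp : p ∉ range f)
    (hA : IsRegion f p A) (hB : IsRegion f p B) (hAB : A ≠ B) (hE : IsCommonEdge f p A B E)
    {c d : ℤ} (hc : ∀ q ∈ A, q ∉ badDirs f ν p → signedCount f ν p q = c)
    (hd : ∀ q ∈ B, q ∉ badDirs f ν p → signedCount f ν p q = d) {x : N}
    (hx : x ∈ (𝓡∂ 2).boundary N) (hxE : sphereProj p (f x) ∈ E) {v : E2}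
    (hv : IsPosBoundaryTangent f ν x v) (hτ : projTangent f p x v ≠ 0) :
    (c = d + 1 ∧ PointsFromInto p (sphereProj p (f x))
        (cross (sphereProj p (f x) - p) (projTangent f p x v)) B A) ∨
      (d = c + 1 ∧ PointsFromInto p (sphereProj p (f x))
        (cross (sphereProj p (f x) - p) (projTangent f p x v)) A B) := by
  have hfp : ∀ y, f y ≠ p := fun y h => hp ⟨y, h⟩
  set q := sphereProj p (f x) with hq
  set τ := projTangent f p x v with hτdef
  have hτn : 0 < ‖τ‖ := norm_pos_iff.2 hτ
  have he : ‖q - p‖ = 1 := sphereProj_sub_norm (hfp x)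
  -- The frame has a₀ towards q, a₂ along τ and a₁ = a₂ × a₀. Then (q − p) × τ = −‖τ‖a₁ points to
  -- the side −1, where the count is larger.
  set a : Fin 3 → E3 := ![q - p, cross (‖τ‖⁻¹ • τ) (q - p), ‖τ‖⁻¹ • τ] with ha_def
  have ha : IsFrame a := by
    refine isFrame_of he (by rw [norm_smul, norm_inv, norm_norm, inv_mul_cancel₀ hτn.ne']) ?_
    rw [inner_smul_right]
    exact mul_eq_zero_of_right _ (inner_fderiv_sphereProj_self (hfp x) _)
  have ha0 : a 0 = q - p := rfl
  have hτa : τ = ‖τ‖ • a 2 := by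
    change τ = ‖τ‖ • ‖τ‖⁻¹ • τ
    rw [smul_inv_smul₀ hτn.ne']
  have hm : cross (q - p) τ = -(‖τ‖ • a 1) := by
    conv_lhs => rw [hτa, cross_smul_right, cross_swap, smul_neg]
    rfl
  -- the base point in gnomonic coordinates
  have hi : ∀ i, (inner ℝ (a i) (q - p) : ℝ) = if i = 0 then 1 else 0 := fun i => by
    rw [← ha0, ha.inner_eq]
  have hq0 : 0 < (inner ℝ (a 0) (q - p) : ℝ) := by rw [hi]; norm_num
  have hq1 : gno a 1 (q - p) = 0 := by simp [gno, hi]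
  have hq2 : gno a 2 (q - p) = 0 := by simp [gno, hi]
  have hiff : ∀ y, sphereProj p (f y) = q ↔ 0 < (inner ℝ (a 0) (f y - p) : ℝ) ∧
      gno a 1 (f y - p) = 0 ∧ gno a 2 (f y - p) = 0 := fun y => by
    rw [ha.sphereProj_eq_iff (hfp y) he hq0, hq1, hq2]
  obtain ⟨hx0, hx1, hx2⟩ := (hiff x).1 rfl
  have hx2' : (inner ℝ (a 2) (f x - p) : ℝ) = 0 := (div_eq_zero_iff.1 hx2).resolve_right hx0.ne'
  -- the sign of the tangent
  have hv1 : v = v 1 • bv1 := eq_smul_bv1 hv.1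
  have hpos : 0 < v 1 * (inner ℝ (a 2) (md f x bv1) : ℝ) := by
    have h1 : (inner ℝ (a 2) τ : ℝ) = ‖τ‖ := by
      conv_lhs => rw [hτa, inner_smul_right, ha.inner_eq, if_pos rfl, mul_one]
    have h2 : (inner ℝ (a 2) τ : ℝ) = ‖f x - p‖⁻¹ * inner ℝ (a 2) (md f x v) :=
      inner_fderiv_sphereProj (hfp x) hx2' _
    rw [hv1, map_smul, inner_smul_right] at h2
    rw [h1] at h2
    exact (mul_pos_iff_of_pos_left (inv_pos.2 (norm_pos_iff.2 (sub_ne_zero.2 (hfp x))))).1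
      (h2 ▸ hτn)
  have hv10 : v 1 ≠ 0 := left_ne_zero_of_mul hpos.ne'
  have habs : 0 < |v 1|⁻¹ := inv_pos.2 (abs_pos.2 hv10)
  -- The sign σ of v₁ compares the chart parameter of the arc with the positive boundary direction;
  -- both that direction and y₂ increase along τ.
  obtain ⟨η, r, δ, hb⟩ := hM.exists_isBoundaryBox ha hp hx hx0 hx1 hx2
    (fun y hy h0 h1 h2 => hE.once y hy x hx (((hiff y).2 ⟨h0, h1, h2⟩).symm ▸ hxE)
      ((hiff y).2 ⟨h0, h1, h2⟩)) (σ := |v 1|⁻¹ * v 1)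
    (by rw [abs_mul, abs_inv, abs_abs, inv_mul_cancel₀ (abs_ne_zero.2 hv10)])
    (by
      rw [deriv_arcGno hM hx hx0 hx2']
      have := mul_pos (mul_pos habs (inv_pos.2 hx0)) hpos
      linarith)
    (by
      have := mul_pos habs (neg_pos.2 (hv.mul_omega_neg hM hv10))
      linarith)
  have harc : arc x (extChartAt (𝓡∂ 2) x x 1) = x :=
    arc_boundary (mem_extChartAt_source (I := 𝓡∂ 2) x) hx
  have hc1 : arcGno a f p x 1 (extChartAt (𝓡∂ 2) x x 1) = 0 := by rw [arcGno, harc, hx1]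
  have hc2 : arcGno a f p x 2 (extChartAt (𝓡∂ 2) x x 1) = 0 := by rw [arcGno, harc, hx2]
  have hqa : q = p + a 0 := (add_sub_cancel p q).symm
  rw [hm]
  rcases hb.region_sides ha hM hp hA hB hAB hq0 hq1 hq2 (hE.subset_left hxE)
    (hE.subset_right hxE) with ⟨h1, h2⟩ | ⟨h1, h2⟩
  · exact Or.inl ⟨hb.count_eq_add_one ha hM hp (fun z hz => hc z (h1 hz)) fun z hz => hd z (h2 hz),
      hb.pointsFromInto hτn hqa hc1 hc2 h1 h2⟩
  · exact Or.inr ⟨hb.count_eq_add_one ha hM hp (fun z hz => hd z (h1 hz)) fun z hz => hc z (h2 hz),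
      hb.pointsFromInto hτn hqa hc1 hc2 h1 h2⟩

end Jump

end

theorem lemma2 {N : Type*} [TopologicalSpace N] [ChartedSpace (EuclideanHalfSpace 2) N]
    [IsManifold (𝓡∂ 2) ∞ N] [CompactSpace N] [T2Space N]
    (f ν : N → E3) (hM : IsOrientedSurface f ν)
    (p : E3) (hp : p ∉ range f)
    (A B E : Set E3) (hA : IsRegion f p A) (hB : IsRegion f p B) (hAB : A ≠ B)
    (hE : IsCommonEdge f p A B E) :
    ∃ χA χB : ℤ, IsCountOn f ν p A χA ∧ IsCountOn f ν p B χB ∧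
      |χA - χB| = 1 ∧
      ∀ x ∈ (𝓡∂ 2).boundary N, sphereProj p (f x) ∈ E →
        ∀ v : EuclideanSpace ℝ (Fin 2), IsPosBoundaryTangent f ν x v → projTangent f p x v ≠ 0 →
          (χB < χA → PointsFromInto p (sphereProj p (f x))
            (cross (sphereProj p (f x) - p) (projTangent f p x v)) B A) ∧
          (χA < χB → PointsFromInto p (sphereProj p (f x))
            (cross (sphereProj p (f x) - p) (projTangent f p x v)) A B) := by
  obtain ⟨χA, hχA⟩ := hM.exists_region_count hp hA
  obtain ⟨χB, hχB⟩ := hM.exists_region_count hp hB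
  have hjump := fun x hx hxE v hv hτ => hM.count_jump (x := x) (v := v) hp hA hB hAB hE hχA hχB
    hx hxE hv hτ
  refine ⟨χA, χB, hM.isCountOn hp hχA, hM.isCountOn hp hχB, ?_, fun x hx hxE v hv hτ => ?_⟩
  -- The absolute value of the jump needs one regular point of E. A positive tangent there is a
  -- nonzero multiple of the chart direction `bv1`, so its projection is nonzero too.
  · obtain ⟨x, hx, hxE, hτ⟩ := hM.exists_projTangent_ne_zero hp hE
    have hτ' : projTangent f p x (-omega f ν x • bv1) ≠ 0 := by
      rw [projTangent_smul]
      exact smul_ne_zero (neg_ne_zero.2 (hM.omega_ne_zero x)) hτ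
    rcases hjump x hx hxE _ (hM.exists_isPosBoundaryTangent x) hτ' with ⟨h, -⟩ | ⟨h, -⟩
    · rw [h, add_sub_cancel_left, abs_one]
    · rw [h, sub_add_cancel_left, abs_neg, abs_one]
  · rcases hjump x hx hxE v hv hτ with ⟨h, hP⟩ | ⟨h, hP⟩
    · exact ⟨fun _ => hP, fun h' => by omega⟩
    · exact ⟨fun h' => by omega, fun _ => hP⟩
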